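/- **Model.** We use the word RAM with word length $w$: a program has constantly many registers, and a memory of words that are addressed by words; registers and memory words hold integers in $\{0,\dots,2^w-1\}$ and all except two of the registers (holding $n$ and $w$) are initially $0$. A step is one of the following: moving a word or a constant to a register, addition, subtraction and multiplication modulo $2^w$, integer division with remainder, bitwise and/or/xor, left and right shift, reading or writing a memory word, comparing two words, one access to the input, and appending a word to a write-only output stream. The input is a directed graph $G=(V,E)$, $E\subseteq V\times V$, with $n\ge 1$ vertices (numbered consecutively) and $m=|E|$ edges. It is available through read-only in/out adjacency arrays with cross links: for each vertex one can access its outdegree and indegree, its $i$th outneighbor and its $i$th inneighbor, and, for each edge $(u,v)$, the position of $u$ in the array of inneighbors of $v$ from the position of $v$ in the array of outneighbors of $u$, and vice versa; the order within each array is arbitrary. The number of bits (of working memory) used by a computation is $w$ times the sum of the number of registers and the least $s$ such that all memory accesses are to addresses smaller than $s$. The word length is $w=\Theta(\log n)$, i.e. $c\lceil\log(n+1)\rceil\le w\le\kappa\lceil\log(n+1)\rceil$, where $c$ is a suitable constant that depends only on the algorithm, and $\kappa$ is an arbitrary constant, on which the constants in the space bounds may depend. **Notation.** $\log$ is the binary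 logarithm. For a directed graph $G=(V,E)$ let $L_0^{\mathrm{in}}(G)=\sum_{v\in V,\ d_v\ge 2}\lceil\log d_v\rceil$, where $d_v$ is the indegree of $v$. A topological sorting of $G$ is an output of all the vertices of $G$, each exactly once, such that for each $(u,v)\in E$, $u$ is output before $v$. **Theorem.** There is an algorithm (a single word-RAM program) that, for every directed acyclic input graph $G$ with $n\ge 1$ vertices and $m$ edges, computes a topological sorting of $G$ in $O(n+m)$ time and, for $n\ge 3$, uses at most any of the following numbers of bits of working memory: (a) $\bigl(2n+2L_0^{\mathrm{in}}(G)\bigr)\bigl(1+O(\log\log n/\log n)\bigr)$; (b) $\bigl(2n+\tfrac43 m\bigr)\bigl(1+O(\log\log n/\log n)\bigr)$; (c) $2n\log\bigl(2+\tfrac{4m}{n}\bigr)\bigl(1+O(\log\log n/\log n)\bigr)$. The correctness and the time bound, with a constant independent of $w$, hold for every $w\ge c\lceil\log(n+1)\rceil$. -/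

import Mathlib

/-! ### Directed graphs and their representation -/

namespace Digraph

variable {n : ℕ}

/-- A directed graph is acyclic if no vertex lies on a (nonempty) directed closed walk. -/
def Acyclic (G : Digraph (Fin n)) : Prop :=
  ∀ v, ¬ Relation.TransGen G.Adj v v

/-- The number `m` of edges. -/
noncomputable def edgeCount (G : Digraph (Fin n)) : ℕ :=
  {e : Fin n × Fin n | G.Adj e.1 e.2}.ncard

/-- The indegree of a vertex. -/
noncomputable def inDeg (G : Digraph (Fin n)) (v : Fin n) : ℕ :=
  {u : Fin n | G.Adj u v}.ncard

/-- `L_k^in(G)`: the sum of `⌈log₂ (d_v + k)⌉` over all vertices `v` whose indegree `d_v`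
satisfies `d_v + k ≥ 2`. -/
noncomputable def inL (G : Digraph (Fin n)) (k : ℤ) : ℤ :=
  ∑ v with 2 ≤ (G.inDeg v : ℤ) + k, ⌈Real.logb 2 (((G.inDeg v : ℤ) + k : ℤ) : ℝ)⌉

/-- A list of vertices is a topological sorting if it contains every vertex exactly once and
`u` precedes `v` for every edge `(u, v)`. -/
def IsTopologicalSorting (G : Digraph (Fin n)) (l : List (Fin n)) : Prop :=
  l.Nodup ∧ (∀ v, v ∈ l) ∧ ∀ u v, G.Adj u v → l.idxOf u < l.idxOf v

/-- A representation of `G` by in/out adjacency arrays: `out u` lists the outneighbors of `u`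
and `inn v` lists the inneighbors of `v`, each neighbor once, in an arbitrary order. -/
structure AdjArrays (G : Digraph (Fin n)) where
  out : Fin n → List (Fin n)
  inn : Fin n → List (Fin n)
  out_nodup : ∀ u, (out u).Nodup
  inn_nodup : ∀ v, (inn v).Nodup
  mem_out : ∀ u v, v ∈ out u ↔ G.Adj u v
  mem_inn : ∀ u v, u ∈ inn v ↔ G.Adj u v

end Digraph

/-! ### The word RAM -/

namespace WordRAM

/-- The access functions of the read-only input. -/
inductive Query where
  | outDeg | inDeg | outHead | inHead | outMate | inMate

/-- The value of an access function at vertex `u` and array position `i` (vertices and positions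
are numbered from `0`; the degree queries ignore `i`; queries outside of the arrays yield `0`).
`outMate u i` is, for the edge `(u, v)` where `v` is the entry number `i` of `out u`, the
position of `u` in `inn v`, and symmetrically for `inMate`. -/
def answer {n : ℕ} {G : Digraph (Fin n)} (A : G.AdjArrays) (q : Query) (u i : ℕ) : ℕ :=
  if h : u < n then
    match q with
    | .outDeg => (A.out ⟨u, h⟩).length
    | .inDeg => (A.inn ⟨u, h⟩).length
    | .outHead => ((A.out ⟨u, h⟩)[i]?).elim 0 fun v => (v : ℕ)
    | .inHead => ((A.inn ⟨u, h⟩)[i]?).elim 0 fun v => (v : ℕ)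
    | .outMate => ((A.out ⟨u, h⟩)[i]?).elim 0 fun v => (A.inn v).idxOf ⟨u, h⟩
    | .inMate => ((A.inn ⟨u, h⟩)[i]?).elim 0 fun v => (A.out v).idxOf ⟨u, h⟩
  else 0

/-- An operand is a register or an immediate constant. -/
inductive Operand where
  | reg (r : ℕ)
  | lit (k : ℕ)

/-- The arithmetic and bitwise operations on words. -/
inductive Op where
  | add | sub | mul | div | mod | and | or | xor | shl | shr

/-- Comparisons of (unsigned) words. -/
inductive Cond where
  | eq (a b : Operand)
  | lt (a b : Operand)

/-- The instructions: `move r a` is `r := a`; `arith r o a b` is `r := a o b`;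
`load r a` is `r := M[a]`; `store a b` is `M[a] := b`; `query r q u i` is `r := q(u, i)`;
`emit a` appends `a` to the write-only output stream. -/
inductive Instr where
  | move (r : ℕ) (a : Operand)
  | arith (r : ℕ) (o : Op) (a b : Operand)
  | load (r : ℕ) (a : Operand)
  | store (a b : Operand)
  | query (r : ℕ) (q : Query) (u i : Operand)
  | emit (a : Operand)

/-- Programs: instructions, sequential composition, conditionals and while loops. -/
inductive Program where
  | instr (i : Instr)
  | seq (p q : Program)
  | branch (c : Cond) (p q : Program)
  | loop (c : Cond) (p : Program)

/-- A state of the machine with word length `w`. Besides the registers, the memory words (which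
are addressed by words) and the output written so far, it records in `space` the least `s` such
that all memory accesses so far, reading or writing, were to addresses smaller than `s`. -/
structure State (w : ℕ) where
  regs : ℕ → BitVec w
  mem : BitVec w → BitVec w
  out : List (BitVec w)
  space : ℕ

/-- Initially register `0` holds `n`, register `1` holds the word length, everything else is
zero, and the output is empty. -/
def State.start (w n : ℕ) : State w where
  regs r := if r = 0 then BitVec.ofNat w n else if r = 1 then BitVec.ofNat w w else 0#w
  mem _ := 0#w
  out := []
  space := 0

variable {w : ℕ}

def Operand.eval (s : State w) : Operand → BitVec w
  | .reg r => s.regs r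
  | .lit k => BitVec.ofNat w k

/-- Addition, subtraction, multiplication and left shift are modulo `2 ^ w`; division and
remainder are unsigned. -/
def Op.eval (a b : BitVec w) : Op → BitVec w
  | .add => a + b
  | .sub => a - b
  | .mul => a * b
  | .div => a / b
  | .mod => a % b
  | .and => a &&& b
  | .or => a ||| b
  | .xor => a ^^^ b
  | .shl => a <<< b.toNat
  | .shr => a >>> b.toNat

def Cond.Holds (s : State w) : Cond → Prop
  | .eq a b => a.eval s = b.eval s
  | .lt a b => (a.eval s).toNat < (b.eval s).toNat

def State.setReg (s : State w) (r : ℕ) (x : BitVec w) : State w :=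
  { s with regs := Function.update s.regs r x }

/-- Record an access to the memory word with address `a`. -/
def State.touch (s : State w) (a : BitVec w) : State w :=
  { s with space := max s.space (a.toNat + 1) }

def State.setMem (s : State w) (a x : BitVec w) : State w :=
  { s with mem := Function.update s.mem a x }

/-- The effect of one instruction; `ans` gives the access functions of the input. -/
def Instr.exec (ans : Query → ℕ → ℕ → ℕ) (s : State w) : Instr → State w
  | .move r a => s.setReg r (a.eval s)
  | .arith r o a b => s.setReg r (o.eval (a.eval s) (b.eval s))
  | .load r a => (s.touch (a.eval s)).setReg r (s.mem (a.eval s))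
  | .store a b => (s.touch (a.eval s)).setMem (a.eval s) (b.eval s)
  | .query r q u i => s.setReg r (BitVec.ofNat w (ans q (u.eval s).toNat (i.eval s).toNat))
  | .emit a => { s with out := s.out ++ [a.eval s] }

/-- `Runs ans P s t s'`: started in state `s`, the program `P` terminates in state `s'` after
exactly `t` steps, where each instruction and each evaluation of a condition is one step. -/
inductive Runs (ans : Query → ℕ → ℕ → ℕ) : Program → State w → ℕ → State w → Prop
  | instr (i : Instr) (s : State w) : Runs ans (.instr i) s 1 (i.exec ans s)
  | seq {p q : Program} {s s₁ s₂ : State w} {t₁ t₂ : ℕ}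
      (hp : Runs ans p s t₁ s₁) (hq : Runs ans q s₁ t₂ s₂) :
      Runs ans (.seq p q) s (t₁ + t₂) s₂
  | branch_true {c : Cond} {p q : Program} {s s₁ : State w} {t : ℕ}
      (hc : c.Holds s) (hp : Runs ans p s t s₁) :
      Runs ans (.branch c p q) s (1 + t) s₁
  | branch_false {c : Cond} {p q : Program} {s s₁ : State w} {t : ℕ}
      (hc : ¬ c.Holds s) (hq : Runs ans q s t s₁) :
      Runs ans (.branch c p q) s (1 + t) s₁
  | loop_true {c : Cond} {p : Program} {s s₁ s₂ : State w} {t₁ t₂ : ℕ}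
      (hc : c.Holds s) (hp : Runs ans p s t₁ s₁) (hl : Runs ans (.loop c p) s₁ t₂ s₂) :
      Runs ans (.loop c p) s (1 + t₁ + t₂) s₂
  | loop_false {c : Cond} {p : Program} {s : State w} (hc : ¬ c.Holds s) :
      Runs ans (.loop c p) s 1 s

/-! The number of registers of a program: one more than the largest register mentioned. -/

def Operand.numRegs : Operand → ℕ
  | .reg r => r + 1
  | .lit _ => 0

def Cond.numRegs : Cond → ℕ
  | .eq a b => max a.numRegs b.numRegs
  | .lt a b => max a.numRegs b.numRegs

def Instr.numRegs : Instr → ℕ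
  | .move r a => max (r + 1) a.numRegs
  | .arith r _ a b => max (r + 1) (max a.numRegs b.numRegs)
  | .load r a => max (r + 1) a.numRegs
  | .store a b => max a.numRegs b.numRegs
  | .query r _ u i => max (r + 1) (max u.numRegs i.numRegs)
  | .emit a => a.numRegs

def Program.numRegs : Program → ℕ
  | .instr i => i.numRegs
  | .seq p q => max p.numRegs q.numRegs
  | .branch c p q => max c.numRegs (max p.numRegs q.numRegs)
  | .loop c p => max c.numRegs p.numRegs

/-- The number of bits of working memory used by a run of `P` that ends in state `s`: `w` bits
for every register of `P` and for every memory word up to the highest one accessed. -/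
def bitsUsed (P : Program) (s : State w) : ℕ :=
  (P.numRegs + s.space) * w

end WordRAM

/-! The algorithm is Kahn's, run depth-first without a stack. Every vertex `v` of indegree `d` has a
counter with the initial value `d - 1`, which has `⌈log d⌉` bits. When an edge into `v` is followed,
the counter of `v` is decremented; if it is `0` already, the edge is the last one into `v`, so `v`
is output and the traversal proceeds to `v`. The counter of `v` is then no longer needed, and it is
overwritten by the position, in the array of the inneighbors of `v`, of the vertex from which `v`
was entered, a number smaller than `d`. With the cross links of the input, this is enough to return
from `v` to that vertex and to the next edge there. The lemmas on `Inv` show that this is correct;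
in the end every vertex was output, since a vertex that was not would have an inneighbor that was
not (`Inv.sorted`). Counting down a binary counter from `d - 1` takes `O(d)` time (`psi_le`), and so
the potential `pot` bounds the running time by `O(n + m)`.

The counters have different lengths, and they have to be found without pointers. The bits of the
counter of `v` belong to the nodes of a chain, which starts at the node `v`; all nodes are numbered
in the order of their levels in the chains, and on each level in the order of the vertices. A marker
bit tells for each node whether it has a successor. As the order on each level is inherited by the
next one, the successor of the node `p` is the node number `n + r`, where `r` is the rank of `p`,
that is, the number of marked nodes before `p` (`rk_pos`). The rank is computed in constant time
with a directory of two levels and a table (`rankE_spec`). Since one bit after the other of a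
counter is visited, the operations on counters take constant time per bit (`decS_spec`,
`writeS_spec`, `readS_spec`).

If `L` is the number of bits of all counters, there are `n + L` marker bits and `L` counter bits.
The directory takes `O(log log n)` bits for every `Ω(log n)` nodes, and everything else is of lower
order (`Sizes.bits_le`). Hence about `n + 2 L ≤ 2 n + 2 L` bits suffice. The other two bounds follow
from `⌈log d⌉ ≤ 2 d / 3` and from `1 + ⌈log d⌉ ≤ log (2 + 4 d)` together with the concavity of the
logarithm.

The program is written in a small imperative language whose values are natural numbers. It is
compiled to the word RAM, and `Tri` is a program logic for total correctness with time bounds; the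
absence of overflow and of accesses outside of the memory area is a part of what is proved. -/

namespace TopoSort
open WordRAM

/-! ### A small imperative language over the natural numbers and its compilation -/

/-- Expressions of the source language. Variable `x < 40` lives in register `x`; the registers
from `40` on hold intermediate results. `mem a` reads the memory word with address `a`, and
`ask q u i` accesses the input. -/
inductive Expr where
  | var (x : ℕ)
  | lit (k : ℕ)
  | bin (o : Op) (a b : Expr)
  | mem (a : Expr)
  | ask (q : Query) (u i : Expr)

/-- Statements of the source language. `cond a b p q` branches on `a < b`, and `while a b p`
repeats `p` as long as `a < b`. -/
inductive Stmt where
  | assign (x : ℕ) (e : Expr)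
  | store (a e : Expr)
  | emit (e : Expr)
  | skip
  | seq (p q : Stmt)
  | cond (a b : Expr) (p q : Stmt)
  | while (a b : Expr) (p : Stmt)

/-- A state of the source language: variables, memory and output hold natural numbers. -/
structure St where
  v : ℕ → ℕ
  m : ℕ → ℕ
  o : List ℕ

/-- The data that the semantics depends on: the word length, the input, and a bound on the
addresses that may be accessed. -/
structure Env where
  w : ℕ
  ans : Query → ℕ → ℕ → ℕ
  sp : ℕ
  ans_lt : ∀ q u i, ans q u i < 2 ^ w

namespace St

/-- Assign the value `a` to the variable `x`. -/
def set (σ : St) (x a : ℕ) : St := { σ with v := Function.update σ.v x a }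

/-- Write the value `x` to the memory address `a`. -/
def put (σ : St) (a x : ℕ) : St := { σ with m := Function.update σ.m a x }

/-- Append the value `x` to the output. -/
def say (σ : St) (x : ℕ) : St := { σ with o := σ.o ++ [x] }

@[simp] theorem set_v (σ : St) (x a y : ℕ) : (σ.set x a).v y = if y = x then a else σ.v y := by
  simp [set, Function.update_apply]
@[simp] theorem set_m (σ : St) (x a : ℕ) : (σ.set x a).m = σ.m := rfl
@[simp] theorem set_o (σ : St) (x a : ℕ) : (σ.set x a).o = σ.o := rfl
@[simp] theorem put_v (σ : St) (x a : ℕ) : (σ.put x a).v = σ.v := rfl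
@[simp] theorem put_m (σ : St) (x a : ℕ) : (σ.put x a).m = Function.update σ.m x a := rfl
@[simp] theorem put_o (σ : St) (x a : ℕ) : (σ.put x a).o = σ.o := rfl
@[simp] theorem say_v (σ : St) (x : ℕ) : (σ.say x).v = σ.v := rfl
@[simp] theorem say_m (σ : St) (x : ℕ) : (σ.say x).m = σ.m := rfl
@[simp] theorem say_o (σ : St) (x : ℕ) : (σ.say x).o = σ.o ++ [x] := rfl

end St

/-- The operations on natural numbers, without reduction modulo `2 ^ w`. -/
@[simp] def natOp : Op → ℕ → ℕ → ℕ
  | .add, a, b => a + b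
  | .sub, a, b => a - b
  | .mul, a, b => a * b
  | .div, a, b => a / b
  | .mod, a, b => a % b
  | .and, a, b => a &&& b
  | .or, a, b => a ||| b
  | .xor, a, b => a ^^^ b
  | .shl, a, b => a <<< b
  | .shr, a, b => a >>> b

/-- No overflow occurs, so that the operation on words agrees with the one on naturals. -/
@[simp] def Fits (w : ℕ) : Op → ℕ → ℕ → Prop
  | .add, a, b => a + b < 2 ^ w
  | .sub, a, b => b ≤ a
  | .mul, a, b => a * b < 2 ^ w
  | .shl, a, b => a <<< b < 2 ^ w
  | _, _, _ => True

namespace Expr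

/-- The value of an expression, computed over the natural numbers. -/
def eval (E : Env) (σ : St) : Expr → ℕ
  | .var x => σ.v x
  | .lit k => k
  | .bin o a b => natOp o (a.eval E σ) (b.eval E σ)
  | .mem a => σ.m (a.eval E σ)
  | .ask q u i => E.ans q (u.eval E σ) (i.eval E σ)

/-- The expression can be evaluated without overflow and without leaving the memory area. -/
def Ok (E : Env) (σ : St) : Expr → Prop
  | .var x => x < 40
  | .lit k => k < 2 ^ E.w
  | .bin o a b => a.Ok E σ ∧ b.Ok E σ ∧ Fits E.w o (a.eval E σ) (b.eval E σ)
  | .mem a => a.Ok E σ ∧ a.eval E σ < E.sp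
  | .ask _ u i => u.Ok E σ ∧ i.Ok E σ

/-- The number of instructions that evaluate the expression. -/
def cost : Expr → ℕ
  | .var _ => 1
  | .lit _ => 1
  | .bin _ a b => a.cost + (b.cost + 1)
  | .mem a => a.cost + 1
  | .ask _ u i => u.cost + (i.cost + 1)

/-- Code that leaves the value of the expression in register `40 + d`, changing only the
registers from `40 + d` on. -/
def compile : Expr → ℕ → Program
  | .var x, d => .instr (.move (40 + d) (.reg x))
  | .lit k, d => .instr (.move (40 + d) (.lit k))
  | .bin o a b, d => .seq (a.compile d) (.seq (b.compile (d + 1))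
      (.instr (.arith (40 + d) o (.reg (40 + d)) (.reg (40 + (d + 1))))))
  | .mem a, d => .seq (a.compile d) (.instr (.load (40 + d) (.reg (40 + d))))
  | .ask q u i, d => .seq (u.compile d) (.seq (i.compile (d + 1))
      (.instr (.query (40 + d) q (.reg (40 + d)) (.reg (40 + (d + 1))))))

end Expr

/-- The machine state `s` represents the source state `σ`. -/
structure Abs (E : Env) (σ : St) (s : State E.w) : Prop where
  regs : ∀ x < 40, (s.regs x).toNat = σ.v x
  mem : ∀ a, (s.mem a).toNat = σ.m a.toNat
  out : s.out = σ.o.map (BitVec.ofNat E.w)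
  space : s.space ≤ E.sp

theorem Op.eval_toNat {w : ℕ} (o : Op) (a b : BitVec w) (h : Fits w o a.toNat b.toNat) :
    (o.eval a b).toNat = natOp o a.toNat b.toNat := by
  cases o <;> simp only [Fits] at h <;> simp only [Op.eval, natOp]
  · rw [BitVec.toNat_add, Nat.mod_eq_of_lt h]
  · rw [BitVec.toNat_sub_of_le (by simpa [BitVec.le_def] using h)]
  · rw [BitVec.toNat_mul, Nat.mod_eq_of_lt h]
  · exact BitVec.toNat_udiv
  · exact BitVec.toNat_umod
  · exact BitVec.toNat_and ..
  · exact BitVec.toNat_or ..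
  · exact BitVec.toNat_xor ..
  · rw [BitVec.toNat_shiftLeft, Nat.mod_eq_of_lt h]
  · exact BitVec.toNat_ushiftRight ..

theorem Abs.setReg {E : Env} {σ : St} {s : State E.w} (h : Abs E σ s) (r : ℕ) (x : BitVec E.w)
    (hr : 40 ≤ r) : Abs E σ (s.setReg r x) :=
  ⟨fun y hy => by
    simpa [State.setReg, Function.update_apply, show y ≠ r by omega] using h.regs y hy,
    h.mem, h.out, h.space⟩

theorem Abs.touch {E : Env} {σ : St} {s : State E.w} (h : Abs E σ s) (a : BitVec E.w)
    (ha : a.toNat < E.sp) : Abs E σ (s.touch a) :=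
  ⟨h.regs, h.mem, h.out, max_le h.space ha⟩

/-- The code of an expression is correct and runs in exactly `cost` steps, because it contains no
branches. Registers below `40 + d` are preserved, so the values of operands survive. -/
theorem Expr.compile_spec {E : Env} {σ : St} (e : Expr) (d : ℕ) (s : State E.w) (h : Abs E σ s)
    (he : e.Ok E σ) : ∃ s', Runs E.ans (e.compile d) s e.cost s' ∧ Abs E σ s' ∧
      (s'.regs (40 + d)).toNat = e.eval E σ ∧ ∀ r < 40 + d, s'.regs r = s.regs r := by
  induction e generalizing d s with
  | var x =>
    refine ⟨_, .instr _ _, h.setReg _ _ (by omega), ?_, fun r hr => ?_⟩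
    · simpa [Instr.exec, State.setReg, Operand.eval, Expr.eval] using h.regs x he
    · simp [Instr.exec, State.setReg, Function.update_apply]; intro; omega
  | lit k =>
    refine ⟨_, .instr _ _, h.setReg _ _ (by omega), ?_, fun r hr => ?_⟩
    · simpa [Instr.exec, State.setReg, Operand.eval, Expr.eval] using Nat.mod_eq_of_lt he
    · simp [Instr.exec, State.setReg, Function.update_apply]; intro; omega
  | bin o a b iha ihb =>
    obtain ⟨s1, r1, A1, e1, f1⟩ := iha d s h he.1
    obtain ⟨s2, r2, A2, e2, f2⟩ := ihb (d + 1) s1 A1 he.2.1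
    refine ⟨_, .seq r1 (.seq r2 (.instr _ _)), A2.setReg _ _ (by omega), ?_, fun r hr => ?_⟩
    · have e1' : (s2.regs (40 + d)).toNat = a.eval E σ := by rw [f2 _ (by omega), e1]
      simp only [Instr.exec, State.setReg, Operand.eval, Function.update_self, Expr.eval]
      rw [Op.eval_toNat _ _ _ (by rw [e1', e2]; exact he.2.2), e1', e2]
    · rw [← f1 r hr, ← f2 r (by omega)]
      simp [Instr.exec, State.setReg, Function.update_apply]; intro; omega
  | mem a iha =>
    obtain ⟨s1, r1, A1, e1, f1⟩ := iha d s h he.1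
    refine ⟨_, .seq r1 (.instr _ _), (A1.touch _ ?_).setReg _ _ (by omega), ?_, fun r hr => ?_⟩
    · simp only [Operand.eval]; rw [e1]; exact he.2
    · simp only [Instr.exec, State.setReg, Operand.eval, Function.update_self, Expr.eval]
      rw [A1.mem, e1]
    · rw [← f1 r hr]
      simp [Instr.exec, State.setReg, State.touch, Function.update_apply]; intro; omega
  | ask q a b iha ihb =>
    obtain ⟨s1, r1, A1, e1, f1⟩ := iha d s h he.1
    obtain ⟨s2, r2, A2, e2, f2⟩ := ihb (d + 1) s1 A1 he.2
    refine ⟨_, .seq r1 (.seq r2 (.instr _ _)), A2.setReg _ _ (by omega), ?_, fun r hr => ?_⟩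
    · have e1' : (s2.regs (40 + d)).toNat = a.eval E σ := by rw [f2 _ (by omega), e1]
      simp only [Instr.exec, State.setReg, Operand.eval, Function.update_self, Expr.eval]
      rw [e1', e2, BitVec.toNat_ofNat, Nat.mod_eq_of_lt (E.ans_lt _ _ _)]
    · rw [← f1 r hr, ← f2 r (by omega)]
      simp [Instr.exec, State.setReg, Function.update_apply]; intro; omega

namespace Stmt

/-- Code that evaluates `a` and `b` into the registers `40` and `41`. -/
def operands (a b : Expr) : Program := .seq (a.compile 0) (b.compile 1)

/-- The translation of statements to programs of the word RAM. A loop evaluates the operands of its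
condition before the loop and at the end of every iteration. -/
def compile : Stmt → Program
  | .assign x e => .seq (e.compile 0) (.instr (.move x (.reg 40)))
  | .store a e => .seq (operands a e) (.instr (.store (.reg 40) (.reg 41)))
  | .emit e => .seq (e.compile 0) (.instr (.emit (.reg 40)))
  | .skip => .instr (.move 40 (.lit 0))
  | .seq p q => .seq p.compile q.compile
  | .cond a b p q => .seq (operands a b) (.branch (.lt (.reg 40) (.reg 41)) p.compile q.compile)
  | .while a b p => .seq (operands a b)
      (.loop (.lt (.reg 40) (.reg 41)) (.seq p.compile (operands a b)))

/-- A bound on the number of instructions that one step of the source program takes. -/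
def wt : Stmt → ℕ
  | .assign _ e => e.cost + 1
  | .store a e => a.cost + e.cost + 1
  | .emit e => e.cost + 1
  | .skip => 1
  | .seq p q => max p.wt q.wt
  | .cond a b p q => max (a.cost + b.cost + 1) (max p.wt q.wt)
  | .while a b p => max (a.cost + b.cost + 1) p.wt

end Stmt

theorem operands_spec {E : Env} {σ : St} (a b : Expr) (s : State E.w) (h : Abs E σ s)
    (ha : a.Ok E σ) (hb : b.Ok E σ) :
    ∃ s', Runs E.ans (Stmt.operands a b) s (a.cost + b.cost) s' ∧ Abs E σ s' ∧
      (s'.regs 40).toNat = a.eval E σ ∧ (s'.regs 41).toNat = b.eval E σ := by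
  obtain ⟨s1, r1, A1, e1, f1⟩ := a.compile_spec 0 s h ha
  obtain ⟨s2, r2, A2, e2, f2⟩ := b.compile_spec 1 s1 A1 hb
  exact ⟨s2, .seq r1 r2, A2, by rw [f2 40 (by omega)]; exact e1, e2⟩

/-- Total correctness with time: started in a state that represents `σ`, the compiled program
terminates in a state that represents some `σ'`, and `Q t σ'` holds for a number `t` of steps of
the source program, each of which stands for at most `S.wt` instructions. -/
def Tri (E : Env) (S : Stmt) (σ : St) (Q : ℕ → St → Prop) : Prop :=
  ∀ s : State E.w, Abs E σ s → ∃ t t' σ' s', Runs E.ans S.compile s t' s' ∧ t' ≤ t * S.wt ∧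
    Abs E σ' s' ∧ Q t σ'

namespace Tri

variable {E : Env} {σ : St} {Q Q' : ℕ → St → Prop}

theorem mono {S : Stmt} (h : Tri E S σ Q) (hQ : ∀ t σ', Q t σ' → Q' t σ') : Tri E S σ Q' := by
  intro s hs
  obtain ⟨t, t', σ', s', h1, h2, h3, h4⟩ := h s hs
  exact ⟨t, t', σ', s', h1, h2, h3, hQ _ _ h4⟩

theorem assign {x : ℕ} {e : Expr} (he : e.Ok E σ)
    (hQ : Q 1 (σ.set x (e.eval E σ))) : Tri E (.assign x e) σ Q := by
  intro s hs
  obtain ⟨s1, r1, A1, e1, f1⟩ := e.compile_spec 0 s hs he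
  refine ⟨1, _, σ.set x _, _, .seq r1 (.instr _ _), by simp [Stmt.wt],
    ⟨fun y hy => ?_, A1.mem, A1.out, A1.space⟩, hQ⟩
  simp only [State.setReg, Function.update_apply, Operand.eval, St.set_v, Instr.exec]
  split_ifs
  · exact e1
  · exact A1.regs y hy

theorem store {a e : Expr} (ha : a.Ok E σ) (he : e.Ok E σ) (hsp : a.eval E σ < E.sp)
    (hQ : Q 1 (σ.put (a.eval E σ) (e.eval E σ))) : Tri E (.store a e) σ Q := by
  intro s hs
  obtain ⟨s1, r1, A1, e1, e2⟩ := operands_spec a e s hs ha he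
  have A2 := A1.touch (s1.regs 40) (by rw [e1]; exact hsp)
  refine ⟨1, _, σ.put _ _, _, .seq r1 (.instr _ _), by simp [Stmt.wt],
    ⟨A2.regs, fun y => ?_, A2.out, A2.space⟩, hQ⟩
  simp only [State.setMem, Function.update_apply, Operand.eval, St.put_m, Instr.exec, ← e1,
    BitVec.toNat_inj]
  split_ifs
  · exact e2
  · exact A1.mem y

theorem emit {e : Expr} (he : e.Ok E σ) (hQ : Q 1 (σ.say (e.eval E σ))) :
    Tri E (.emit e) σ Q := by
  intro s hs
  obtain ⟨s1, r1, A1, e1, f1⟩ := e.compile_spec 0 s hs he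
  refine ⟨1, _, σ.say _, _, .seq r1 (.instr _ _), by simp [Stmt.wt],
    ⟨A1.regs, A1.mem, ?_, A1.space⟩, hQ⟩
  simp only [Operand.eval, St.say_o, Instr.exec, List.map_append, A1.out, List.map_cons,
    List.map_nil, ← e1, BitVec.ofNat_toNat, BitVec.setWidth_eq]

theorem skip (hQ : Q 1 σ) : Tri E .skip σ Q := fun _ hs =>
  ⟨1, _, _, _, .instr _ _, by simp [Stmt.wt], hs.setReg _ _ le_rfl, hQ⟩

theorem seq {p q : Stmt} (h : Tri E p σ fun t σ' => Tri E q σ' fun t' => Q (t + t')) :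
    Tri E (.seq p q) σ Q := by
  intro s hs
  obtain ⟨t1, t1', σ1, s1, r1, l1, A1, h1⟩ := h s hs
  obtain ⟨t2, t2', σ2, s2, r2, l2, A2, h2⟩ := h1 s1 A1
  refine ⟨_, _, _, _, .seq r1 r2, ?_, A2, h2⟩
  rw [add_mul]
  exact add_le_add (l1.trans (Nat.mul_le_mul_left _ (le_max_left _ _)))
    (l2.trans (Nat.mul_le_mul_left _ (le_max_right _ _)))

theorem cond {a b : Expr} {p q : Stmt} (ha : a.Ok E σ) (hb : b.Ok E σ)
    (hp : a.eval E σ < b.eval E σ → Tri E p σ fun t => Q (1 + t))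
    (hq : ¬ a.eval E σ < b.eval E σ → Tri E q σ fun t => Q (1 + t)) :
    Tri E (.cond a b p q) σ Q := by
  intro s hs
  obtain ⟨s1, r1, A1, e1, e2⟩ := operands_spec a b s hs ha hb
  by_cases hc : a.eval E σ < b.eval E σ
  · obtain ⟨t, t', σ', s', r, l, A, h⟩ := hp hc s1 A1
    refine ⟨_, _, _, _, .seq r1 (.branch_true ?_ r), ?_, A, h⟩
    · simpa [Cond.Holds, Operand.eval, e1, e2] using hc
    · simp only [Stmt.wt, add_mul, one_mul, ← add_assoc]
      exact add_le_add (le_max_left _ _) (l.trans (Nat.mul_le_mul_left _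
        ((le_max_left _ _).trans (le_max_right _ _))))
  · obtain ⟨t, t', σ', s', r, l, A, h⟩ := hq hc s1 A1
    refine ⟨_, _, _, _, .seq r1 (.branch_false ?_ r), ?_, A, h⟩
    · simpa [Cond.Holds, Operand.eval, e1, e2] using hc
    · simp only [Stmt.wt, add_mul, one_mul, ← add_assoc]
      exact add_le_add (le_max_left _ _) (l.trans (Nat.mul_le_mul_left _
        ((le_max_right _ _).trans (le_max_right _ _))))

/-- The rule for loops: the invariant `I` relates the state to a ghost value, and the potential
`Φ` of the ghost value pays for the iterations. -/
theorem loop {α : Type*} (I : α → St → Prop) (Φ : α → ℕ) {a b : Expr} {p : Stmt}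
    (hok : ∀ g σ, I g σ → a.Ok E σ ∧ b.Ok E σ)
    (hp : ∀ g σ, I g σ → a.eval E σ < b.eval E σ →
      Tri E p σ fun t σ' => ∃ g', I g' σ' ∧ t + 1 + Φ g' ≤ Φ g) (g : α) (h : I g σ) :
    Tri E (.while a b p) σ fun t σ' =>
      ∃ g', I g' σ' ∧ ¬ a.eval E σ' < b.eval E σ' ∧ t + Φ g' ≤ Φ g + 1 := by
  -- the loop proper, whose operands have just been evaluated into the registers `40` and `41`
  have key : ∀ (n : ℕ) (g : α) (σ : St) (s : State E.w), Φ g ≤ n → I g σ → Abs E σ s →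
      (s.regs 40).toNat = a.eval E σ → (s.regs 41).toNat = b.eval E σ →
      ∃ t t' σ' s', Runs E.ans (.loop (.lt (.reg 40) (.reg 41))
          (.seq p.compile (Stmt.operands a b))) s t' s' ∧
        t' ≤ t * max (a.cost + b.cost + 1) p.wt + 1 ∧ Abs E σ' s' ∧
        ∃ g', I g' σ' ∧ ¬ a.eval E σ' < b.eval E σ' ∧ t + Φ g' ≤ Φ g := by
    intro n
    induction n using Nat.strong_induction_on with
    | _ n ih =>
    intro g σ s hn hI hA e1 e2
    by_cases hc : a.eval E σ < b.eval E σ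
    · obtain ⟨t, t', σ', s1, r, l, A1, g', hI', hΦ⟩ := hp g σ hI hc s hA
      obtain ⟨s2, r2, A2, e1', e2'⟩ := operands_spec a b s1 A1 (hok _ _ hI').1 (hok _ _ hI').2
      obtain ⟨t3, t3', σ3, s3, r3, l3, A3, g3, hI3, hc3, hΦ3⟩ :=
        ih (Φ g') (by omega) g' σ' s2 le_rfl hI' A2 e1' e2'
      refine ⟨t + 1 + t3, _, σ3, s3, .loop_true ?_ (.seq r r2) r3, ?_, A3, g3, hI3, hc3, by omega⟩
      · simpa [Cond.Holds, Operand.eval, e1, e2] using hc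
      · have h1 := l.trans (Nat.mul_le_mul_left t (le_max_right (a.cost + b.cost + 1) p.wt))
        have h2 := le_max_left (a.cost + b.cost + 1) p.wt
        simp only [add_mul, one_mul]
        omega
    · refine ⟨0, _, σ, s, .loop_false ?_, by omega, hA, g, hI, hc, by omega⟩
      simpa [Cond.Holds, Operand.eval, e1, e2] using hc
  intro s hs
  obtain ⟨s1, r1, A1, e1, e2⟩ := operands_spec a b s hs (hok _ _ h).1 (hok _ _ h).2
  obtain ⟨t, t', σ', s', r, l, A, g', hI, hc, hΦ⟩ := key _ g σ s1 le_rfl h A1 e1 e2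
  refine ⟨t + 1, _, _, _, .seq r1 r, ?_, A, g', hI, hc, by omega⟩
  have h2 := le_max_left (a.cost + b.cost + 1) p.wt
  simp only [Stmt.wt, add_mul, one_mul]
  omega

end Tri

/-! ### Chains of nodes in level order -/

/-- The number of vertices smaller than `v` whose chain reaches level `j`. -/
def cnt (c : ℕ → ℕ) (j v : ℕ) : ℕ := Nat.count (fun u => j ≤ c u) v

/-- The number of the first node on level `j`. -/
def start (c : ℕ → ℕ) (n j : ℕ) : ℕ := ∑ i ∈ Finset.range j, cnt c i n

/-- The number of the node on level `j` of the chain of the vertex `v`. The chain of `v` has one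
node on each of the levels `0, …, c v`. -/
def pos (c : ℕ → ℕ) (n v j : ℕ) : ℕ := start c n j + cnt c j v

/-- The node `p` has a successor on its chain. -/
def Mk (c : ℕ → ℕ) (n p : ℕ) : Prop := ∃ v < n, ∃ j < c v, pos c n v j = p

open Classical in
/-- The number of nodes before `p` that have a successor. -/
noncomputable def rk (c : ℕ → ℕ) (n p : ℕ) : ℕ := Nat.count (Mk c n) p

section
variable (c : ℕ → ℕ) (n : ℕ)

@[simp] theorem cnt_level_zero (v : ℕ) : cnt c 0 v = v := by simp [cnt, Nat.count_true]

@[simp] theorem cnt_zero (j : ℕ) : cnt c j 0 = 0 := by simp [cnt]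

theorem cnt_succ (j v : ℕ) : cnt c j (v + 1) = cnt c j v + if j ≤ c v then 1 else 0 := by
  simp [cnt, Nat.count_succ]

theorem cnt_mono (j : ℕ) {v v' : ℕ} (h : v ≤ v') : cnt c j v ≤ cnt c j v' :=
  Nat.count_monotone _ h

@[simp] theorem start_zero : start c n 0 = 0 := by simp [start]

theorem start_succ (j : ℕ) : start c n (j + 1) = start c n j + cnt c j n := by
  simp [start, Finset.sum_range_succ]

@[simp] theorem start_one : start c n 1 = n := by simp [start_succ]

theorem start_mono {i j : ℕ} (h : i ≤ j) : start c n i ≤ start c n j :=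
  Finset.sum_le_sum_of_subset (Finset.range_mono h)

@[simp] theorem pos_level_zero (v : ℕ) : pos c n v 0 = v := by simp [pos]

variable {c n}

theorem pos_lt {v j : ℕ} (hv : v < n) (hj : j ≤ c v) : pos c n v j < start c n (j + 1) := by
  have h1 := cnt_mono c j (show v + 1 ≤ n from hv)
  rw [cnt_succ, if_pos hj] at h1
  rw [pos, start_succ]; omega

theorem pos_inj {v j v' j' : ℕ} (hv : v < n) (hj : j ≤ c v) (hv' : v' < n) (hj' : j' ≤ c v')
    (h : pos c n v j = pos c n v' j') : v = v' ∧ j = j' := by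
  have e : j = j' := by
    rcases lt_trichotomy j j' with h1 | h1 | h1
    · have := pos_lt hv hj
      have := start_mono c n (show j + 1 ≤ j' from h1)
      have : start c n j' ≤ pos c n v' j' := Nat.le_add_right _ _
      omega
    · exact h1
    · have := pos_lt hv' hj'
      have := start_mono c n (show j' + 1 ≤ j from h1)
      have : start c n j ≤ pos c n v j := Nat.le_add_right _ _
      omega
  subst e
  refine ⟨?_, rfl⟩
  have h2 : cnt c j v = cnt c j v' := by simpa [pos] using h
  rcases lt_trichotomy v v' with h1 | h1 | h1
  · have := cnt_mono c j (show v + 1 ≤ v' from h1)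
    rw [cnt_succ, if_pos hj] at this; omega
  · exact h1
  · have := cnt_mono c j (show v' + 1 ≤ v from h1)
    rw [cnt_succ, if_pos hj'] at this; omega

theorem mk_pos {v j : ℕ} (hv : v < n) (hj : j ≤ c v) : Mk c n (pos c n v j) ↔ j < c v := by
  constructor
  · rintro ⟨v', hv', j', hj', e⟩
    obtain ⟨rfl, rfl⟩ := pos_inj hv' hj'.le hv hj e
    exact hj'
  · exact fun h => ⟨v, hv, j, h, rfl⟩

/-- Successors are numbered consecutively in the order of their predecessors. -/
theorem rk_start (j v : ℕ) (hv : v ≤ n) :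
    n + rk c n (start c n j + cnt c j v) = start c n (j + 1) + cnt c (j + 1) v := by
  induction j generalizing v with
  | zero =>
    induction v with
    | zero => simp [rk]
    | succ v ih =>
      have ih := ih (by omega)
      have h := mk_pos (c := c) (j := 0) (show v < n from hv) (Nat.zero_le _)
      simp only [pos, start_zero, cnt_level_zero, zero_add] at h ih ⊢
      rw [rk, Nat.count_succ, ← rk, cnt_succ, ← add_assoc, ih]
      simp [h, Nat.succ_le_iff, add_assoc]
  | succ j ihj =>
    induction v with
    | zero =>
      have := ihj n le_rfl
      rw [← start_succ, ← start_succ] at this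
      simpa using this
    | succ v ih =>
      have ih := ih (by omega)
      by_cases hj : j + 1 ≤ c v
      · have h := mk_pos (c := c) (show v < n from hv) hj
        rw [pos] at h
        rw [cnt_succ, if_pos hj, ← add_assoc, rk, Nat.count_succ, ← rk, ← add_assoc, ih,
          cnt_succ _ (j + 1 + 1)]
        simp [h, Nat.succ_le_iff, add_assoc]
      · rw [cnt_succ, if_neg hj, add_zero, ih, cnt_succ, if_neg (by omega), add_zero]

theorem rk_pos (v j : ℕ) (hv : v < n) : n + rk c n (pos c n v j) = pos c n v (j + 1) :=
  rk_start j v hv.le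

/-- Level by level, there are `n` nodes on level `0` and `∑ v, c v` nodes on the other levels. -/
theorem sum_start (J : ℕ) (h : ∀ v < n, c v < J) :
    start c n J = n + ∑ v ∈ Finset.range n, c v := by
  have h1 : ∀ i, cnt c i n = ∑ v ∈ Finset.range n, if i ≤ c v then 1 else 0 := by
    intro i
    rw [cnt, Nat.count_eq_card_filter_range, Finset.card_filter]
  rw [start, Finset.sum_congr rfl fun i _ => h1 i, Finset.sum_comm]
  have h2 : ∀ v ∈ Finset.range n, (∑ i ∈ Finset.range J, if i ≤ c v then 1 else 0) = 1 + c v := by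
    intro v hv
    rw [← Finset.card_filter]
    have : (Finset.range J).filter (fun i => i ≤ c v) = Finset.range (c v + 1) := by
      ext i
      have := h v (Finset.mem_range.1 hv)
      simp; omega
    rw [this, Finset.card_range, add_comm]
  rw [Finset.sum_congr rfl h2, Finset.sum_add_distrib]; simp

theorem rk_pos_inj {v j v' j' : ℕ} (hv : v < n) (hj : j < c v) (hv' : v' < n) (hj' : j' < c v')
    (h : rk c n (pos c n v j) = rk c n (pos c n v' j')) : v = v' ∧ j = j' := by
  have h1 := rk_pos (c := c) v j hv
  have h2 := rk_pos (c := c) v' j' hv'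
  have := pos_inj hv (show j + 1 ≤ c v from hj) hv' (show j' + 1 ≤ c v' from hj') (by omega)
  omega

end

/-! ### Bit fields -/

/-- The field of `s` bits of the word `x` whose least significant bit is bit `off` of `x`. -/
def fld (x off s : ℕ) : ℕ := (x >>> off) % 2 ^ s

theorem testBit_fld (x off s i : ℕ) :
    (fld x off s).testBit i = (decide (i < s) && x.testBit (off + i)) := by
  simp [fld, Nat.testBit_mod_two_pow, Nat.testBit_shiftRight]

theorem fld_lt (x off s : ℕ) : fld x off s < 2 ^ s := Nat.mod_lt _ (by positivity)

theorem testBit_of_lt {x s i : ℕ} (h : x < 2 ^ s) (hi : s ≤ i) : x.testBit i = false :=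
  Nat.testBit_lt_two_pow (h.trans_le (Nat.pow_le_pow_right (by norm_num) hi))

theorem fld_xor_same {x off s y : ℕ} (hy : y < 2 ^ s) :
    fld (x ^^^ (y <<< off)) off s = fld x off s ^^^ y := by
  apply Nat.eq_of_testBit_eq
  intro i
  simp only [testBit_fld, Nat.testBit_xor, Nat.testBit_shiftLeft]
  by_cases hi : i < s
  · simp [hi]
  · simp [hi, testBit_of_lt hy (not_lt.1 hi)]

theorem fld_xor_disj {x off s y off' s' : ℕ} (hy : y < 2 ^ s)
    (h : off' + s' ≤ off ∨ off + s ≤ off') : fld (x ^^^ (y <<< off)) off' s' = fld x off' s' := by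
  apply Nat.eq_of_testBit_eq
  intro i
  simp only [testBit_fld, Nat.testBit_xor, Nat.testBit_shiftLeft]
  by_cases hi : i < s'
  · rcases h with h | h
    · simp [hi, show ¬ off ≤ off' + i by omega]
    · simp [testBit_of_lt hy (show s ≤ off' + i - off by omega)]
  · simp [hi]

/-- Entry number `i` of an array of fields of `s` bits, `k` to a word, that starts at address
`b`. -/
def field (m : ℕ → ℕ) (b k s i : ℕ) : ℕ := fld (m (b + i / k)) (i % k * s) s

/-- Bit number `i` of a bit array with `k` bits to a word. -/
def bit (m : ℕ → ℕ) (b k i : ℕ) : ℕ := (m (b + i / k) >>> (i % k)) % 2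

theorem bit_eq_field (m : ℕ → ℕ) (b k i : ℕ) : bit m b k i = field m b k 1 i := by
  simp [bit, field, fld]

theorem field_xor (m : ℕ → ℕ) (b k s i y j : ℕ) (hy : y < 2 ^ s) :
    field (Function.update m (b + i / k) (m (b + i / k) ^^^ (y <<< (i % k * s)))) b k s j =
      if j = i then field m b k s j ^^^ y else field m b k s j := by
  split_ifs with h
  · subst h
    simp [field, fld_xor_same hy]
  · by_cases h1 : j / k = i / k
    · have h2 : j % k ≠ i % k := fun h2 => h (by
        rw [← Nat.div_add_mod j k, h1, h2, Nat.div_add_mod])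
      rw [field, field, h1, Function.update_self, fld_xor_disj hy]
      rcases lt_or_gt_of_ne h2 with h3 | h3
      · left; rw [← Nat.succ_mul]; exact Nat.mul_le_mul_right _ h3
      · right; rw [← Nat.succ_mul]; exact Nat.mul_le_mul_right _ h3
    · rw [field, field, Function.update_of_ne (by omega)]

theorem bit_xor (m : ℕ → ℕ) (b k i y j : ℕ) (hy : y < 2) :
    bit (Function.update m (b + i / k) (m (b + i / k) ^^^ (y <<< (i % k)))) b k j =
      if j = i then bit m b k j ^^^ y else bit m b k j := by
  simpa [← bit_eq_field] using field_xor m b k 1 i y j (by simpa using hy)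

theorem bit_congr {m m' : ℕ → ℕ} {b k i : ℕ} (h : m' (b + i / k) = m (b + i / k)) :
    bit m' b k i = bit m b k i := by rw [bit, bit, h]

theorem field_congr {m m' : ℕ → ℕ} {b k s i : ℕ} (h : m' (b + i / k) = m (b + i / k)) :
    field m' b k s i = field m b k s i := by rw [field, field, h]

theorem bit_lt (m : ℕ → ℕ) (b k i : ℕ) : bit m b k i < 2 := Nat.mod_lt _ (by norm_num)

/-- Bit arrays whose words hold `k` chunks of `h` bits can be read by chunks. -/
theorem testBit_field (m : ℕ → ℕ) (b k h i j : ℕ) (hj : j < h) :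
    (field m b k h i).testBit j = decide (bit m b (h * k) (i * h + j) = 1) := by
  have h1 : (i * h + j) / (h * k) = i / k := by
    rw [← Nat.div_div_eq_div_mul, Nat.mul_comm, Nat.mul_add_div (by omega), Nat.div_eq_of_lt hj,
      add_zero]
  have h2 : (i * h + j) % (h * k) = i % k * h + j := by
    rw [Nat.mod_mul, Nat.mul_add_mod_self_right, Nat.mod_eq_of_lt hj, Nat.mul_comm i h,
      Nat.mul_add_div (by omega), Nat.div_eq_of_lt hj, add_zero]
    ring
  rw [field, testBit_fld, bit, h1, h2]
  simp [hj, Nat.testBit_eq_decide_div_mod_eq, Nat.shiftRight_eq_div_pow]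

/-! ### Counting bits -/

/-- The number of ones among the `h` least significant bits. -/
def pc (h x : ℕ) : ℕ := Nat.count (fun i => x.testBit i) h

@[simp] theorem pc_zero (h : ℕ) : pc h 0 = 0 := by simp [pc, Nat.count_false]

theorem pc_half {h x : ℕ} (hx : x < 2 ^ h) : pc h x = pc h (x / 2) + x % 2 := by
  have h1 := Nat.count_succ' (fun i => x.testBit i) h
  have h2 := Nat.count_succ (fun i => x.testBit i) h
  rw [testBit_of_lt hx le_rfl] at h2
  have h3 : Nat.count (fun k => x.testBit (k + 1)) h = pc h (x / 2) := by
    simp only [pc, Nat.testBit_add_one]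
  rw [h3] at h1
  have h4 : (if x.testBit 0 = true then 1 else 0) = x % 2 := by
    rw [Nat.testBit_zero]
    rcases Nat.mod_two_eq_zero_or_one x with h | h <;> simp [h]
  simp only [h4] at h1
  simp only [Bool.false_eq_true, if_false, add_zero] at h2
  rw [← h1, h2, pc]

theorem count_congr {P Q : ℕ → Prop} [DecidablePred P] [DecidablePred Q] {n : ℕ}
    (h : ∀ i < n, P i ↔ Q i) : Nat.count P n = Nat.count Q n := by
  induction n with
  | zero => simp
  | succ n ih =>
    rw [Nat.count_succ, Nat.count_succ, ih fun i hi => h i (by omega)]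
    simp only [h n (by omega)]

/-- Reading a chunk advances the rank. -/
theorem rk_chunk {c : ℕ → ℕ} {n : ℕ} {m : ℕ → ℕ} {b k h i j : ℕ} (hj : j ≤ h)
    (hm : ∀ l < j, bit m b (h * k) (i * h + l) = 1 ↔ Mk c n (i * h + l)) :
    rk c n (i * h + j) = rk c n (i * h) + pc h (field m b k h i % 2 ^ j) := by
  classical
  have h1 : pc h (field m b k h i % 2 ^ j) = pc j (field m b k h i) := by
    obtain ⟨e, rfl⟩ := Nat.exists_eq_add_of_le hj
    rw [pc, Nat.count_add]
    rw [count_congr (Q := fun _ => False) (n := e), Nat.count_false, add_zero, pc]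
    · exact count_congr fun l hl => by simp [Nat.testBit_mod_two_pow, hl]
    · intro l _; simp [Nat.testBit_mod_two_pow]
  rw [h1, rk, Nat.count_add, rk, pc]
  refine congrArg _ (count_congr fun l hl => ?_)
  rw [testBit_field _ _ _ _ _ _ (by omega), decide_eq_true_iff, hm l hl]

theorem rk_le_of_le {c : ℕ → ℕ} {n p q : ℕ} (h : p ≤ q) : rk c n q ≤ rk c n p + (q - p) := by
  classical
  obtain ⟨e, rfl⟩ := Nat.exists_eq_add_of_le h
  rw [rk, Nat.count_add, ← rk]
  have : Nat.count (fun k => Mk c n (p + k)) e ≤ e := Nat.count_le _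
  convert Nat.add_le_add_left this _ using 1
  simp

theorem rk_mono {c : ℕ → ℕ} {n p q : ℕ} (h : p ≤ q) : rk c n p ≤ rk c n q := by
  classical exact Nat.count_monotone _ h

/-! ### The program -/

namespace Expr

instance : Add Expr := ⟨.bin .add⟩
instance : Sub Expr := ⟨.bin .sub⟩
instance : Mul Expr := ⟨.bin .mul⟩
instance : Div Expr := ⟨.bin .div⟩
instance : Mod Expr := ⟨.bin .mod⟩
instance : XorOp Expr := ⟨.bin .xor⟩
instance : ShiftLeft Expr := ⟨.bin .shl⟩
instance : ShiftRight Expr := ⟨.bin .shr⟩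
instance (k : ℕ) : OfNat Expr k := ⟨.lit k⟩

variable (E : Env) (σ : St) (a b : Expr)

@[simp] theorem eval_add : (a + b).eval E σ = a.eval E σ + b.eval E σ := rfl
@[simp] theorem eval_sub : (a - b).eval E σ = a.eval E σ - b.eval E σ := rfl
@[simp] theorem eval_mul : (a * b).eval E σ = a.eval E σ * b.eval E σ := rfl
@[simp] theorem eval_div : (a / b).eval E σ = a.eval E σ / b.eval E σ := rfl
@[simp] theorem eval_mod : (a % b).eval E σ = a.eval E σ % b.eval E σ := rfl
@[simp] theorem eval_xor : (a ^^^ b).eval E σ = a.eval E σ ^^^ b.eval E σ := rfl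
@[simp] theorem eval_shl : (a <<< b).eval E σ = a.eval E σ <<< b.eval E σ := rfl
@[simp] theorem eval_shr : (a >>> b).eval E σ = a.eval E σ >>> b.eval E σ := rfl
@[simp] theorem eval_zero : (0 : Expr).eval E σ = 0 := rfl
@[simp] theorem eval_one : (1 : Expr).eval E σ = 1 := rfl
@[simp] theorem eval_two : (2 : Expr).eval E σ = 2 := rfl
@[simp] theorem eval_four : (4 : Expr).eval E σ = 4 := rfl
@[simp] theorem ok_add :
    (a + b).Ok E σ ↔ a.Ok E σ ∧ b.Ok E σ ∧ a.eval E σ + b.eval E σ < 2 ^ E.w := Iff.rfl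
@[simp] theorem ok_sub :
    (a - b).Ok E σ ↔ a.Ok E σ ∧ b.Ok E σ ∧ b.eval E σ ≤ a.eval E σ := Iff.rfl
@[simp] theorem ok_mul :
    (a * b).Ok E σ ↔ a.Ok E σ ∧ b.Ok E σ ∧ a.eval E σ * b.eval E σ < 2 ^ E.w := Iff.rfl
@[simp] theorem ok_shl :
    (a <<< b).Ok E σ ↔ a.Ok E σ ∧ b.Ok E σ ∧ a.eval E σ <<< b.eval E σ < 2 ^ E.w := Iff.rfl
@[simp] theorem ok_div : (a / b).Ok E σ ↔ a.Ok E σ ∧ b.Ok E σ :=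
  ⟨fun h => ⟨h.1, h.2.1⟩, fun h => ⟨h.1, h.2, trivial⟩⟩
@[simp] theorem ok_mod : (a % b).Ok E σ ↔ a.Ok E σ ∧ b.Ok E σ :=
  ⟨fun h => ⟨h.1, h.2.1⟩, fun h => ⟨h.1, h.2, trivial⟩⟩
@[simp] theorem ok_xor : (a ^^^ b).Ok E σ ↔ a.Ok E σ ∧ b.Ok E σ :=
  ⟨fun h => ⟨h.1, h.2.1⟩, fun h => ⟨h.1, h.2, trivial⟩⟩
@[simp] theorem ok_shr : (a >>> b).Ok E σ ↔ a.Ok E σ ∧ b.Ok E σ :=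
  ⟨fun h => ⟨h.1, h.2.1⟩, fun h => ⟨h.1, h.2, trivial⟩⟩
@[simp] theorem eval_var (x : ℕ) : (var x).eval E σ = σ.v x := rfl
@[simp] theorem eval_mem : (mem a).eval E σ = σ.m (a.eval E σ) := rfl
@[simp] theorem eval_ask (q : Query) :
    (ask q a b).eval E σ = E.ans q (a.eval E σ) (b.eval E σ) := rfl
@[simp] theorem ok_var (x : ℕ) : (var x).Ok E σ ↔ x < 40 := Iff.rfl
@[simp] theorem ok_mem : (mem a).Ok E σ ↔ a.Ok E σ ∧ a.eval E σ < E.sp := Iff.rfl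
@[simp] theorem ok_ask (q : Query) : (ask q a b).Ok E σ ↔ a.Ok E σ ∧ b.Ok E σ := Iff.rfl
@[simp] theorem ok_zero : (0 : Expr).Ok E σ ↔ 0 < 2 ^ E.w := Iff.rfl
@[simp] theorem ok_one : (1 : Expr).Ok E σ ↔ 1 < 2 ^ E.w := Iff.rfl
@[simp] theorem ok_two : (2 : Expr).Ok E σ ↔ 2 < 2 ^ E.w := Iff.rfl
@[simp] theorem ok_four : (4 : Expr).Ok E σ ↔ 4 < 2 ^ E.w := Iff.rfl

end Expr

prefix:max "♯" => Expr.var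
infixr:60 " ;; " => Stmt.seq
infix:61 " ::= " => Stmt.assign

/-! The variables of the program. The variables `v_n` to `v_NC` are constant once they have been
computed, `v_T` to `v_D` being the addresses of the arrays; `v_r`, `v_u`, `v_i` and `v_act` hold the
state of the traversal, and the others are temporary. -/

notation "v_n" => (0 : ℕ)
notation "v_w" => (1 : ℕ)
notation "v_lg" => (2 : ℕ)
notation "v_k" => (3 : ℕ)
notation "v_h" => (4 : ℕ)
notation "v_U" => (5 : ℕ)
notation "v_s" => (6 : ℕ)
notation "v_kR" => (7 : ℕ)
notation "v_T" => (8 : ℕ)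
notation "v_S" => (9 : ℕ)
notation "v_R" => (10 : ℕ)
notation "v_M" => (11 : ℕ)
notation "v_D" => (12 : ℕ)
notation "v_NC" => (13 : ℕ)
notation "v_r" => (14 : ℕ)
notation "v_u" => (15 : ℕ)
notation "v_i" => (16 : ℕ)
notation "v_act" => (17 : ℕ)
notation "v_v" => (18 : ℕ)
notation "v_key" => (19 : ℕ)
notation "v_x" => (20 : ℕ)
notation "v_j" => (21 : ℕ)
notation "v_p" => (22 : ℕ)
notation "v_q" => (23 : ℕ)
notation "v_last" => (24 : ℕ)
notation "v_acc" => (25 : ℕ)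
notation "v_base" => (26 : ℕ)

/-- Bit number `p` of the bit array at address `b`. -/
def bitE (b p : Expr) : Expr := (.mem (b + p / ♯v_U) >>> (p % ♯v_U)) % 2

/-- Add `y`, which is `0` or `1`, modulo `2` to bit number `p` of the bit array at address `b`. -/
def flipS (b p y : Expr) : Stmt :=
  .store (b + p / ♯v_U) (.mem (b + p / ♯v_U) ^^^ (y <<< (p % ♯v_U)))

/-- Chunk number `i` of the marker bits. -/
def chunkE (i : Expr) : Expr :=
  (.mem (♯v_M + i / ♯v_k) >>> (i % ♯v_k * ♯v_h)) % (1 <<< ♯v_h)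

/-- The number of marked nodes before the node `p`. -/
def rankE (p : Expr) : Expr :=
  .mem (♯v_S + p / ♯v_h / ♯v_lg) +
  (.mem (♯v_R + p / ♯v_h / ♯v_kR) >>> (p / ♯v_h % ♯v_kR * ♯v_s)) % (1 <<< ♯v_s) +
  .mem (♯v_T + chunkE (p / ♯v_h) % (1 <<< (p % ♯v_h)))

/-- Compute the bit length of `x` in `y`, destroying `x`. -/
def sizeS (x y : ℕ) : Stmt :=
  y ::= 0 ;; .while 0 ♯x (x ::= ♯x / 2 ;; y ::= ♯y + 1)

/-- Compute the parameters of the data structure that depend on `n` and `w`. -/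
def setupS : Stmt :=
  v_x ::= ♯v_n ;;
  sizeS v_x v_lg ;;
  v_k ::= ♯v_w / (♯v_lg / 4 + 1) ;;
  v_h ::= ♯v_w / ♯v_k ;;
  v_U ::= ♯v_h * ♯v_k ;;
  v_x ::= ♯v_h * ♯v_lg ;;
  sizeS v_x v_s ;;
  v_kR ::= ♯v_w / ♯v_s

/-- Set `x` to the initial value of the counter of the vertex `v`, which is one less than the
indegree of `v` (and `0` for a source). -/
def initS : Stmt :=
  v_x ::= .ask .inDeg ♯v_v 0 ;;
  .cond 0 ♯v_x (v_x ::= ♯v_x - 1) .skip ;;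
  v_j ::= 0

/-- Count the nodes on each level. -/
def countS : Stmt :=
  v_v ::= 0 ;;
  .while ♯v_v ♯v_n (
    initS ;;
    .while 0 ♯v_x (
      v_j ::= ♯v_j + 1 ;;
      .store ♯v_j (.mem ♯v_j + 1) ;;
      v_x ::= ♯v_x / 2) ;;
    v_v ::= ♯v_v + 1)

/-- Replace the sizes of the levels by their first nodes, and compute the number of all nodes. -/
def prefixS : Stmt :=
  v_acc ::= ♯v_n ;;
  v_j ::= 0 ;;
  .while ♯v_j ♯v_lg (
    v_j ::= ♯v_j + 1 ;;
    v_x ::= .mem ♯v_j ;;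
    .store ♯v_j ♯v_acc ;;
    v_acc ::= ♯v_acc + ♯v_x)

/-- Compute the addresses of the arrays. -/
def layoutS : Stmt :=
  v_NC ::= ♯v_acc / ♯v_h + 1 ;;
  v_T ::= ♯v_lg + 1 ;;
  v_S ::= ♯v_T + (1 <<< ♯v_h) ;;
  v_R ::= ♯v_S + (♯v_NC / ♯v_lg + 1) ;;
  v_M ::= ♯v_R + (♯v_NC / ♯v_kR + 1) ;;
  v_D ::= ♯v_M + (♯v_NC / ♯v_k + 1)

/-- Fill in the marker bits and the initial values of the counters. The pointer to each level
advances past the nodes that have been created there. -/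
def fillS : Stmt :=
  v_v ::= 0 ;;
  .while ♯v_v ♯v_n (
    initS ;;
    v_p ::= ♯v_v ;;
    .while 0 ♯v_x (
      flipS ♯v_M ♯v_p 1 ;;
      v_j ::= ♯v_j + 1 ;;
      v_p ::= .mem ♯v_j ;;
      .store ♯v_j (♯v_p + 1) ;;
      v_q ::= ♯v_p - ♯v_n ;;
      flipS ♯v_D ♯v_q (♯v_x % 2) ;;
      v_x ::= ♯v_x / 2) ;;
    v_v ::= ♯v_v + 1)

/-- Compute the table of the numbers of ones in the words of `h` bits, by the recursion that removes
the last bit. -/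
def tableS : Stmt :=
  v_x ::= 0 ;;
  .while ♯v_x (1 <<< ♯v_h) (
    .store (♯v_T + ♯v_x) (.mem (♯v_T + ♯v_x / 2) + ♯v_x % 2) ;;
    v_x ::= ♯v_x + 1)

/-- Compute the rank directory. -/
def dirS : Stmt :=
  v_acc ::= 0 ;;
  v_base ::= 0 ;;
  v_j ::= 0 ;;
  .while ♯v_j ♯v_NC (
    .cond (♯v_j % ♯v_lg) 1
      (.store (♯v_S + ♯v_j / ♯v_lg) ♯v_acc ;; v_base ::= ♯v_acc) .skip ;;
    .store (♯v_R + ♯v_j / ♯v_kR) (.mem (♯v_R + ♯v_j / ♯v_kR) ^^^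
      ((♯v_acc - ♯v_base) <<< (♯v_j % ♯v_kR * ♯v_s))) ;;
    v_acc ::= ♯v_acc + .mem (♯v_T + chunkE ♯v_j) ;;
    v_j ::= ♯v_j + 1)

/-- Proceed from the node `p` to its successor, whose payload bit has the number `q`. -/
def nextS : Stmt := v_q ::= rankE ♯v_p ;; v_p ::= ♯v_n + ♯v_q

/-- Decrement the counter of `v`. Afterwards `last` tells whether the counter was `0`. The loop goes
on while there is a bit left and a borrow is pending: `last = 1` means that the bit treated last, if
any, was `0`. -/
def decS : Stmt :=
  v_p ::= ♯v_v ;;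
  v_last ::= 1 ;;
  .while 1 (bitE ♯v_M ♯v_p + ♯v_last) (
    nextS ;;
    v_last ::= 1 - bitE ♯v_D ♯v_q ;;
    flipS ♯v_D ♯v_q 1)

/-- Overwrite the counter of `v` by `key`. -/
def writeS : Stmt :=
  v_p ::= ♯v_v ;;
  .while 0 (bitE ♯v_M ♯v_p) (
    nextS ;;
    flipS ♯v_D ♯v_q (bitE ♯v_D ♯v_q ^^^ ♯v_key % 2) ;;
    v_key ::= ♯v_key / 2)

/-- Read the counter of `u` into `key`. -/
def readS : Stmt :=
  v_p ::= ♯v_u ;;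
  v_key ::= 0 ;;
  v_j ::= 0 ;;
  .while 0 (bitE ♯v_M ♯v_p) (
    nextS ;;
    v_key ::= ♯v_key + (bitE ♯v_D ♯v_q <<< ♯v_j) ;;
    v_j ::= ♯v_j + 1)

/-- One step of the traversal: start at the next source (`act = 0` means that there is no current
vertex), follow the next edge out of the current vertex `u`, or return from `u`. A vertex is output
when it is entered, and then its counter is overwritten by the position of the edge by which it was
entered, so that the way back can be found in the input. -/
def stepS : Stmt :=
  .cond ♯v_act 1
    (.cond (.ask .inDeg ♯v_r 0) 1
      (v_u ::= ♯v_r ;; v_i ::= 0 ;; v_act ::= 1 ;; .emit ♯v_u) .skip ;;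
     v_r ::= ♯v_r + 1)
    (.cond ♯v_i (.ask .outDeg ♯v_u 0)
      (v_v ::= .ask .outHead ♯v_u ♯v_i ;;
       decS ;;
       .cond 0 ♯v_last
        (v_key ::= .ask .outMate ♯v_u ♯v_i ;; writeS ;;
         v_u ::= ♯v_v ;; v_i ::= 0 ;; .emit ♯v_u)
        (v_i ::= ♯v_i + 1))
      (.cond (.ask .inDeg ♯v_u 0) 1
        (v_act ::= 0)
        (readS ;;
         v_v ::= ♯v_u ;;
         v_u ::= .ask .inHead ♯v_v ♯v_key ;;
         v_i ::= .ask .inMate ♯v_v ♯v_key + 1)))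

/-- The traversal. -/
def traverseS : Stmt :=
  v_r ::= 0 ;; v_act ::= 0 ;; .while ♯v_r (♯v_n + ♯v_act) stepS

/-- The whole algorithm. -/
def mainS : Stmt :=
  setupS ;; countS ;; prefixS ;; layoutS ;; fillS ;; tableS ;; dirS ;; traverseS

/-! ### The layout of the memory -/

/-- The parameters of the data structure and the relations between them that the correctness
depends on. `c v` is the number of bits of the counter of the vertex `v`, and `lg` the bit length of
`n`. The memory holds, in this order, the word `0`, which is not used, pointers to the levels
`1, …, lg`; at `bT` a table of the numbers of ones in the chunks of `h` bits; at `bS` the ranks of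
the chunks whose number is a multiple of `lg`; at `bR` the ranks of all chunks relative to these, in
fields of `s` bits, `kR` to a word; at `bM` the marker bits of all nodes, in `NC` chunks, `k` to a
word; and at `bD` the payload bits of all nodes but those on level `0`. -/
structure Layout (E : Env) where
  (n lg k h s kR bT bS bR bM bD NC : ℕ)
  c : ℕ → ℕ
  n_pos : 0 < n
  lg_eq : lg = n.size
  k_eq : k = E.w / (lg / 4 + 1)
  h_eq : h = E.w / k
  s_eq : s = (h * lg).size
  kR_eq : kR = E.w / s
  c_eq : ∀ v < n, c v = (E.ans .inDeg v 0 - 1).size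
  c_le : ∀ v < n, c v ≤ lg
  lg_pos : 0 < lg
  k_pos : 0 < k
  h_pos : 0 < h
  hk_le : h * k ≤ E.w
  h_lt : h < E.w
  s_lt : s < E.w
  kR_pos : 0 < kR
  kRs_le : kR * s ≤ E.w
  rel_lt : lg * h < 2 ^ s
  NC_eq : NC = start c n (lg + 1) / h + 1
  bT_eq : bT = lg + 1
  bS_eq : bS = bT + 2 ^ h
  bR_eq : bR = bS + (NC / lg + 1)
  bM_eq : bM = bR + (NC / kR + 1)
  bD_eq : bD = bM + (NC / k + 1)
  sp_eq : E.sp = bD + ((start c n (lg + 1) - n) / (h * k) + 1)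
  big : 16 * (E.sp + start c n (lg + 1) + E.w) ≤ 2 ^ E.w

namespace Layout

variable {E : Env} (L : Layout E)

/-- The number of nodes. -/
def N : ℕ := start L.c L.n (L.lg + 1)

/-- The number of usable bits of a word in a bit array. -/
def U : ℕ := L.h * L.k

/-- The values of the variables `0, …, 13`, which are constant after the initialization. -/
@[simp] def val : ℕ → ℕ
  | 0 => L.n
  | 1 => E.w
  | 2 => L.lg
  | 3 => L.k
  | 4 => L.h
  | 5 => L.U
  | 6 => L.s
  | 7 => L.kR
  | 8 => L.bT
  | 9 => L.bS
  | 10 => L.bR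
  | 11 => L.bM
  | 12 => L.bD
  | _ => L.NC

/-- The first `b` variables have their final values. -/
def Par (b : ℕ) (σ : St) : Prop := ∀ x < b, σ.v x = L.val x

/-- The memory contains a correct rank directory, and the marker bits that it belongs to. -/
structure Dir (m : ℕ → ℕ) : Prop where
  tab : ∀ x < 2 ^ L.h, m (L.bT + x) = pc L.h x
  sup : ∀ i, i * L.lg < L.NC → m (L.bS + i) = rk L.c L.n (i * L.lg * L.h)
  rel : ∀ i < L.NC, field m L.bR L.kR L.s i =
    rk L.c L.n (i * L.h) - rk L.c L.n (i / L.lg * L.lg * L.h)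
  mark : ∀ p < L.NC * L.h, bit m L.bM L.U p = 1 ↔ Mk L.c L.n p

end Layout

/-! ### Reading the data structure -/

theorem shl_lt {a s off w : ℕ} (ha : a < 2 ^ s) (h : off + s ≤ w) : a <<< off < 2 ^ w := by
  rw [Nat.shiftLeft_eq]
  calc a * 2 ^ off < 2 ^ s * 2 ^ off := by gcongr
    _ = 2 ^ (off + s) := by rw [← pow_add, add_comm]
    _ ≤ 2 ^ w := Nat.pow_le_pow_right (by norm_num) h

theorem mod_mul_add_le {i k s : ℕ} (hk : 0 < k) : i % k * s + s ≤ k * s := by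
  rw [← Nat.succ_mul]; exact Nat.mul_le_mul_right _ (Nat.mod_lt _ hk)

namespace Layout

variable {E : Env} (L : Layout E)

theorem Par.set {L : Layout E} {b : ℕ} {σ : St} (h : L.Par b σ) (x a : ℕ) (hx : b ≤ x) :
    L.Par b (σ.set x a) := fun y hy => by
  rw [St.set_v, if_neg (by omega)]; exact h y hy

theorem Par.put {L : Layout E} {b : ℕ} {σ : St} (h : L.Par b σ) (x a : ℕ) :
    L.Par b (σ.put x a) := h

theorem Par.say {L : Layout E} {b : ℕ} {σ : St} (h : L.Par b σ) (x : ℕ) :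
    L.Par b (σ.say x) := h

theorem U_pos : 0 < L.U := Nat.mul_pos L.h_pos L.k_pos

theorem U_le : L.U ≤ E.w := L.hk_le

theorem bit_shl_lt {y i : ℕ} (hy : y < 2) : y <<< (i % L.U) < 2 ^ E.w :=
  shl_lt (s := 1) (by simpa using hy) (by have := Nat.mod_lt i L.U_pos; have := L.U_le; omega)

theorem lt_NC {p : ℕ} (hp : p < L.N) : p / L.h < L.NC := by
  have : p / L.h ≤ L.N / L.h := Nat.div_le_div_right hp.le
  rw [L.NC_eq, ← N]; omega

theorem N_lt : L.N < L.NC * L.h := by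
  rw [L.NC_eq, ← N, add_mul, one_mul]
  have := Nat.div_add_mod' L.N L.h
  have := Nat.mod_lt L.N L.h_pos
  omega

theorem n_le_N : L.n ≤ L.N := by
  have := start_mono L.c L.n (show 1 ≤ L.lg + 1 by omega)
  simpa [N] using this

theorem sp_eq' : E.sp = L.bD + ((L.N - L.n) / L.U + 1) := L.sp_eq

theorem big' : 16 * (E.sp + L.N + E.w) ≤ 2 ^ E.w := L.big

theorem bases : L.lg < L.bT ∧ L.bT + 2 ^ L.h ≤ L.bS ∧ L.bS + L.NC / L.lg < L.bR ∧
    L.bR + L.NC / L.kR < L.bM ∧ L.bM + L.NC / L.k < L.bD ∧ L.bD < E.sp ∧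
    L.bT < L.bS ∧ L.bS < L.bR ∧ L.bR < L.bM ∧ L.bM < L.bD := by
  have h1 := L.bT_eq
  have h2 := L.bS_eq
  have h3 := L.bR_eq
  have h4 := L.bM_eq
  have h5 := L.bD_eq
  have h6 := L.sp_eq
  have := Nat.two_pow_pos L.h
  have := Nat.zero_le (L.NC / L.lg)
  have := Nat.zero_le (L.NC / L.kR)
  have := Nat.zero_le (L.NC / L.k)
  have := Nat.zero_le ((start L.c L.n (L.lg + 1) - L.n) / (L.h * L.k))
  refine ⟨?_, ?_, ?_, ?_, ?_, ?_, ?_, ?_, ?_, ?_⟩ <;> omega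

theorem mark_addr {p : ℕ} (hp : p < L.NC * L.h) : L.bM + p / L.U < L.bD := by
  have h1 : p / L.h < L.NC := Nat.div_lt_of_lt_mul (by rwa [mul_comm])
  have h2 : p / L.h / L.k ≤ L.NC / L.k := Nat.div_le_div_right h1.le
  rw [Nat.div_div_eq_div_mul] at h2
  have := L.bases
  rw [U]; omega

theorem data_addr {q : ℕ} (hq : q < L.N - L.n) : L.bD + q / L.U < E.sp := by
  have h2 : q / L.U ≤ (L.N - L.n) / L.U := Nat.div_le_div_right hq.le
  have := L.sp_eq'
  omega

theorem w_pos (L : Layout E) : 0 < E.w := by have := L.s_lt; omega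

/-- The word length allows the constants that occur in the program. -/
theorem four_lt (L : Layout E) : 4 < 2 ^ E.w := by
  have := L.bases
  have := L.big
  omega

/-- The operations on the counters preserve the directory. -/
theorem Dir.congr {L : Layout E} {m m' : ℕ → ℕ} (h : L.Dir m)
    (hm : ∀ a, L.bT ≤ a → a < L.bD → m' a = m a) : L.Dir m' := by
  obtain ⟨b1, b2, b3, b4, b5, b6, b7, b8, b9, b10⟩ := L.bases
  refine ⟨fun x hx => ?_, fun i hi => ?_, fun i hi => ?_, fun p hp => ?_⟩
  · rw [hm _ (by omega) (by omega)]; exact h.tab x hx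
  · have : i ≤ L.NC / L.lg := (Nat.le_div_iff_mul_le L.lg_pos).2 hi.le
    rw [hm _ (by omega) (by omega)]; exact h.sup i hi
  · have : i / L.kR ≤ L.NC / L.kR := Nat.div_le_div_right hi.le
    rw [field_congr (hm _ ((by omega : L.bT ≤ L.bR).trans (Nat.le_add_right _ _)) (by omega))]
    exact h.rel i hi
  · have := L.mark_addr hp
    rw [bit_congr (hm _ ((by omega : L.bT ≤ L.bM).trans (Nat.le_add_right _ _)) (by omega))]
    exact h.mark p hp

variable {L} {σ : St}

/-- A chunk of marker bits does not extend over a word boundary, since a word holds `k` chunks. -/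
theorem chunkE_spec (hP : L.Par 14 σ) {e : Expr} (he : e.Ok E σ) (hi : e.eval E σ < L.NC) :
    (chunkE e).eval E σ = field σ.m L.bM L.k L.h (e.eval E σ) ∧ (chunkE e).Ok E σ := by
  obtain ⟨b1, b2, b3, b4, b5, b6, b7, b8, b9, b10⟩ := L.bases
  have hbig := L.big
  have h1 : e.eval E σ / L.k ≤ L.NC / L.k := Nat.div_le_div_right hi.le
  have h2 : e.eval E σ % L.k * L.h + L.h ≤ L.k * L.h := mod_mul_add_le L.k_pos
  have h3 := L.hk_le
  have h4 := E.w.lt_two_pow_self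
  have z1 := Nat.le_add_right L.bM (e.eval E σ / L.k)
  have z2 := Nat.zero_le (e.eval E σ % L.k * L.h)
  have hP : ∀ x < 14, σ.v x = L.val x := hP
  rw [mul_comm] at h3
  have h5 : 1 <<< L.h < 2 ^ E.w := shl_lt (s := 1) (by norm_num) (by have := L.h_lt; omega)
  constructor
  · simp [chunkE, hP, field, fld, Nat.shiftLeft_eq]
  · simp only [chunkE, Expr.ok_mod, Expr.ok_shr, Expr.ok_mem, Expr.ok_var, Expr.ok_add,
      Expr.ok_div, Expr.ok_mul, Expr.ok_one, Expr.ok_shl, Expr.eval_add, Expr.eval_div,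
      Expr.eval_mod, Expr.eval_var, hP, Nat.reduceLT, Expr.eval_one, val, true_and, and_true, he,
      h5]
    refine ⟨⟨⟨?_, ?_⟩, ?_⟩, ?_⟩ <;> omega

/-- The rank of a node is found in constant time: it is the rank of the last chunk whose number is a
multiple of `lg`, plus the relative rank of its own chunk, plus a number of ones that is found in
the table. -/
theorem rankE_spec (hP : L.Par 14 σ) (hD : L.Dir σ.m) {e : Expr} (he : e.Ok E σ)
    (hi : e.eval E σ < L.N) :
    (rankE e).eval E σ = rk L.c L.n (e.eval E σ) ∧ (rankE e).Ok E σ := by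
  obtain ⟨b1, b2, b3, b4, b5, b6, b7, b8, b9, b10⟩ := L.bases
  have hbig := L.big'
  set p := e.eval E σ with hp
  have hNC := L.lt_NC hi
  have he' : (e / ♯v_h).Ok E σ := by simp [he]
  have hev : (e / ♯v_h).eval E σ = p / L.h := by simp [hP v_h (by norm_num), hp]
  obtain ⟨c1, c2⟩ := chunkE_spec hP he' (by rw [hev]; exact hNC)
  rw [hev] at c1
  have hj : p % L.h < L.h := Nat.mod_lt _ L.h_pos
  have h1 : p / L.h / L.lg ≤ L.NC / L.lg := Nat.div_le_div_right hNC.le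
  have h2 : p / L.h / L.kR ≤ L.NC / L.kR := Nat.div_le_div_right hNC.le
  have h3 : p / L.h % L.kR * L.s + L.s ≤ L.kR * L.s := mod_mul_add_le L.kR_pos
  have h3' := L.kRs_le
  have h4 := E.w.lt_two_pow_self
  have hP' := hP
  replace hP : ∀ x < 14, σ.v x = L.val x := hP
  have h5 : 1 <<< L.s < 2 ^ E.w := shl_lt (s := 1) (by norm_num) (by have := L.s_lt; omega)
  have h6 : 1 <<< (p % L.h) < 2 ^ E.w :=
    shl_lt (s := 1) (by norm_num) (by have := L.h_lt; omega)
  have h7 : field σ.m L.bM L.k L.h (p / L.h) % 2 ^ (p % L.h) < 2 ^ L.h :=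
    (Nat.mod_le _ _).trans_lt (fld_lt _ _ _)
  have s1 : p / L.h / L.lg * L.lg ≤ p / L.h := Nat.div_mul_le_self _ _
  have e1 : σ.m (L.bS + p / L.h / L.lg) = rk L.c L.n (p / L.h / L.lg * L.lg * L.h) :=
    hD.sup _ (by omega)
  have e2 := hD.rel _ hNC
  have e3 : σ.m (L.bT + field σ.m L.bM L.k L.h (p / L.h) % 2 ^ (p % L.h)) = _ := hD.tab _ h7
  have hpe : p / L.h * L.h + p % L.h = p := Nat.div_add_mod' p L.h
  have e4 : rk L.c L.n p = rk L.c L.n (p / L.h * L.h) +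
      pc L.h (field σ.m L.bM L.k L.h (p / L.h) % 2 ^ (p % L.h)) := by
    rw [← rk_chunk hj.le, hpe]
    intro l hl
    refine hD.mark _ ?_
    have := L.N_lt
    omega
  have mono : rk L.c L.n (p / L.h / L.lg * L.lg * L.h) ≤ rk L.c L.n (p / L.h * L.h) :=
    rk_mono (Nat.mul_le_mul_right _ s1)
  have e5 : rk L.c L.n p ≤ p := by
    have := rk_le_of_le (c := L.c) (n := L.n) (Nat.zero_le p)
    simpa [rk] using this
  have ev2 : (σ.m (L.bR + p / L.h / L.kR) >>> (p / L.h % L.kR * L.s)) % 1 <<< L.s =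
      rk L.c L.n (p / L.h * L.h) - rk L.c L.n (p / L.h / L.lg * L.lg * L.h) := by
    rw [← e2, field, fld, Nat.shiftLeft_eq, one_mul]
  have key : (rankE e).eval E σ = rk L.c L.n p := by
    simp only [rankE, Expr.eval_add, Expr.eval_mem, Expr.eval_var, Expr.eval_div, Expr.eval_mod,
      Expr.eval_shr, Expr.eval_mul, Expr.eval_shl, Expr.eval_one, hP, Nat.reduceLT,
      val, c1, ← hp, ev2, e1]
    rw [Nat.shiftLeft_eq 1 (p % L.h), one_mul, e3]
    omega
  refine ⟨key, ?_⟩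
  simp only [rankE, Expr.eval_add, Expr.eval_mem, Expr.eval_var, Expr.eval_div, Expr.eval_mod,
    Expr.eval_shr, Expr.eval_mul, Expr.eval_shl, Expr.eval_one, hP, Nat.reduceLT, val,
    c1, ← hp, ev2, e1] at key
  simp only [rankE, Expr.ok_mod, Expr.ok_shr, Expr.ok_mem, Expr.ok_var, Expr.ok_add, Expr.ok_div,
      Expr.ok_mul, Expr.ok_one, Expr.ok_shl, Expr.eval_add, Expr.eval_div, Expr.eval_mod,
      Expr.eval_mem, Expr.eval_var, hP, Nat.reduceLT, Expr.eval_one, val, true_and, and_true, he,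
      h5, c1, c2, ← hp, h6,
      Expr.eval_shr, Expr.eval_mul, Expr.eval_shl, ev2, e1]
  rw [Nat.shiftLeft_eq 1 (p % L.h), one_mul] at key ⊢
  refine ⟨⟨⟨?_, ?_⟩, ⟨⟨⟨?_, ?_⟩, ?_⟩, ?_⟩, ?_⟩, ⟨⟨?_, ?_⟩, ?_⟩, ?_⟩ <;> omega

/-- Reading a bit of a bit array of which the word in question lies in the memory area. -/
theorem bitE_spec {t : ℕ} (hP : L.Par t σ) (ht : 6 ≤ t) {b e : Expr} (hb : b.Ok E σ)
    (he : e.Ok E σ) (hi : b.eval E σ + e.eval E σ / L.U < E.sp) :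
    (bitE b e).eval E σ = bit σ.m (b.eval E σ) L.U (e.eval E σ) ∧ (bitE b e).Ok E σ := by
  have hbig := L.big'
  have hU : σ.v 5 = L.U := hP 5 (by omega)
  have h4 := L.four_lt
  constructor
  · simp [bitE, bit, hU]
  · simp [bitE, hU, hb, he, hi]; omega

theorem flipS_spec {t : ℕ} (hP : L.Par t σ) (ht : 6 ≤ t) {b e y : Expr} (hb : b.Ok E σ)
    (he : e.Ok E σ) (hy : y.Ok E σ) (hi : b.eval E σ + e.eval E σ / L.U < E.sp)
    (hy2 : y.eval E σ < 2) {Q : ℕ → St → Prop}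
    (hQ : Q 1 (σ.put (b.eval E σ + e.eval E σ / L.U)
      (σ.m (b.eval E σ + e.eval E σ / L.U) ^^^ (y.eval E σ <<< (e.eval E σ % L.U))))) :
    Tri E (flipS b e y) σ Q := by
  have hbig := L.big'
  have hU : σ.v 5 = L.U := hP 5 (by omega)
  have h4 := L.four_lt
  have h1 := L.bit_shl_lt (i := e.eval E σ) hy2
  refine Tri.store ?_ ?_ ?_ ?_
  · simp [hU, hb, he]; omega
  · simp [hU, hb, he, hi, hy, h1]; omega
  · simpa [hU] using hi
  · simpa [hU] using hQ

end Layout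

/-! ### Initialization -/

theorem size_half {x : ℕ} (hx : 0 < x) : x.size = (x / 2).size + 1 := by
  conv_lhs => rw [← Nat.bit_bodd_div2 x]
  rw [Nat.size_bit (by rw [Nat.bit_bodd_div2]; omega), Nat.div2_val]

theorem div_two_pow_pos_iff {x j : ℕ} : 0 < x / 2 ^ j ↔ j < x.size := by
  rw [Nat.lt_size, Nat.div_pos_iff]
  simp

theorem size_le_self (x : ℕ) : x.size ≤ x := Nat.size_le.2 x.lt_two_pow_self

namespace Layout

variable {E : Env} {L : Layout E} {σ : St}

theorem sizeS_spec (x y : ℕ) (hx : x < 40) (hy : y < 40) (hxy : x ≠ y) (hb : 4 < 2 ^ E.w)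
    (hs : (σ.v x).size < 2 ^ E.w) :
    Tri E (sizeS x y) σ fun t σ' => t ≤ 3 * (σ.v x).size + 2 ∧ σ'.v y = (σ.v x).size ∧
      (∀ z, z ≠ x → z ≠ y → σ'.v z = σ.v z) ∧ σ'.m = σ.m ∧ σ'.o = σ.o := by
  have hw0 : 0 < E.w := by by_contra h; simp [show E.w = 0 by omega] at hb
  refine Tri.seq (Tri.assign (by simp) ?_)
  refine Tri.mono (Tri.loop (α := ℕ) (fun g τ => τ.v x = g ∧ τ.v y + g.size = (σ.v x).size ∧
    (∀ z, z ≠ x → z ≠ y → τ.v z = σ.v z) ∧ τ.m = σ.m ∧ τ.o = σ.o) (fun g => 3 * g.size)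
    ?_ ?_ (σ.v x) ?_) ?_
  · intro g τ _; simp [hx]
  · rintro g τ ⟨h1, h2, h3, h4, h5⟩ hc
    simp only [Expr.eval_zero, Expr.eval_var, h1] at hc
    have hg := size_half hc
    refine Tri.seq (Tri.assign (by simp [hx]; omega) (Tri.assign ?_ ?_))
    · simp [hy, hxy.symm]; omega
    · refine ⟨g / 2, ⟨?_, ?_, ?_, h4, h5⟩, ?_⟩
      · simp [h1, hxy]
      · simp [hxy.symm]; omega
      · intro z hz1 hz2; simp [hz1, hz2, h3]
      · omega
  · refine ⟨by simp [hxy], by simp, ?_, rfl, rfl⟩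
    intro z hz1 hz2; simp [hz2]
  · rintro t τ ⟨g, ⟨h1, h2, h3, h4, h5⟩, hc, ht⟩
    simp only [Expr.eval_zero, Expr.eval_var, h1, not_lt, Nat.le_zero] at hc
    subst hc
    simp only [Nat.size_zero, add_zero] at h2
    exact ⟨by omega, h2, h3, h4, h5⟩

theorem setupS_spec (L : Layout E) (h0 : σ.v 0 = L.n) (h1 : σ.v 1 = E.w) :
    Tri E setupS σ fun t σ' => t ≤ 20 * L.n ∧ L.Par 8 σ' ∧ σ'.m = σ.m ∧ σ'.o = σ.o := by
  have hb := L.four_lt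
  have hw0 := L.w_pos
  have hn := L.n_pos
  have hbig := L.big'
  have hnN := L.n_le_N
  have hw := E.w.lt_two_pow_self
  have hs := size_le_self L.n
  have hU := L.U_le
  have hhlt := L.h_lt
  have hslt := L.s_lt
  have hrel : L.h * L.lg < 2 ^ E.w := by
    rw [mul_comm]
    exact L.rel_lt.trans (Nat.pow_lt_pow_right (by norm_num) L.s_lt)
  have hsn : L.s ≤ 2 * L.n := by
    rw [L.s_eq, Nat.size_le]
    have e1 : L.h ≤ 2 ^ L.lg := by
      have hk : E.w < (L.k + 1) * (L.lg / 4 + 1) := by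
        rw [L.k_eq, mul_comm]; exact Nat.lt_mul_div_succ _ (by omega)
      have hk0 := L.k_pos
      have : L.h < 2 * (L.lg / 4 + 1) := by
        rw [L.h_eq, Nat.div_lt_iff_lt_mul hk0]
        nlinarith
      have := L.lg.lt_two_pow_self
      have := L.lg_pos
      omega
    calc L.h * L.lg < 2 ^ L.lg * 2 ^ L.lg :=
          Nat.mul_lt_mul_of_le_of_lt e1 L.lg.lt_two_pow_self (by positivity)
      _ = 2 ^ (2 * L.lg) := by rw [← pow_add]; congr 1; omega
      _ ≤ 2 ^ (2 * L.n) := Nat.pow_le_pow_right (by norm_num) (by rw [L.lg_eq]; omega)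
  refine Tri.seq (Tri.assign (by simp) (Tri.seq (Tri.mono (sizeS_spec 20 2 (by norm_num)
    (by norm_num) (by norm_num) hb ?_) ?_)))
  · simp [h0]; omega
  rintro t1 σ1 ⟨ht1, a1, a2, a3, a4⟩
  simp only [St.set_v, Expr.eval_var, h0, if_true, ← L.lg_eq] at a1 ht1
  have b0 : σ1.v 0 = L.n := by rw [a2 0 (by norm_num) (by norm_num)]; simp [h0]
  have b1 : σ1.v 1 = E.w := by rw [a2 1 (by norm_num) (by norm_num)]; simp [h1]
  have hlg : L.lg / 4 + 1 < 2 ^ E.w := by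
    have := L.lg_eq
    omega
  refine Tri.seq (Tri.assign (by simp [a1, hb, hlg]; omega) (Tri.seq (Tri.assign (by simp)
    (Tri.seq (Tri.assign ?_ (Tri.seq (Tri.assign ?_ (Tri.seq (Tri.mono (sizeS_spec 20 6
    (by norm_num) (by norm_num) (by norm_num) hb ?_) ?_)))))))))
  · simp [a1, b1, ← L.k_eq, ← L.h_eq]
    rw [U] at hU; omega
  · simp [a1, b1, ← L.k_eq, ← L.h_eq, hrel]
  · simp [a1, b1, ← L.k_eq, ← L.h_eq, ← L.s_eq]; omega
  rintro t2 σ2 ⟨ht2, c1, c2, c3, c4⟩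
  simp [a1, b1, ← L.k_eq, ← L.h_eq, ← L.s_eq] at ht2 c1 c3 c4
  have d0 : σ2.v 0 = L.n := by rw [c2 0 (by norm_num) (by norm_num)]; simp [b0]
  have d1 : σ2.v 1 = E.w := by rw [c2 1 (by norm_num) (by norm_num)]; simp [b1]
  have d2 : σ2.v 2 = L.lg := by rw [c2 2 (by norm_num) (by norm_num)]; simp [a1]
  have d3 : σ2.v 3 = L.k := by
    rw [c2 3 (by norm_num) (by norm_num)]; simp [a1, b1, ← L.k_eq]
  have d4 : σ2.v 4 = L.h := by
    rw [c2 4 (by norm_num) (by norm_num)]; simp [a1, b1, ← L.k_eq, ← L.h_eq]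
  have d5 : σ2.v 5 = L.U := by
    rw [c2 5 (by norm_num) (by norm_num)]; simp [a1, b1, ← L.k_eq, ← L.h_eq, U]
  refine Tri.assign (by simp) ⟨?_, ?_, ?_, ?_⟩
  · have := L.lg_eq
    omega
  · intro x hx
    interval_cases x <;> simp [d0, d1, d2, d3, d4, d5, c1, ← L.kR_eq]
  · simp [c3, a3]
  · simp [c4, a4]

/-- The initial value of the counter of the vertex `v`. -/
def ini (E : Env) (v : ℕ) : ℕ := E.ans .inDeg v 0 - 1

theorem initS_spec (L : Layout E) {v : ℕ} (hv : σ.v 18 = v) {Q : ℕ → St → Prop}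
    (hQ : ∀ t σ', t ≤ 4 → σ'.v 20 = ini E v → σ'.v 21 = 0 →
      (∀ z, z ≠ 20 → z ≠ 21 → σ'.v z = σ.v z) → σ'.m = σ.m → σ'.o = σ.o → Q t σ') :
    Tri E initS σ Q := by
  have hb := L.four_lt
  have hw0 := L.w_pos
  have h0 : 0 < 2 ^ E.w := by omega
  refine Tri.seq (Tri.assign (by simp) (Tri.seq (Tri.cond (by simp) (by simp) ?_ ?_)))
  · intro hc
    simp [hv] at hc
    refine Tri.assign ?_ (Tri.assign (by simp) (hQ _ _ (by omega) ?_ ?_ ?_ ?_ ?_))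
    · simp [hv]; omega
    · simp [hv, ini]
    · simp
    · intro z h1 h2; simp [h1, h2]
    · simp
    · simp
  · intro hc
    simp [hv] at hc
    refine Tri.skip (Tri.assign (by simp) (hQ _ _ (by omega) ?_ ?_ ?_ ?_ ?_))
    · simp [hv, ini, hc]
    · simp
    · intro z h1 h2; simp [h1, h2]
    · simp
    · simp

theorem sum_Ico_step {f : ℕ → ℕ} {v n : ℕ} (h : v < n) :
    ∑ u ∈ Finset.Ico v n, f u = f v + ∑ u ∈ Finset.Ico (v + 1) n, f u :=
  Finset.sum_eq_sum_Ico_succ_bot h f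

theorem c_eq_size (L : Layout E) {v : ℕ} (hv : v < L.n) : L.c v = (ini E v).size := L.c_eq v hv

theorem countS_spec (L : Layout E) (hP : L.Par 8 σ) (hm : σ.m = fun _ => 0) :
    Tri E countS σ fun t σ' => t ≤ 12 * (L.n + ∑ v ∈ Finset.range L.n, L.c v) ∧ L.Par 8 σ' ∧
      (∀ a, 0 < a → σ'.m a = cnt L.c a L.n) ∧ σ'.o = σ.o := by
  have hb := L.four_lt
  have hw0 := L.w_pos
  have h0 : 0 < 2 ^ E.w := by omega
  have hn := L.n_pos
  have hbig := L.big'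
  have hnN := L.n_le_N
  obtain ⟨b1, b2, b3, b4, b5, b6, b7, b8, b9, b10⟩ := L.bases
  refine Tri.seq (Tri.assign (by simp) ?_)
  refine Tri.mono (Tri.loop (α := ℕ) (fun v τ => v ≤ L.n ∧ τ.v 18 = v ∧ L.Par 8 τ ∧
    (∀ a, 0 < a → τ.m a = cnt L.c a v) ∧ τ.o = σ.o)
    (fun v => ∑ u ∈ Finset.Ico v L.n, (4 * L.c u + 7)) ?_ ?_ 0 ?_) ?_
  · intro g τ _; simp
  · rintro v τ ⟨h1, h2, h3, h4, h5⟩ hc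
    have hn' : τ.v 0 = L.n := h3 0 (by norm_num)
    simp only [Expr.eval_var, h2, hn'] at hc
    have hcs := L.c_eq_size hc
    have hcl := L.c_le v hc
    refine Tri.seq (initS_spec L h2 ?_)
    intro t1 σ1 ht1 a1 a2 a3 a4 a5
    refine Tri.seq (Tri.mono (Tri.loop (α := ℕ) (fun j τ => j ≤ L.c v ∧ τ.v 21 = j ∧
      τ.v 20 = ini E v / 2 ^ j ∧ τ.v 18 = v ∧ L.Par 8 τ ∧
      (∀ a, 0 < a → τ.m a = cnt L.c a v + if a ≤ j then 1 else 0) ∧ τ.o = σ.o)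
      (fun j => 4 * (L.c v - j)) ?_ ?_ 0 ?_) ?_)
    · intro g τ _; simp
    · rintro j τ ⟨h1, h2, h3, h4, h5, h6, h7⟩ hc'
      simp only [Expr.eval_zero, Expr.eval_var, h3, div_two_pow_pos_iff, ← hcs] at hc'
      have hcn : cnt L.c (j + 1) v ≤ v := Nat.count_le _
      refine Tri.seq (Tri.assign ?_ (Tri.seq (Tri.store ?_ ?_ ?_ (Tri.assign ?_ ?_))))
      · simp [h2]; omega
      · simp
      · simp [h2, h6]; omega
      · simp [h2]; omega
      · simp; omega
      · refine ⟨j + 1, ⟨hc', by simp [h2], ?_, by simp [h4], ?_, ?_, by simp [h7]⟩, by omega⟩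
        · simp [h3, Nat.div_div_eq_div_mul, pow_succ]
        · exact (Par.put (h5.set _ _ (by norm_num)) _ _).set _ _ (by norm_num)
        · intro a ha
          simp [h2, Function.update_apply]
          split_ifs with e1 e2 e2
          · subst e1; simp [h6]
          · omega
          · rw [h6 a ha, if_pos (by omega)]
          · rw [h6 a ha, if_neg (by omega)]
    · refine ⟨Nat.zero_le _, a2, by simp [a1], by rw [a3 18 (by norm_num) (by norm_num), h2],
        fun x hx => ?_, fun a ha => ?_, by rw [a5, h5]⟩
      · rw [a3 x (by omega) (by omega)]; exact h3 x hx
      · rw [a4, h4 a ha, if_neg (by omega)]; rfl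
    · rintro t2 σ2 ⟨j, ⟨h1, h2, h3, h4, h5, h6, h7⟩, hc', ht2⟩
      simp only [Expr.eval_zero, Expr.eval_var, h3, div_two_pow_pos_iff, ← hcs] at hc'
      obtain rfl : j = L.c v := by omega
      refine Tri.assign ?_ ⟨v + 1, ⟨hc, by simp [h4], h5.set _ _ (by norm_num), fun a ha => ?_,
        by simp [h7]⟩, ?_⟩
      · simp [h4]; omega
      · rw [cnt_succ]; exact h6 a ha
      · rw [sum_Ico_step hc]; omega
  · exact ⟨Nat.zero_le _, by simp, hP.set _ _ (by norm_num), fun a ha => by simp [hm], rfl⟩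
  · rintro t σ' ⟨v, ⟨h1, h2, h3, h4, h5⟩, hc, ht⟩
    have hn' : σ'.v 0 = L.n := h3 0 (by norm_num)
    simp only [Expr.eval_var, h2, hn'] at hc
    obtain rfl : v = L.n := by omega
    refine ⟨?_, h3, h4, h5⟩
    simp only [Finset.Ico_self, Finset.sum_empty, ← Finset.range_eq_Ico, Finset.sum_add_distrib,
      ← Finset.mul_sum, Finset.sum_const, Finset.card_range, smul_eq_mul] at ht
    omega

theorem prefixS_spec (L : Layout E) (hP : L.Par 8 σ)
    (hm : ∀ a, 0 < a → σ.m a = cnt L.c a L.n) :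
    Tri E prefixS σ fun t σ' => t ≤ 8 * L.n ∧ L.Par 8 σ' ∧ σ'.v 25 = L.N ∧
      (∀ a, 0 < a → a ≤ L.lg → σ'.m a = start L.c L.n a) ∧ (∀ a, L.lg < a → σ'.m a = 0) ∧
      σ'.o = σ.o := by
  have hb := L.four_lt
  have hw0 := L.w_pos
  have h0 : 0 < 2 ^ E.w := by omega
  have hn := L.n_pos
  have hbig := L.big'
  have hlgn : L.lg ≤ L.n := by rw [L.lg_eq]; exact size_le_self _
  obtain ⟨b1, b2, b3, b4, b5, b6, b7, b8, b9, b10⟩ := L.bases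
  refine Tri.seq (Tri.assign (by simp) (Tri.seq (Tri.assign (by simp) ?_)))
  refine Tri.mono (Tri.loop (α := ℕ) (fun j τ => j ≤ L.lg ∧ τ.v 21 = j ∧ L.Par 8 τ ∧
    τ.v 25 = start L.c L.n (j + 1) ∧ (∀ a, 0 < a → τ.m a = if a ≤ j then start L.c L.n a else
      cnt L.c a L.n) ∧ τ.o = σ.o) (fun j => 5 * (L.lg - j)) ?_ ?_ 0 ?_) ?_
  · intro g τ _; simp
  · rintro j τ ⟨h1, h2, h3, h4, h5, h6⟩ hc
    have hlg : τ.v 2 = L.lg := h3 2 (by norm_num)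
    simp only [Expr.eval_var, h2, hlg] at hc
    have hN : start L.c L.n (j + 1 + 1) ≤ L.N := start_mono _ _ (by omega)
    rw [start_succ] at hN
    refine Tri.seq (Tri.assign ?_ (Tri.seq (Tri.assign ?_ (Tri.seq (Tri.store ?_ ?_ ?_
      (Tri.assign ?_ ?_))))))
    · simp [h2]; omega
    · simp [h2]; omega
    · simp
    · simp
    · simp [h2]; omega
    · simp [h2, h4, h5]; omega
    · refine ⟨j + 1, ⟨hc, by simp [h2], ?_, ?_, ?_, by simp [h6]⟩, by omega⟩
      · exact (Par.put ((h3.set _ _ (by norm_num)).set _ _ (by norm_num)) _ _).set _ _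
          (by norm_num)
      · simp [h2, h4, h5, start_succ]
      · intro a ha
        simp [h2, Function.update_apply]
        split_ifs with e1 e2 e2
        · subst e1; simp [h4]
        · omega
        · rw [h5 a ha, if_pos (by omega)]
        · rw [h5 a ha, if_neg (by omega)]
  · refine ⟨Nat.zero_le _, by simp, (hP.set _ _ (by norm_num)).set _ _ (by norm_num), ?_,
      fun a ha => ?_, rfl⟩
    · have : σ.v 0 = L.n := hP 0 (by norm_num)
      simp [this]
    · rw [if_neg (by omega)]; exact hm a ha
  · rintro t σ' ⟨j, ⟨h1, h2, h3, h4, h5, h6⟩, hc, ht⟩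
    have hlg : σ'.v 2 = L.lg := h3 2 (by norm_num)
    simp only [Expr.eval_var, h2, hlg] at hc
    obtain rfl : j = L.lg := by omega
    refine ⟨by omega, h3, h4, fun a ha ha' => by rw [h5 a ha, if_pos ha'], fun a ha => ?_, h6⟩
    rw [h5 a (by omega), if_neg (by omega), cnt, Nat.count_eq_card_filter_range,
      Finset.card_eq_zero, Finset.filter_eq_empty_iff]
    intro u hu
    have := L.c_le u (Finset.mem_range.1 hu)
    omega

theorem layoutS_spec (L : Layout E) (hP : L.Par 8 σ) (hN : σ.v 25 = L.N) :
    Tri E layoutS σ fun t σ' => t ≤ 6 ∧ L.Par 14 σ' ∧ σ'.m = σ.m ∧ σ'.o = σ.o := by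
  have hb := L.four_lt
  have hw0 := L.w_pos
  have hbig := L.big'
  obtain ⟨b1, b2, b3, b4, b5, b6, b7, b8, b9, b10⟩ := L.bases
  replace hP : ∀ x < 8, σ.v x = L.val x := hP
  have hNC : L.N / L.h + 1 = L.NC := L.NC_eq.symm
  have hle : L.N / L.h ≤ L.N := Nat.div_le_self _ _
  have h5 : 1 <<< L.h < 2 ^ E.w := shl_lt (s := 1) (by norm_num) (by have := L.h_lt; omega)
  have z1 : L.NC / L.lg < 2 ^ E.w := by omega
  have z2 : L.NC / L.kR < 2 ^ E.w := by omega
  have z3 : L.NC / L.k < 2 ^ E.w := by omega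
  have e1 := L.bT_eq.symm
  have e2 := L.bS_eq.symm
  have e3 := L.bR_eq.symm
  have e4 := L.bM_eq.symm
  have e5 := L.bD_eq.symm
  rw [← one_mul (2 ^ L.h), ← Nat.shiftLeft_eq] at e2
  refine Tri.seq (Tri.assign ?_ (Tri.seq (Tri.assign ?_ (Tri.seq (Tri.assign ?_
    (Tri.seq (Tri.assign ?_ (Tri.seq (Tri.assign ?_ (Tri.assign ?_ ?_))))))))))
  · simp [hP, hN]; omega
  · simp [hP]; omega
  · simp [hP, hN, e1, e2, h5]; omega
  · simp [hP, hN, e1, e2, hNC, e3]; omega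
  · simp [hP, hN, e1, e2, hNC, e3, e4]; omega
  · simp [hP, hN, e1, e2, hNC, e3, e4, e5]; omega
  · refine ⟨by omega, fun x hx => ?_, by simp, by simp⟩
    interval_cases x <;> simp [hP, hN, e1, e2, hNC, e3, e4, e5]

end Layout

/-! ### Filling in the data structure -/

theorem bit_update_ne {m : ℕ → ℕ} {b k i a x : ℕ} (h : b + i / k ≠ a) :
    bit (Function.update m a x) b k i = bit m b k i :=
  bit_congr (Function.update_of_ne h _ _)

namespace Layout

variable {E : Env} {L : Layout E} {σ : St}

/-- The memory contains the values `val v` in the counters. -/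
def Val (L : Layout E) (m : ℕ → ℕ) (val : ℕ → ℕ) : Prop :=
  ∀ v < L.n, ∀ j < L.c v, bit m L.bD L.U (rk L.c L.n (pos L.c L.n v j)) = val v / 2 ^ j % 2

theorem pos_lt_N (L : Layout E) {v j : ℕ} (hv : v < L.n) (hj : j ≤ L.c v) :
    pos L.c L.n v j < L.N :=
  (pos_lt hv hj).trans_le (start_mono _ _ (by have := L.c_le v hv; omega))

/-- The payload bits are numbered by the ranks of the predecessors of their nodes. -/
theorem rk_lt (L : Layout E) {v j : ℕ} (hv : v < L.n) (hj : j < L.c v) :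
    rk L.c L.n (pos L.c L.n v j) < L.N - L.n := by
  have h1 := rk_pos (c := L.c) v j hv
  have h2 := L.pos_lt_N hv (show j + 1 ≤ L.c v from hj)
  omega

/-- The memory while the marker bits and counters are filled in: the vertices before `v` have been
treated, and so have the first `j` bits of the vertex `v`. -/
structure Fill (L : Layout E) (v j : ℕ) (m : ℕ → ℕ) : Prop where
  ptr : ∀ a, 0 < a → a ≤ L.lg →
    m a = start L.c L.n a + cnt L.c a v + if a ≤ j then 1 else 0
  mark : ∀ p < L.NC * L.h, bit m L.bM L.U p = 1 ↔ ∃ u i, u < L.n ∧ i < L.c u ∧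
    (u < v ∨ u = v ∧ i < j) ∧ pos L.c L.n u i = p
  data : ∀ u < L.n, ∀ i < L.c u, bit m L.bD L.U (rk L.c L.n (pos L.c L.n u i)) =
    if u < v ∨ u = v ∧ i < j then ini E u / 2 ^ i % 2 else 0
  zero : ∀ a, L.bT ≤ a → a < L.bM → m a = 0

/-- The effect of one iteration of the inner loop of `fillS`: the node `p` gets a successor. -/
theorem Fill.step {L : Layout E} {v j : ℕ} {m : ℕ → ℕ} (h : L.Fill v j m) (hv : v < L.n)
    (hj : j < L.c v) {m1 m2 m3 : ℕ → ℕ} {p q : ℕ} (hp : p = pos L.c L.n v j)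
    (hq : q = rk L.c L.n p)
    (h1 : m1 = Function.update m (L.bM + p / L.U) (m (L.bM + p / L.U) ^^^ (1 <<< (p % L.U))))
    (h2 : m2 = Function.update m1 (j + 1) (pos L.c L.n v (j + 1) + 1))
    (h3 : m3 = Function.update m2 (L.bD + q / L.U) (m2 (L.bD + q / L.U) ^^^
      ((ini E v / 2 ^ j % 2) <<< (q % L.U)))) : L.Fill v (j + 1) m3 := by
  obtain ⟨b1, b2, b3, b4, b5, b6, b7, b8, b9, b10⟩ := L.bases
  have hcl := L.c_le v hv
  have hpN : p < L.N := by rw [hp]; exact L.pos_lt_N hv hj.le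
  have hNC := L.N_lt
  have ap : L.bM + p / L.U < L.bD := L.mark_addr (by omega)
  have ap' : L.bM ≤ L.bM + p / L.U := Nat.le_add_right _ _
  have aq' : L.bD ≤ L.bD + q / L.U := Nat.le_add_right _ _
  have not_yet : ∀ u i, u < L.n → i < L.c u → (u < v ∨ u = v ∧ i < j) →
      pos L.c L.n u i ≠ p := by
    intro u i hu hi hd e
    rw [hp] at e
    obtain ⟨rfl, rfl⟩ := pos_inj hu hi.le hv hj.le e
    omega
  refine ⟨?_, ?_, ?_, ?_⟩
  · intro a ha hal
    rw [h3, Function.update_of_ne (by omega), h2, Function.update_apply]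
    split_ifs with e1 e2 e2
    · subst e1; rw [pos]
    · omega
    · rw [h1, Function.update_of_ne (by omega), h.ptr a ha hal, if_pos (by omega)]
    · rw [h1, Function.update_of_ne (by omega), h.ptr a ha hal, if_neg (by omega)]
  · intro p' hp'
    have ap2 : L.bM + p' / L.U < L.bD := L.mark_addr hp'
    have ap2' : L.bM ≤ L.bM + p' / L.U := Nat.le_add_right _ _
    rw [h3, bit_update_ne (by omega), h2, bit_update_ne (by omega), h1, bit_xor _ _ _ _ _ _
      (by norm_num)]
    split_ifs with e
    · subst e
      have h0 : bit m L.bM L.U p' = 0 := by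
        have := bit_lt m L.bM L.U p'
        by_contra hne
        obtain ⟨u, i, hu, hi, hd, e⟩ := (h.mark p' hp').1 (by omega)
        exact not_yet u i hu hi hd e
      rw [h0]
      simp only [Nat.zero_xor, true_iff]
      exact ⟨v, j, hv, hj, Or.inr ⟨rfl, by omega⟩, hp.symm⟩
    · rw [h.mark p' hp']
      constructor
      · rintro ⟨u, i, hu, hi, hd, e'⟩
        exact ⟨u, i, hu, hi, by omega, e'⟩
      · rintro ⟨u, i, hu, hi, hd, e'⟩
        refine ⟨u, i, hu, hi, ?_, e'⟩
        rcases hd with hd | ⟨rfl, hd⟩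
        · exact Or.inl hd
        · rcases Nat.lt_succ_iff_lt_or_eq.1 hd with hd | rfl
          · exact Or.inr ⟨rfl, hd⟩
          · exact absurd (e'.symm.trans hp.symm) e
  · intro u hu i hi
    have ar := Nat.le_add_right L.bD (rk L.c L.n (pos L.c L.n u i) / L.U)
    have e2 : bit m2 L.bD L.U (rk L.c L.n (pos L.c L.n u i)) =
        bit m L.bD L.U (rk L.c L.n (pos L.c L.n u i)) := by
      rw [h2, bit_update_ne (by omega), h1, bit_update_ne (by omega)]
    rw [h3, bit_xor _ _ _ _ _ _ (Nat.mod_lt _ (by norm_num)), e2, h.data u hu i hi]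
    by_cases e : u = v ∧ i = j
    · obtain ⟨rfl, rfl⟩ := e
      rw [if_pos (by rw [hq, hp]), if_neg (by omega), if_pos (by omega), Nat.zero_xor]
    · rw [if_neg]
      · by_cases hd : u < v ∨ u = v ∧ i < j
        · rw [if_pos hd, if_pos (by omega)]
        · rw [if_neg hd, if_neg (by omega)]
      · intro e'
        rw [hq, hp] at e'
        exact e (rk_pos_inj hu hi hv hj e')
  · intro a ha ha'
    rw [h3, Function.update_of_ne (by omega), h2, Function.update_of_ne (by omega), h1,
      Function.update_of_ne (by omega)]
    exact h.zero a ha ha'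

theorem Fill.next {L : Layout E} {v : ℕ} {m : ℕ → ℕ} (h : L.Fill v (L.c v) m) :
    L.Fill (v + 1) 0 m := by
  refine ⟨fun a ha hal => ?_, fun p hp => ?_, fun u hu i hi => ?_, h.zero⟩
  · rw [h.ptr a ha hal, cnt_succ, if_neg (show ¬ a ≤ 0 by omega), add_zero, add_assoc]
  · rw [h.mark p hp]
    constructor <;> rintro ⟨u, i, hu, hi, hd, e'⟩ <;> refine ⟨u, i, hu, hi, ?_, e'⟩
    · omega
    · by_cases e : u = v
      · subst e; omega
      · omega
  · rw [h.data u hu i hi]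
    by_cases e : u = v
    · subst e; rw [if_pos (by omega), if_pos (by omega)]
    · congr 1; simp only [eq_iff_iff]; omega

theorem fillS_spec (L : Layout E) (hP : L.Par 14 σ)
    (hm : ∀ a, 0 < a → a ≤ L.lg → σ.m a = start L.c L.n a) (hm' : ∀ a, L.lg < a → σ.m a = 0) :
    Tri E fillS σ fun t σ' => t ≤ 16 * (L.n + ∑ v ∈ Finset.range L.n, L.c v) ∧ L.Par 14 σ' ∧
      L.Fill L.n 0 σ'.m ∧ σ'.o = σ.o := by
  have hb := L.four_lt
  have hw0 := L.w_pos
  have h0 : 0 < 2 ^ E.w := by omega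
  have hn := L.n_pos
  have hbig := L.big'
  have hnN := L.n_le_N
  obtain ⟨b1, b2, b3, b4, b5, b6, b7, b8, b9, b10⟩ := L.bases
  refine Tri.seq (Tri.assign (by simp) ?_)
  refine Tri.mono (Tri.loop (α := ℕ) (fun v τ => v ≤ L.n ∧ τ.v 18 = v ∧ L.Par 14 τ ∧
    L.Fill v 0 τ.m ∧ τ.o = σ.o)
    (fun v => ∑ u ∈ Finset.Ico v L.n, (8 * L.c u + 9)) ?_ ?_ 0 ?_) ?_
  · intro g τ _; simp
  · rintro v τ ⟨h1, h2, h3, h4, h5⟩ hc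
    have hn' : τ.v 0 = L.n := h3 0 (by norm_num)
    simp only [Expr.eval_var, h2, hn'] at hc
    have hcs := L.c_eq_size hc
    have hcl := L.c_le v hc
    refine Tri.seq (initS_spec L h2 ?_)
    intro t1 σ1 ht1 a1 a2 a3 a4 a5
    refine Tri.seq (Tri.assign (by simp) (Tri.seq (Tri.mono (Tri.loop (α := ℕ) (fun j τ =>
      j ≤ L.c v ∧ τ.v 21 = j ∧ τ.v 20 = ini E v / 2 ^ j ∧ τ.v 18 = v ∧ L.Par 14 τ ∧
      L.Fill v j τ.m ∧ τ.v 22 = pos L.c L.n v j ∧ τ.o = σ.o)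
      (fun j => 8 * (L.c v - j)) ?_ ?_ 0 ?_) ?_)))
    · intro g τ _; simp
    · rintro j τ ⟨h1, h2, h3, h4, h5, h6, h7, h8⟩ hc'
      simp only [Expr.eval_zero, Expr.eval_var, h3, div_two_pow_pos_iff, ← hcs] at hc'
      have hv0 : τ.v 0 = L.n := h5 0 (by norm_num)
      have hvU : τ.v 5 = L.U := h5 5 (by norm_num)
      have hv11 : τ.v 11 = L.bM := h5 11 (by norm_num)
      have hv12 : τ.v 12 = L.bD := h5 12 (by norm_num)
      have hpN := L.pos_lt_N hc hc'.le
      have hpN' := L.pos_lt_N hc (show j + 1 ≤ L.c v from hc')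
      have hqN := L.rk_lt hc hc'
      have hrk := rk_pos (c := L.c) v j hc
      have hNC := L.N_lt
      have ap : L.bM + pos L.c L.n v j / L.U < L.bD := L.mark_addr (by omega)
      have ap' : L.bM ≤ L.bM + pos L.c L.n v j / L.U := Nat.le_add_right _ _
      have aq := L.data_addr hqN
      have hptr : τ.m (j + 1) = pos L.c L.n v (j + 1) := by
        rw [h6.ptr _ (by omega) (by omega), if_neg (by omega), add_zero, pos]
      have hsub : pos L.c L.n v (j + 1) - L.n = rk L.c L.n (pos L.c L.n v j) := by omega
      have hptr' : Function.update τ.m (L.bM + pos L.c L.n v j / L.U)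
          (τ.m (L.bM + pos L.c L.n v j / L.U) ^^^ 1 <<< (pos L.c L.n v j % L.U)) (j + 1) =
          pos L.c L.n v (j + 1) := by
        rw [Function.update_of_ne (by omega), hptr]
      refine Tri.seq (flipS_spec h5 (by norm_num) (by simp) (by simp) (by simp; omega) ?_
        (by simp) ?_)
      · simp [hv11, h7]; omega
      simp only [Expr.eval_var, Expr.eval_one, hv11, h7]
      refine Tri.seq (Tri.assign ?_ (Tri.seq (Tri.assign ?_ (Tri.seq (Tri.store ?_ ?_ ?_
        (Tri.seq (Tri.assign ?_ (Tri.seq (flipS_spec (L := L) (t := 14) ?_ (by norm_num) (by simp)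
          (by simp) ?_ ?_ ?_ (Tri.assign ?_ ?_))))))))))
      · simp [h2]; omega
      · simp [h2]; omega
      · simp
      · simp [h2, hptr']; omega
      · simp [h2]; omega
      · simp [h2, hptr', hv0]; omega
      · exact (Par.put ((Par.set (Par.put h5 _ _) _ _ (by norm_num)).set _ _ (by norm_num))
          _ _).set _ _ (by norm_num)
      · simp; omega
      · simp [h2, hptr', hv0, hsub, hv12]; omega
      · simp; omega
      · simp; omega
      · refine ⟨j + 1, ⟨hc', by simp [h2], ?_, by simp [h4], ?_, ?_, ?_, by simp [h8]⟩, by omega⟩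
        · simp [h3, Nat.div_div_eq_div_mul, pow_succ]
        · exact (Par.put ((Par.put ((Par.set (Par.put h5 _ _) _ _ (by norm_num)).set _ _
            (by norm_num)) _ _).set _ _ (by norm_num)) _ _).set _ _ (by norm_num)
        · refine h6.step hc hc' rfl rfl rfl rfl ?_
          simp [h2, hptr', hv0, hsub, hv12, h3]
        · simp [h2, hptr']
    · refine ⟨Nat.zero_le _, by simp [a2], by simp [a1],
        by simp [a3 18 (by norm_num) (by norm_num), h2], ?_, ?_, ?_, ?_⟩
      · refine Par.set (fun x hx => ?_) _ _ (by norm_num)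
        rw [a3 x (by omega) (by omega)]; exact h3 x hx
      · simp [a4, h4]
      · simp [a3 18 (by norm_num) (by norm_num), h2]
      · simp [a5, h5]
    · rintro t2 σ2 ⟨j, ⟨h1, h2, h3, h4, h5, h6, h7, h8⟩, hc', ht2⟩
      simp only [Expr.eval_zero, Expr.eval_var, h3, div_two_pow_pos_iff, ← hcs] at hc'
      obtain rfl : j = L.c v := by omega
      refine Tri.assign ?_ ⟨v + 1, ⟨hc, by simp [h4], h5.set _ _ (by norm_num), ?_,
        by simp [h8]⟩, ?_⟩
      · simp [h4]; omega
      · exact h6.next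
      · rw [sum_Ico_step hc]; omega
  · refine ⟨Nat.zero_le _, by simp, hP.set _ _ (by norm_num), ⟨fun a ha hal => ?_,
      fun p hp => ?_, fun u hu i hi => ?_, fun a ha _ => ?_⟩, rfl⟩
    · rw [if_neg (by omega)]; simp [hm a ha hal]
    · have ap' : L.bM ≤ L.bM + p / L.U := Nat.le_add_right _ _
      simp only [St.set_m, bit, hm' (L.bM + p / L.U) (by omega)]
      simp
    · have ap' := Nat.le_add_right L.bD (rk L.c L.n (pos L.c L.n u i) / L.U)
      rw [if_neg (by omega)]
      simp only [St.set_m, bit,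
        hm' (L.bD + rk L.c L.n (pos L.c L.n u i) / L.U) (by omega)]
      simp
    · exact hm' a (by omega)
  · rintro t σ' ⟨v, ⟨h1, h2, h3, h4, h5⟩, hc, ht⟩
    have hn' : σ'.v 0 = L.n := h3 0 (by norm_num)
    simp only [Expr.eval_var, h2, hn'] at hc
    obtain rfl : v = L.n := by omega
    refine ⟨?_, h3, h4, h5⟩
    simp only [Finset.Ico_self, Finset.sum_empty, ← Finset.range_eq_Ico, Finset.sum_add_distrib,
      ← Finset.mul_sum, Finset.sum_const, Finset.card_range, smul_eq_mul] at ht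
    omega

theorem tableS_spec (L : Layout E) (hP : L.Par 14 σ)
    (hz : ∀ a, L.bT ≤ a → a < L.bM → σ.m a = 0) :
    Tri E tableS σ fun t σ' => t ≤ 5 * 2 ^ L.h ∧ L.Par 14 σ' ∧
      (∀ x < 2 ^ L.h, σ'.m (L.bT + x) = pc L.h x) ∧
      (∀ a, a < L.bT ∨ L.bS ≤ a → σ'.m a = σ.m a) ∧ σ'.o = σ.o := by
  have hb := L.four_lt
  have hw0 := L.w_pos
  have h0 : 0 < 2 ^ E.w := by omega
  have hbig := L.big'
  have h5 : 1 <<< L.h < 2 ^ E.w := shl_lt (s := 1) (by norm_num) (by have := L.h_lt; omega)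
  have h5' : 2 ^ L.h < 2 ^ E.w := Nat.pow_lt_pow_right (by norm_num) L.h_lt
  have hpos := Nat.two_pow_pos L.h
  obtain ⟨b1, b2, b3, b4, b5, b6, b7, b8, b9, b10⟩ := L.bases
  refine Tri.seq (Tri.assign (by simp) ?_)
  refine Tri.mono (Tri.loop (α := ℕ) (fun x τ => x ≤ 2 ^ L.h ∧ τ.v 20 = x ∧ L.Par 14 τ ∧
    (∀ y < 2 ^ L.h, τ.m (L.bT + y) = if y < x then pc L.h y else 0) ∧
    (∀ a, a < L.bT ∨ L.bS ≤ a → τ.m a = σ.m a) ∧ τ.o = σ.o)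
    (fun x => 3 * (2 ^ L.h - x)) ?_ ?_ 0 ?_) ?_
  · rintro x τ ⟨_, _, h3, _⟩
    have hv4 : τ.v 4 = L.h := h3 4 (by norm_num)
    simp [hv4, h5]; omega
  · rintro x τ ⟨h1, h2, h3, h4, h5, h6⟩ hc
    have hv4 : τ.v 4 = L.h := h3 4 (by norm_num)
    have hv8 : τ.v 8 = L.bT := h3 8 (by norm_num)
    simp only [Expr.eval_var, Expr.eval_shl, Expr.eval_one, h2, hv4, Nat.shiftLeft_eq,
      one_mul] at hc
    have hx2 : τ.m (L.bT + x / 2) + x % 2 = pc L.h x := by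
      rw [h4 _ (by omega)]
      rcases Nat.eq_zero_or_pos x with rfl | hx
      · simp
      · rw [if_pos (by omega), ← pc_half hc]
    have hpc : pc L.h x ≤ L.h := Nat.count_le _
    have := L.h_lt
    have := E.w.lt_two_pow_self
    refine Tri.seq (Tri.store ?_ ?_ ?_ (Tri.assign ?_ ?_))
    · simp [h2, hv8]; omega
    · simp [h2, hv8, hx2]; omega
    · simp [h2, hv8]; omega
    · simp [h2]; omega
    · refine ⟨x + 1, ⟨hc, by simp [h2], (Par.put h3 _ _).set _ _ (by norm_num), ?_, ?_,
        by simp [h6]⟩, by omega⟩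
      · intro y hy
        simp [h2, hv8, hx2, Function.update_apply]
        split_ifs with e1 e2 e2
        · rw [e1]
        · omega
        · rw [h4 y hy, if_pos (by omega)]
        · rw [h4 y hy, if_neg (by omega)]
      · intro a ha
        simp only [St.set_m, St.put_m, Expr.eval_add, Expr.eval_var, h2, hv8]
        rw [Function.update_of_ne (by omega), h5 a ha]
  · refine ⟨Nat.zero_le _, by simp, hP.set _ _ (by norm_num), fun y hy => ?_, fun a _ => rfl, rfl⟩
    rw [if_neg (by omega)]; exact hz _ (by omega) (by omega)
  · rintro t σ' ⟨x, ⟨h1, h2, h3, h4, h5, h6⟩, hc, ht⟩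
    have hv4 : σ'.v 4 = L.h := h3 4 (by norm_num)
    simp only [Expr.eval_var, Expr.eval_shl, Expr.eval_one, h2, hv4, Nat.shiftLeft_eq,
      one_mul] at hc
    refine ⟨by omega, h3, fun y hy => ?_, h5, h6⟩
    rw [h4 y hy, if_pos (by omega)]

theorem dirS_spec (L : Layout E) (hP : L.Par 14 σ)
    (htab : ∀ x < 2 ^ L.h, σ.m (L.bT + x) = pc L.h x)
    (hz : ∀ a, L.bS ≤ a → a < L.bM → σ.m a = 0)
    (hmark : ∀ p < L.NC * L.h, bit σ.m L.bM L.U p = 1 ↔ Mk L.c L.n p) :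
    Tri E dirS σ fun t σ' => t ≤ 7 * L.NC + 4 ∧ L.Par 14 σ' ∧ L.Dir σ'.m ∧
      (∀ a, L.bM ≤ a → σ'.m a = σ.m a) ∧ σ'.o = σ.o := by
  have hb := L.four_lt
  have hw0 := L.w_pos
  have h0 : 0 < 2 ^ E.w := by omega
  have hbig := L.big'
  have hw := E.w.lt_two_pow_self
  obtain ⟨b1, b2, b3, b4, b5, b6, b7, b8, b9, b10⟩ := L.bases
  have hrk : ∀ p, rk L.c L.n p ≤ p := fun p => by
    have := rk_le_of_le (c := L.c) (n := L.n) (Nat.zero_le p)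
    simpa [rk] using this
  have hNClt : ∀ i < L.NC, i * L.h ≤ L.N := by
    intro i hi
    rw [← Nat.le_div_iff_mul_le L.h_pos]
    have := L.NC_eq; rw [← N] at this; omega
  refine Tri.seq (Tri.assign (by simp) (Tri.seq (Tri.assign (by simp) (Tri.seq
    (Tri.assign (by simp) ?_)))))
  refine Tri.mono (Tri.loop (α := ℕ) (fun i τ => i ≤ L.NC ∧ τ.v 21 = i ∧ L.Par 14 τ ∧
    τ.v 25 = rk L.c L.n (i * L.h) ∧
    (¬ i % L.lg < 1 → τ.v 26 = rk L.c L.n (i / L.lg * L.lg * L.h)) ∧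
    (∀ i', i' * L.lg < i → τ.m (L.bS + i') = rk L.c L.n (i' * L.lg * L.h)) ∧
    (∀ i' < L.NC, field τ.m L.bR L.kR L.s i' = if i' < i then
      rk L.c L.n (i' * L.h) - rk L.c L.n (i' / L.lg * L.lg * L.h) else 0) ∧
    (∀ a, a < L.bS ∨ L.bM ≤ a → τ.m a = σ.m a) ∧ τ.o = σ.o)
    (fun i => 7 * (L.NC - i)) ?_ ?_ 0 ?_) ?_
  · intro x τ _; simp
  · rintro i τ ⟨h1, h2, h3, h4, h5, h6, h7, h8, h9⟩ hc
    have hv2 : τ.v 2 = L.lg := h3 2 (by norm_num)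
    have hv6 : τ.v 6 = L.s := h3 6 (by norm_num)
    have hv7 : τ.v 7 = L.kR := h3 7 (by norm_num)
    have hv8 : τ.v 8 = L.bT := h3 8 (by norm_num)
    have hv9 : τ.v 9 = L.bS := h3 9 (by norm_num)
    have hv10 : τ.v 10 = L.bR := h3 10 (by norm_num)
    have hv13 : τ.v 13 = L.NC := h3 13 (by norm_num)
    simp only [Expr.eval_var, h2, hv13] at hc
    have hiN := hNClt i hc
    have hri := hrk (i * L.h)
    have d1 : i / L.lg ≤ L.NC / L.lg := Nat.div_le_div_right hc.le
    have d2 : i / L.kR ≤ L.NC / L.kR := Nat.div_le_div_right hc.le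
    have dS := Nat.le_add_right L.bS (i / L.lg)
    have dR := Nat.le_add_right L.bR (i / L.kR)
    -- the first statement stores the absolute rank and makes it the new base
    have first : Tri E (.cond (♯v_j % ♯v_lg) 1
        (.store (♯v_S + ♯v_j / ♯v_lg) ♯v_acc ;; v_base ::= ♯v_acc) .skip) τ fun t τ' => t ≤ 3 ∧
          L.Par 14 τ' ∧ τ'.v 21 = i ∧ τ'.v 25 = rk L.c L.n (i * L.h) ∧
          τ'.v 26 = rk L.c L.n (i / L.lg * L.lg * L.h) ∧
          (∀ i', i' * L.lg < i + 1 → τ'.m (L.bS + i') = rk L.c L.n (i' * L.lg * L.h)) ∧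
          (∀ a, a < L.bS ∨ L.bR ≤ a → τ'.m a = τ.m a) ∧ τ'.o = σ.o := by
      refine Tri.cond (by simp) (by simp; omega) ?_ ?_
      · intro hm
        simp only [Expr.eval_mod, Expr.eval_var, Expr.eval_one, h2, hv2] at hm
        have hdvd : i / L.lg * L.lg = i := Nat.div_mul_cancel (Nat.dvd_of_mod_eq_zero (by omega))
        refine Tri.seq (Tri.store ?_ ?_ ?_ (Tri.assign (by simp) ⟨by omega, ?_, by simp [h2],
          by simp [h4], ?_, ?_, ?_, by simp [h9]⟩))
        · simp [h2, hv9, hv2]; omega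
        · simp
        · simp [h2, hv9, hv2]; omega
        · exact (Par.put h3 _ _).set _ _ (by norm_num)
        · simp [h4, hdvd]
        · intro i' hi'
          simp [h2, hv9, hv2, Function.update_apply]
          split_ifs with e
          · rw [h4, e, hdvd]
          · refine h6 i' ?_
            by_contra hge
            have : i' * L.lg = i := by omega
            rw [← this, Nat.mul_div_cancel _ L.lg_pos] at e
            exact e rfl
        · intro a ha
          simp only [St.set_m, St.put_m, Expr.eval_add, Expr.eval_var, Expr.eval_div, h2, hv9, hv2]
          rw [Function.update_of_ne (by omega)]
      · intro hm
        simp only [Expr.eval_mod, Expr.eval_var, Expr.eval_one, h2, hv2] at hm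
        refine Tri.skip ⟨by omega, h3, h2, h4, h5 hm, fun i' hi' => h6 i' ?_, fun a _ => rfl, h9⟩
        by_contra hge
        have : i' * L.lg = i := by omega
        rw [← this, Nat.mul_mod_left] at hm
        omega
    refine Tri.seq (Tri.mono first ?_)
    rintro t1 τ1 ⟨ht1, k3, k2, k4, k5, k6, k8, k9⟩
    have hw2 : τ1.v 2 = L.lg := k3 2 (by norm_num)
    have hw6 : τ1.v 6 = L.s := k3 6 (by norm_num)
    have hw7 : τ1.v 7 = L.kR := k3 7 (by norm_num)
    have hw8 : τ1.v 8 = L.bT := k3 8 (by norm_num)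
    have hw10 : τ1.v 10 = L.bR := k3 10 (by norm_num)
    have hmono : rk L.c L.n (i / L.lg * L.lg * L.h) ≤ rk L.c L.n (i * L.h) :=
      rk_mono (Nat.mul_le_mul_right _ (Nat.div_mul_le_self _ _))
    have hdiff : rk L.c L.n (i * L.h) - rk L.c L.n (i / L.lg * L.lg * L.h) < 2 ^ L.s := by
      have e1 := rk_le_of_le (c := L.c) (n := L.n)
        (Nat.mul_le_mul_right L.h (Nat.div_mul_le_self i L.lg))
      have e2 : i * L.h - i / L.lg * L.lg * L.h ≤ L.lg * L.h := by
        rw [← Nat.sub_mul]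
        refine Nat.mul_le_mul_right _ ?_
        have := Nat.div_add_mod' i L.lg
        have := Nat.mod_lt i L.lg_pos
        omega
      have := L.rel_lt
      omega
    have hoff : i % L.kR * L.s + L.s ≤ E.w :=
      (mod_mul_add_le L.kR_pos).trans L.kRs_le
    have hshl := shl_lt hdiff hoff
    have hR : ∀ i' < L.NC, field τ1.m L.bR L.kR L.s i' = field τ.m L.bR L.kR L.s i' := by
      intro i' _
      have := Nat.le_add_right L.bR (i' / L.kR)
      exact field_congr (k8 _ (by omega))
    have hchunk : ∀ τ' : St, L.Par 14 τ' → τ'.v 21 = i → (∀ a, L.bM ≤ a → τ'.m a = σ.m a) →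
        (chunkE ♯v_j).eval E τ' = field σ.m L.bM L.k L.h i ∧ (chunkE ♯v_j).Ok E τ' := by
      intro τ' p1 p2 p3
      have hlt : (♯v_j : Expr).eval E τ' < L.NC := by simpa [p2] using hc
      obtain ⟨c1, c2⟩ := chunkE_spec p1 (e := ♯v_j) (by simp) hlt
      refine ⟨?_, c2⟩
      rw [c1, Expr.eval_var, p2]
      exact field_congr (p3 _ (Nat.le_add_right _ _))
    have hcl : field σ.m L.bM L.k L.h i < 2 ^ L.h := fld_lt _ _ _
    have hrk1 : rk L.c L.n (i * L.h) + pc L.h (field σ.m L.bM L.k L.h i) =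
        rk L.c L.n ((i + 1) * L.h) := by
      rw [add_mul, one_mul, rk_chunk (b := L.bM) (k := L.k) (m := σ.m) le_rfl,
        Nat.mod_eq_of_lt hcl]
      intro l hl
      refine hmark _ ?_
      calc i * L.h + l < (i + 1) * L.h := by rw [add_mul]; omega
        _ ≤ L.NC * L.h := Nat.mul_le_mul_right _ hc
    have hpc : pc L.h (field σ.m L.bM L.k L.h i) ≤ L.h := Nat.count_le _
    have hhw := L.h_lt
    have hNCN : L.NC ≤ L.N + 1 := by
      have := L.NC_eq
      rw [← N] at this
      have := Nat.div_le_self L.N L.h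
      omega
    have hr2 := hrk ((i + 1) * L.h)
    have hr3 : (i + 1) * L.h = i * L.h + L.h := by ring
    have hP3 : L.Par 14 (τ1.put (L.bR + i / L.kR) (τ1.m (L.bR + i / L.kR) ^^^
      ((rk L.c L.n (i * L.h) - rk L.c L.n (i / L.lg * L.lg * L.h)) <<< (i % L.kR * L.s)))) :=
      Par.put k3 _ _
    obtain ⟨c1, c2⟩ := hchunk _ hP3 k2 (by
      intro a ha
      rw [St.put_m, Function.update_of_ne (by omega), k8 a (by omega), h8 a (by omega)])
    have hT : Function.update τ1.m (L.bR + i / L.kR) (τ1.m (L.bR + i / L.kR) ^^^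
        ((rk L.c L.n (i * L.h) - rk L.c L.n (i / L.lg * L.lg * L.h)) <<< (i % L.kR * L.s)))
        (L.bT + field σ.m L.bM L.k L.h i) = pc L.h (field σ.m L.bM L.k L.h i) := by
      rw [Function.update_of_ne (by omega), k8 _ (by omega), h8 _ (by omega), htab _ hcl]
    refine Tri.seq (Tri.store ?_ ?_ ?_ ?_)
    · simp [k2, hw10, hw7]; omega
    · simp [k2, hw10, hw7, hw6, k4, k5, hshl]; omega
    · simp [k2, hw10, hw7]; omega
    simp only [Expr.eval_add, Expr.eval_var, Expr.eval_div, Expr.eval_xor, Expr.eval_mem,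
      Expr.eval_shl, Expr.eval_sub, Expr.eval_mul, Expr.eval_mod, k2, hw10, hw7, hw6, k4, k5]
    refine Tri.seq (Tri.assign ?_ (Tri.assign ?_ ?_))
    · simp [c1, c2, k4, hw8, hT]; omega
    · simp [k2]; omega
    · refine ⟨i + 1, ⟨hc, by simp [k2], ?_, ?_, ?_, ?_, ?_, ?_, by simp [k9]⟩, by omega⟩
      · exact (Par.set hP3 _ _ (by norm_num)).set _ _ (by norm_num)
      · simp [c1, k4, hw8, hT, hrk1]
      · intro hm
        simp only [St.set_v, St.put_v, k5]
        have : (i + 1) / L.lg = i / L.lg := by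
          rw [Nat.succ_div, if_neg, add_zero]
          intro hd
          exact hm (by rw [Nat.mod_eq_zero_of_dvd hd]; norm_num)
        simp [this]
      · intro i' hi'
        have : i' ≤ L.NC / L.lg := by
          rw [Nat.le_div_iff_mul_le L.lg_pos]; omega
        simp only [St.set_m, St.put_m]
        rw [Function.update_of_ne (by omega), k6 i' hi']
      · intro i' hi'
        simp only [St.set_m, St.put_m]
        rw [field_xor _ _ _ _ _ _ _ hdiff, hR i' hi', h7 i' hi']
        by_cases e1 : i' = i
        · rw [if_pos e1, if_neg (by omega), if_pos (by omega), e1, Nat.zero_xor]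
        · rw [if_neg e1]
          by_cases e2 : i' < i
          · rw [if_pos e2, if_pos (by omega)]
          · rw [if_neg e2, if_neg (by omega)]
      · intro a ha
        simp only [St.set_m, St.put_m]
        rw [Function.update_of_ne (by omega), k8 a (by omega), h8 a ha]
  · refine ⟨Nat.zero_le _, by simp, ((hP.set _ _ (by norm_num)).set _ _ (by norm_num)).set _ _
      (by norm_num), by simp [rk], by simp, fun i' hi' => by omega, fun i' hi' => ?_,
      fun a _ => rfl, rfl⟩
    have d2 : i' / L.kR ≤ L.NC / L.kR := Nat.div_le_div_right hi'.le
    have dR := Nat.le_add_right L.bR (i' / L.kR)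
    simp only [St.set_m, field]
    rw [hz _ (by omega) (by omega)]
    simp [fld]
  · rintro t σ' ⟨i, ⟨h1, h2, h3, h4, h5, h6, h7, h8, h9⟩, hc, ht⟩
    have hv13 : σ'.v 13 = L.NC := h3 13 (by norm_num)
    simp only [Expr.eval_var, h2, hv13] at hc
    obtain rfl : i = L.NC := by omega
    refine ⟨by omega, h3, ⟨fun x hx => ?_, h6, fun i hi => ?_, fun p hp => ?_⟩,
      fun a ha => h8 a (Or.inr ha), h9⟩
    · rw [h8 _ (Or.inl (by omega))]; exact htab x hx
    · rw [h7 i hi, if_pos hi]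
    · rw [bit_congr (h8 _ (Or.inr (Nat.le_add_right _ _)))]; exact hmark p hp

end Layout

/-! ### Operations on counters -/

/-- Adding `2 ^ j` to a number whose bit number `j` is `0` sets this bit. -/
theorem add_two_pow_bit {a j : ℕ} (h : a / 2 ^ j % 2 = 0) (i : ℕ) :
    (a + 2 ^ j) / 2 ^ i % 2 = if i = j then 1 else a / 2 ^ i % 2 := by
  rcases lt_trichotomy i j with hi | rfl | hi
  · obtain ⟨e, rfl⟩ := Nat.exists_eq_add_of_lt hi
    rw [if_neg (by omega), show i + e + 1 = i + (e + 1) by ring, pow_add,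
      Nat.add_mul_div_left _ _ (by positivity), pow_succ]
    omega
  · rw [if_pos rfl, Nat.add_div_right _ (by positivity)]
    omega
  · obtain ⟨e, rfl⟩ := Nat.exists_eq_add_of_lt hi
    have h1 : (a + 2 ^ j) / 2 ^ (j + 1) = a / 2 ^ (j + 1) := by
      rw [pow_succ, ← Nat.div_div_eq_div_mul, ← Nat.div_div_eq_div_mul,
        Nat.add_div_right _ (by positivity)]
      omega
    rw [if_neg (by omega), show j + e + 1 = (j + 1) + e by ring, pow_add,
      ← Nat.div_div_eq_div_mul, h1, Nat.div_div_eq_div_mul]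

theorem div_of_dvd_add {x j : ℕ} (h : 2 ^ j ∣ x) : (x + (2 ^ j - 1)) / 2 ^ j = x / 2 ^ j := by
  obtain ⟨y, rfl⟩ := h
  have := Nat.two_pow_pos j
  rw [Nat.mul_add_div this, Nat.mul_div_cancel_left _ this, Nat.div_eq_of_lt (by omega), add_zero]

namespace Layout

variable {E : Env} {L : Layout E} {σ : St}

theorem lg_le_w (L : Layout E) : L.lg ≤ E.w := by
  have h1 := L.big'
  have h2 := L.n_le_N
  have h3 : L.n < 2 ^ E.w := by
    have := L.bases
    omega
  rw [L.lg_eq]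
  exact Nat.size_le.2 h3

/-- Flipping a payload bit changes one bit of one counter, as different nodes have different
ranks. -/
theorem Val.flip {m : ℕ → ℕ} {val : ℕ → ℕ} (h : L.Val m val) {v j y x : ℕ} (hv : v < L.n)
    (hj : j < L.c v) (hy : y < 2) {q : ℕ} (hq : q = rk L.c L.n (pos L.c L.n v j))
    (hx : ∀ i < L.c v, x / 2 ^ i % 2 = if i = j then (val v / 2 ^ j % 2) ^^^ y
      else val v / 2 ^ i % 2) :
    L.Val (Function.update m (L.bD + q / L.U) (m (L.bD + q / L.U) ^^^ (y <<< (q % L.U))))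
      (Function.update val v x) := by
  intro u hu i hi
  rw [bit_xor _ _ _ _ _ _ hy, h u hu i hi, hq]
  by_cases e : u = v
  · subst e
    rw [Function.update_self, hx i hi]
    by_cases e : i = j
    · subst e; rw [if_pos rfl, if_pos rfl]
    · rw [if_neg e, if_neg]
      exact fun e' => e (rk_pos_inj hu hi hu hj e').2
  · rw [Function.update_of_ne e, if_neg]
    exact fun e' => e (rk_pos_inj hu hi hv hj e').1

theorem nextS_spec {v j : ℕ} (hP : L.Par 14 σ) (hD : L.Dir σ.m) (hv : v < L.n) (hj : j < L.c v)
    (hp : σ.v 22 = pos L.c L.n v j) {Q : ℕ → St → Prop}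
    (hQ : Q 2 ((σ.set 23 (rk L.c L.n (pos L.c L.n v j))).set 22 (pos L.c L.n v (j + 1)))) :
    Tri E nextS σ Q := by
  have hbig := L.big'
  have h1 := L.pos_lt_N hv hj.le
  have h2 := L.pos_lt_N hv (show j + 1 ≤ L.c v from hj)
  have h3 := rk_pos (c := L.c) v j hv
  have hv0 : σ.v 0 = L.n := hP 0 (by norm_num)
  obtain ⟨e1, e2⟩ := rankE_spec hP hD (e := ♯v_p) (by simp) (by simpa [hp] using h1)
  rw [Expr.eval_var, hp] at e1
  refine Tri.seq (Tri.assign e2 (Tri.assign ?_ ?_))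
  · simp [hv0, e1]; omega
  · simpa [hv0, e1, h3] using hQ

theorem markE_spec {v j : ℕ} (hP : L.Par 14 σ) (hD : L.Dir σ.m) (hv : v < L.n) (hj : j ≤ L.c v)
    (hp : σ.v 22 = pos L.c L.n v j) :
    (bitE ♯v_M ♯v_p).eval E σ = (if j < L.c v then 1 else 0) ∧ (bitE ♯v_M ♯v_p).Ok E σ := by
  have h1 := L.pos_lt_N hv hj
  have h2 := L.N_lt
  have h3 := L.mark_addr (h1.trans h2)
  have h4 := L.bases
  have hv11 : σ.v 11 = L.bM := hP 11 (by norm_num)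
  obtain ⟨e1, e2⟩ := bitE_spec hP (by norm_num) (b := ♯v_M) (e := ♯v_p) (by simp) (by simp)
    (by simp [hp, hv11]; omega)
  refine ⟨?_, e2⟩
  rw [e1, Expr.eval_var, Expr.eval_var, hp, hv11]
  have h5 := hD.mark _ (h1.trans h2)
  rw [mk_pos hv hj] at h5
  have h6 := bit_lt σ.m L.bM L.U (pos L.c L.n v j)
  split_ifs with h
  · exact h5.2 h
  · have := mt h5.1 h
    omega

theorem dataE_spec {q : ℕ} (hP : L.Par 14 σ) (hq : σ.v 23 = q) (hlt : q < L.N - L.n) :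
    (bitE ♯v_D ♯v_q).eval E σ = bit σ.m L.bD L.U q ∧ (bitE ♯v_D ♯v_q).Ok E σ := by
  have h3 := L.data_addr hlt
  have hv12 : σ.v 12 = L.bD := hP 12 (by norm_num)
  obtain ⟨e1, e2⟩ := bitE_spec hP (by norm_num) (b := ♯v_D) (e := ♯v_q) (by simp) (by simp)
    (by simp [hq, hv12]; omega)
  exact ⟨by rw [e1, Expr.eval_var, Expr.eval_var, hq, hv12], e2⟩

/-- At most the memory area of the payload bits and the variables from `19` on have changed. -/
structure Frame (L : Layout E) (σ σ' : St) : Prop where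
  v : ∀ z < 19, σ'.v z = σ.v z
  m : ∀ a < L.bD, σ'.m a = σ.m a
  o : σ'.o = σ.o

theorem Frame.par {σ' : St} (h : L.Frame σ σ') (hP : L.Par 14 σ) : L.Par 14 σ' := fun x hx => by
  rw [h.v x (by omega)]; exact hP x hx

theorem Frame.dir {σ' : St} (h : L.Frame σ σ') (hD : L.Dir σ.m) : L.Dir σ'.m :=
  hD.congr fun a _ ha => h.m a ha

theorem Frame.refl (σ : St) : L.Frame σ σ := ⟨fun _ _ => rfl, fun _ _ => rfl, rfl⟩

theorem Frame.set {σ' : St} (h : L.Frame σ σ') {x : ℕ} (hx : 19 ≤ x) (a : ℕ) :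
    L.Frame σ (σ'.set x a) :=
  ⟨fun z hz => by rw [St.set_v, if_neg (by omega), h.v z hz], h.m, h.o⟩

theorem Frame.put {σ' : St} (h : L.Frame σ σ') (a x : ℕ) : L.Frame σ (σ'.put (L.bD + a) x) :=
  ⟨h.v, fun b hb => by rw [St.put_m, Function.update_of_ne (by omega), h.m b hb], h.o⟩

/-- The number of bits that change when `x > 0` is decremented is determined by the largest power
of two that divides `x`, whence the bound `J`. A counter that is `0` is left with the contents `y`
that do not matter, since it is overwritten next. -/
theorem decS_spec {v : ℕ} (hP : L.Par 14 σ) (hD : L.Dir σ.m) {val : ℕ → ℕ} (hV : L.Val σ.m val)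
    (hv : v < L.n) (hσ : σ.v 18 = v) (hx : val v < 2 ^ L.c v) {J : ℕ}
    (hJ : ∀ j < L.c v, 2 ^ j ∣ val v → j < J) :
    Tri E decS σ fun t σ' => t ≤ 5 * J + 3 ∧ L.Frame σ σ' ∧
      σ'.v 24 = (if val v = 0 then 1 else 0) ∧
      ∃ y, L.Val σ'.m (Function.update val v y) ∧ (0 < val v → y = val v - 1) := by
  have hb := L.four_lt
  have hw0 := L.w_pos
  refine Tri.seq (Tri.assign (by simp) (Tri.seq (Tri.assign (by simp; omega) ?_)))
  -- While the borrow is pending, the lowest `j` bits, which were `0`, have become `1`: the counter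
  -- holds `val v + (2 ^ j - 1)`.
  refine Tri.mono (Tri.loop (α := ℕ) (fun j τ => j ≤ L.c v ∧ L.Frame σ τ ∧
    τ.v 22 = pos L.c L.n v j ∧
    (τ.v 24 = 1 ∧ 2 ^ j ∣ val v ∧ L.Val τ.m (Function.update val v (val v + (2 ^ j - 1))) ∨
      τ.v 24 = 0 ∧ 0 < val v ∧ L.Val τ.m (Function.update val v (val v - 1))))
    (fun j => 5 * (J - j)) ?_ ?_ 0 ?_) ?_
  · rintro j τ ⟨h1, h2, h3, h4⟩
    obtain ⟨e1, e2⟩ := markE_spec (h2.par hP) (h2.dir hD) hv h1 h3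
    have h24 : τ.v 24 ≤ 1 := by rcases h4 with h4 | h4 <;> omega
    simp only [Expr.ok_one, Expr.ok_add, Expr.ok_var, e1, e2, Expr.eval_var, true_and]
    clear h4
    split_ifs <;> omega
  · rintro j τ ⟨h1, h2, h3, h4⟩ hc
    obtain ⟨e1, e2⟩ := markE_spec (h2.par hP) (h2.dir hD) hv h1 h3
    simp only [Expr.eval_one, Expr.eval_add, Expr.eval_var, e1] at hc
    obtain ⟨h4, hd, hVj⟩ : τ.v 24 = 1 ∧ 2 ^ j ∣ val v ∧
        L.Val τ.m (Function.update val v (val v + (2 ^ j - 1))) := by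
      rcases h4 with h4 | h4
      · exact h4
      · rw [h4.1] at hc; split_ifs at hc <;> omega
    have hj : j < L.c v := by
      by_contra hj; rw [if_neg hj] at hc; omega
    have hjJ := hJ j hj hd
    have hq := L.rk_lt hv hj
    have hq' := L.data_addr hq
    have hbit := hVj v hv j hj
    rw [Function.update_self, div_of_dvd_add hd] at hbit
    have hbit2 := bit_lt τ.m L.bD L.U (rk L.c L.n (pos L.c L.n v j))
    refine Tri.seq (nextS_spec (h2.par hP) (h2.dir hD) hv hj h3 ?_)
    set τ1 := (τ.set 23 (rk L.c L.n (pos L.c L.n v j))).set 22 (pos L.c L.n v (j + 1)) with hτ1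
    have hF1 : L.Frame σ τ1 := (h2.set (by norm_num) _).set (by norm_num) _
    obtain ⟨g1, g2⟩ := dataE_spec (hF1.par hP) (q := rk L.c L.n (pos L.c L.n v j))
      (by simp [hτ1]) hq
    rw [show τ1.m = τ.m from rfl] at g1
    have hF2 := hF1.set (show 19 ≤ 24 by norm_num)
      (1 - bit τ.m L.bD L.U (rk L.c L.n (pos L.c L.n v j)))
    have hv12 := (hF2.par hP) 12 (by norm_num)
    simp only [Layout.val] at hv12
    refine Tri.seq (Tri.assign ?_ ?_)
    · simp only [Expr.ok_sub, Expr.ok_one, g1, g2, Expr.eval_one, true_and]; omega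
    simp only [Expr.eval_sub, Expr.eval_one, g1]
    have v23 : (τ1.set 24 (1 - bit τ.m L.bD L.U (rk L.c L.n (pos L.c L.n v j)))).v 23 =
        rk L.c L.n (pos L.c L.n v j) := by simp [hτ1]
    refine flipS_spec (hF2.par hP) (by norm_num) (by simp) (by simp) (by simp; omega) ?_
      (by simp) ?_
    · simp only [Expr.eval_var, hv12, v23]; exact hq'
    simp only [Expr.eval_var, Expr.eval_one, hv12, v23]
    refine ⟨j + 1, ⟨hj, hF2.put _ _, by simp [hτ1], ?_⟩, by omega⟩
    have e0 : val v / 2 ^ j % 2 = 0 ∨ val v / 2 ^ j % 2 = 1 := Nat.mod_two_eq_zero_or_one _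
    have h2j := Nat.two_pow_pos j
    rcases e0 with e0 | e0
    · left
      refine ⟨by simp [hbit, e0], ?_, ?_⟩
      · obtain ⟨y, hy⟩ := hd
        rw [hy, Nat.mul_div_cancel_left _ h2j] at e0
        rw [hy, pow_succ]
        exact Nat.mul_dvd_mul_left _ (Nat.dvd_of_mod_eq_zero e0)
      · have := hVj.flip (y := 1) (x := val v + (2 ^ (j + 1) - 1)) hv hj (by norm_num) rfl ?_
        · rw [Function.update_idem] at this
          exact this
        · intro i hi
          rw [Function.update_self, div_of_dvd_add hd, e0]
          have := add_two_pow_bit (a := val v + (2 ^ j - 1)) (j := j)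
            (by rw [div_of_dvd_add hd, e0]) i
          rw [show val v + (2 ^ (j + 1) - 1) = val v + (2 ^ j - 1) + 2 ^ j by rw [pow_succ]; omega,
            this]
          rfl
    · right
      obtain ⟨y, hy⟩ := hd
      rw [hy, Nat.mul_div_cancel_left _ h2j] at e0
      have hy0 : 0 < y := by omega
      have hpos : 0 < val v := by rw [hy]; positivity
      refine ⟨by simp [hbit, hy, Nat.mul_div_cancel_left _ h2j, e0], hpos, ?_⟩
      have := hVj.flip (y := 1) (x := val v - 1) hv hj (by norm_num) rfl ?_
      · rw [Function.update_idem] at this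
        exact this
      · intro i hi
        rw [Function.update_self, div_of_dvd_add ⟨y, hy⟩]
        have e2 : (val v - 1) / 2 ^ j = y - 1 := by
          rw [hy, Nat.div_eq_iff h2j]
          obtain ⟨z, rfl⟩ : ∃ z, y = z + 1 := ⟨y - 1, by omega⟩
          rw [Nat.add_sub_cancel, mul_add, mul_one, mul_comm]
          omega
        have := add_two_pow_bit (a := val v - 1) (j := j) (by rw [e2]; omega) i
        rw [show val v + (2 ^ j - 1) = val v - 1 + 2 ^ j by omega, this]
        split_ifs with e
        · rw [hy, Nat.mul_div_cancel_left _ h2j, e0, ← hy, e, e2]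
          simp; omega
        · rfl
  · refine ⟨Nat.zero_le _, ((Frame.refl σ).set (by norm_num) _).set (by norm_num) _,
      by simp [hσ], Or.inl ⟨by simp, by simp, ?_⟩⟩
    simpa using hV
  · rintro t σ' ⟨j, ⟨h1, h2, h3, h4⟩, hc, ht⟩
    obtain ⟨e1, e2⟩ := markE_spec (h2.par hP) (h2.dir hD) hv h1 h3
    simp only [Expr.eval_one, Expr.eval_add, Expr.eval_var, e1] at hc
    refine ⟨by omega, h2, ?_⟩
    rcases h4 with ⟨h4, hd, hVj⟩ | ⟨h4, hpos, hVj⟩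
    · have hj : j = L.c v := by
        by_contra hj; rw [if_pos (by omega)] at hc; omega
      subst hj
      have h0 := Nat.eq_zero_of_dvd_of_lt hd hx
      exact ⟨by rw [h4, if_pos h0], _, hVj, fun h => by omega⟩
    · exact ⟨by rw [h4, if_neg (by omega)], _, hVj, fun _ => rfl⟩

/-- Each bit is flipped by the difference of its old and its new value. -/
theorem writeS_spec {v key : ℕ} (hP : L.Par 14 σ) (hD : L.Dir σ.m) {val : ℕ → ℕ}
    (hV : L.Val σ.m val) (hv : v < L.n) (hσ : σ.v 18 = v) (hk : σ.v 19 = key) :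
    Tri E writeS σ fun t σ' => t ≤ 5 * L.c v + 2 ∧ L.Frame σ σ' ∧
      L.Val σ'.m (Function.update val v key) := by
  have hb := L.four_lt
  have hw0 := L.w_pos
  refine Tri.seq (Tri.assign (by simp) ?_)
  refine Tri.mono (Tri.loop (α := ℕ) (fun j τ => j ≤ L.c v ∧ L.Frame σ τ ∧
    τ.v 22 = pos L.c L.n v j ∧ τ.v 19 = key / 2 ^ j ∧
    ∀ u < L.n, ∀ i < L.c u, bit τ.m L.bD L.U (rk L.c L.n (pos L.c L.n u i)) =
      (if u = v ∧ i < j then key else val u) / 2 ^ i % 2) (fun j => 5 * (L.c v - j)) ?_ ?_ 0 ?_) ?_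
  · rintro j τ ⟨h1, h2, h3, h4⟩
    obtain ⟨e1, e2⟩ := markE_spec (h2.par hP) (h2.dir hD) hv h1 h3
    simp [e2]
  · rintro j τ ⟨h1, h2, h3, h4, h5⟩ hc
    obtain ⟨e1, e2⟩ := markE_spec (h2.par hP) (h2.dir hD) hv h1 h3
    simp only [Expr.eval_zero, e1] at hc
    have hj : j < L.c v := by
      by_contra hj; rw [if_neg hj] at hc; omega
    have hq := L.rk_lt hv hj
    have hq' := L.data_addr hq
    have hbit2 := bit_lt τ.m L.bD L.U (rk L.c L.n (pos L.c L.n v j))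
    refine Tri.seq (nextS_spec (h2.par hP) (h2.dir hD) hv hj h3 ?_)
    set τ1 := (τ.set 23 (rk L.c L.n (pos L.c L.n v j))).set 22 (pos L.c L.n v (j + 1)) with hτ1
    have hF1 : L.Frame σ τ1 := (h2.set (by norm_num) _).set (by norm_num) _
    obtain ⟨g1, g2⟩ := dataE_spec (hF1.par hP) (q := rk L.c L.n (pos L.c L.n v j))
      (by simp [hτ1]) hq
    rw [show τ1.m = τ.m from rfl] at g1
    have hv12 := (hF1.par hP) 12 (by norm_num)
    simp only [Layout.val] at hv12
    have v23 : τ1.v 23 = rk L.c L.n (pos L.c L.n v j) := by simp [hτ1]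
    have v19 : τ1.v 19 = key / 2 ^ j := by simp [hτ1, h4]
    have hxor : bit τ.m L.bD L.U (rk L.c L.n (pos L.c L.n v j)) ^^^ key / 2 ^ j % 2 < 2 :=
      Nat.xor_lt_two_pow (n := 1) (by simpa using hbit2) (by simp; omega)
    refine Tri.seq (flipS_spec (hF1.par hP) (by norm_num) (by simp) (by simp)
      (by simp [g2]; omega) ?_ ?_ ?_)
    · simp only [Expr.eval_var, hv12, v23]; exact hq'
    · simp only [Expr.eval_var, Expr.eval_xor, Expr.eval_mod, Expr.eval_two, g1, v19]; exact hxor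
    simp only [Expr.eval_var, Expr.eval_xor, Expr.eval_mod, Expr.eval_two, g1, v19, hv12, v23]
    refine Tri.assign (by simp; omega) ⟨j + 1, ⟨hj, ?_, by simp [hτ1], ?_, ?_⟩, by omega⟩
    · exact (hF1.put _ _).set (by norm_num) _
    · simp [v19, Nat.div_div_eq_div_mul, pow_succ]
    · intro u hu i hi
      simp only [St.set_m, St.put_m]
      rw [bit_xor _ _ _ _ _ _ hxor, show τ1.m = τ.m from rfl]
      by_cases e : u = v ∧ i = j
      · obtain ⟨rfl, rfl⟩ := e
        rw [if_pos rfl, if_pos (by omega), ← Nat.xor_assoc, Nat.xor_self, Nat.zero_xor]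
      · rw [if_neg, h5 u hu i hi]
        · by_cases e3 : u = v ∧ i < j
          · rw [if_pos e3, if_pos (by omega)]
          · rw [if_neg e3, if_neg (by omega)]
        · exact fun e' => e (rk_pos_inj hu hi hv hj e')
  · refine ⟨Nat.zero_le _, (Frame.refl σ).set (by norm_num) _, by simp [hσ], by simp [hk], ?_⟩
    intro u hu i hi
    rw [if_neg (by omega)]; exact hV u hu i hi
  · rintro t σ' ⟨j, ⟨h1, h2, h3, h4, h5⟩, hc, ht⟩
    obtain ⟨e1, e2⟩ := markE_spec (h2.par hP) (h2.dir hD) hv h1 h3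
    simp only [Expr.eval_zero, e1] at hc
    have hj : j = L.c v := by
      by_contra hj; rw [if_pos (by omega)] at hc; omega
    subst hj
    refine ⟨by omega, h2, fun u hu i hi => ?_⟩
    rw [h5 u hu i hi, Function.update_apply]
    by_cases e : u = v
    · subst e; rw [if_pos ⟨rfl, hi⟩, if_pos rfl]
    · rw [if_neg (by omega), if_neg e]

theorem readS_spec {u : ℕ} (hP : L.Par 14 σ) (hD : L.Dir σ.m) {val : ℕ → ℕ}
    (hV : L.Val σ.m val) (hu : u < L.n) (hσ : σ.v 15 = u) (hx : val u < 2 ^ L.c u) :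
    Tri E readS σ fun t σ' => t ≤ 5 * L.c u + 4 ∧ L.Frame σ σ' ∧ σ'.m = σ.m ∧
      σ'.v 19 = val u := by
  have hb := L.four_lt
  have hw0 := L.w_pos
  have hcw := (L.c_le u hu).trans L.lg_le_w
  have h2w := E.w.lt_two_pow_self
  refine Tri.seq (Tri.assign (by simp) (Tri.seq (Tri.assign (by simp) (Tri.seq
    (Tri.assign (by simp) ?_)))))
  refine Tri.mono (Tri.loop (α := ℕ) (fun j τ => j ≤ L.c u ∧ L.Frame σ τ ∧ τ.m = σ.m ∧
    τ.v 22 = pos L.c L.n u j ∧ τ.v 21 = j ∧ τ.v 19 = val u % 2 ^ j)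
    (fun j => 5 * (L.c u - j)) ?_ ?_ 0 ?_) ?_
  · rintro j τ ⟨h1, h2, h3, h4, h5⟩
    obtain ⟨e1, e2⟩ := markE_spec (h2.par hP) (h2.dir hD) hu h1 h4
    simp [e2]
  · rintro j τ ⟨h1, h2, h3, h4, h5, h6⟩ hc
    obtain ⟨e1, e2⟩ := markE_spec (h2.par hP) (h2.dir hD) hu h1 h4
    simp only [Expr.eval_zero, e1] at hc
    have hj : j < L.c u := by
      by_contra hj; rw [if_neg hj] at hc; omega
    have hq := L.rk_lt hu hj
    have hbit := hV u hu j hj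
    refine Tri.seq (nextS_spec (h2.par hP) (h2.dir hD) hu hj h4 ?_)
    set τ1 := (τ.set 23 (rk L.c L.n (pos L.c L.n u j))).set 22 (pos L.c L.n u (j + 1)) with hτ1
    have hF1 : L.Frame σ τ1 := (h2.set (by norm_num) _).set (by norm_num) _
    obtain ⟨g1, g2⟩ := dataE_spec (hF1.par hP) (q := rk L.c L.n (pos L.c L.n u j))
      (by simp [hτ1]) hq
    rw [show τ1.m = σ.m from h3, hbit] at g1
    have v21 : τ1.v 21 = j := by simp [hτ1, h5]
    have v19 : τ1.v 19 = val u % 2 ^ j := by simp [hτ1, h6]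
    have hshl : (val u / 2 ^ j % 2) <<< j < 2 ^ E.w :=
      shl_lt (s := 1) (by simp; omega) (by omega)
    have hadd : val u % 2 ^ j + (val u / 2 ^ j % 2) <<< j = val u % 2 ^ (j + 1) := by
      rw [Nat.mod_pow_succ, Nat.shiftLeft_eq, mul_comm (2 ^ j)]
    have hlt : val u % 2 ^ (j + 1) < 2 ^ E.w :=
      (Nat.mod_lt _ (by positivity)).trans_le (Nat.pow_le_pow_right (by norm_num) (by omega))
    refine Tri.seq (Tri.assign ?_ (Tri.assign ?_ ⟨j + 1, ⟨hj, ?_, ?_, ?_, ?_, ?_⟩, by omega⟩))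
    · simp only [Expr.ok_add, Expr.ok_var, Expr.ok_shl, g1, g2, Expr.eval_var, Expr.eval_shl,
        v21, v19, hadd, hshl, hlt]
      simp
    · simp [v21]; omega
    · exact (hF1.set (by norm_num) _).set (by norm_num) _
    · exact h3
    · simp [hτ1]
    · simp [v21]
    · simp [v21, v19, g1, hadd]
  · exact ⟨Nat.zero_le _, (((Frame.refl σ).set (by norm_num) _).set (by norm_num) _).set
      (by norm_num) _, rfl, by simp [hσ], by simp, by simp [Nat.mod_one]⟩
  · rintro t σ' ⟨j, ⟨h1, h2, h3, h4, h5, h6⟩, hc, ht⟩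
    obtain ⟨e1, e2⟩ := markE_spec (h2.par hP) (h2.dir hD) hu h1 h4
    simp only [Expr.eval_zero, e1] at hc
    have hj : j = L.c u := by
      by_contra hj; rw [if_pos (by omega)] at hc; omega
    subst hj
    exact ⟨by omega, h2, h3, by rw [h6, Nat.mod_eq_of_lt hx]⟩

end Layout

/-! ### The traversal of the graph -/

/-- The total cost of the binary decrements from `x` down to `0`. -/
noncomputable def psi (x : ℕ) : ℕ := x + padicValNat 2 x.factorial

theorem psi_sub_one {x : ℕ} (hx : 0 < x) : psi (x - 1) + (padicValNat 2 x + 1) = psi x := by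
  obtain ⟨y, rfl⟩ : ∃ y, x = y + 1 := ⟨x - 1, by omega⟩
  have : padicValNat 2 (y + 1).factorial = padicValNat 2 (y + 1) + padicValNat 2 y.factorial := by
    rw [Nat.factorial_succ, padicValNat.mul (by omega) (Nat.factorial_ne_zero _)]
  rw [psi, psi, this, Nat.add_sub_cancel]
  omega

/-- By Legendre's formula, a binary counter is counted down in linear time. -/
theorem psi_le (x : ℕ) : psi x ≤ 2 * x := by
  have := sub_one_mul_padicValNat_factorial (p := 2) x
  rw [psi]
  omega

section

variable {n : ℕ} {G : Digraph (Fin n)} (A : G.AdjArrays)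

/-- The configuration of the traversal: the list `l` of the vertices that were output, the stack
`st` of vertices whose out-edges are being followed, the number `nx x` of out-edges of each vertex
`x` that were followed, the contents `val v` of the counters, and the next candidate `r` for a
source. -/
structure Cfg (n : ℕ) where
  l : List (Fin n)
  st : List (Fin n)
  nx : Fin n → ℕ
  val : ℕ → ℕ
  r : ℕ

/-- Every vertex on the stack except for the bottom, which is a source, was entered from the vertex
below it by the last edge followed there, and its counter holds the number of this edge among its
in-edges. -/
def Linked (nx : Fin n → ℕ) (val : ℕ → ℕ) : List (Fin n) → Prop
  | [] => True
  | [u] => (A.inn u).length = 0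
  | v :: u :: st => (G.Adj u v ∧ nx u = (A.out u).idxOf v + 1 ∧ val v = (A.inn v).idxOf u) ∧
      Linked nx val (u :: st)

theorem Linked.congr {nx nx' : Fin n → ℕ} {val val' : ℕ → ℕ} {st : List (Fin n)}
    (h : Linked A nx val st) (hn : ∀ b ∈ st.tail, nx' b = nx b)
    (hv : ∀ a ∈ st, val' a = val a) : Linked A nx' val' st := by
  induction st with
  | nil => trivial
  | cons v st ih =>
    cases st with
    | nil => exact h
    | cons u st =>
      refine ⟨?_, ih h.2 (fun b hb => hn b (List.mem_cons_of_mem _ hb))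
        fun a ha => hv a (List.mem_cons_of_mem _ ha)⟩
      rw [hn u (by simp), hv v (by simp)]
      exact h.1

open Classical in
/-- The inneighbors of `v` whose edge to `v` was followed. -/
noncomputable def followed (nx : Fin n → ℕ) (v : Fin n) : Finset (Fin n) :=
  {x | G.Adj x v ∧ (A.out x).idxOf v < nx x}

open Classical in
theorem length_inn (v : Fin n) :
    (A.inn v).length = (Finset.univ.filter fun x => G.Adj x v).card := by
  rw [← List.toFinset_card_of_nodup (A.inn_nodup v)]
  congr 1
  ext x
  simp [A.mem_inn]

theorem followed_update {nx : Fin n → ℕ} {u v : Fin n} (hi : nx u < (A.out u).length)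
    (hv : (A.out u)[nx u] = v) (w : Fin n) :
    followed A (Function.update nx u (nx u + 1)) w =
      if w = v then insert u (followed A nx w) else followed A nx w := by
  have hidx : ∀ w, (A.out u).idxOf w = nx u ↔ w = v := by
    intro w
    constructor
    · intro h
      have hm : (A.out u).idxOf w < (A.out u).length := by omega
      rw [← List.getElem_idxOf hm, ← hv]
      simp only [h]
    · rintro rfl
      rw [← hv, (A.out_nodup u).idxOf_getElem]
  have hadj : G.Adj u v := (A.mem_out u v).1 (hv ▸ List.getElem_mem hi)
  split_ifs with h
  · subst h
    ext x
    simp only [followed, Finset.mem_filter, Finset.mem_univ, true_and, Finset.mem_insert,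
      Function.update_apply]
    by_cases e : x = u
    · subst e
      simp [hadj, (hidx w).2 rfl]
    · simp [e]
  · ext x
    simp only [followed, Finset.mem_filter, Finset.mem_univ, true_and, Function.update_apply]
    by_cases e : x = u
    · subst e
      have := mt (hidx w).1 h
      simp only [if_true]
      constructor <;> rintro ⟨h1, h2⟩ <;> exact ⟨h1, by omega⟩
    · simp [e]

/-- The invariant of the traversal. The counter of a vertex `v` that was not output yet is one less
than the number of edges into `v` that were not followed yet. -/
structure Inv (g : Cfg n) : Prop where
  nodup : g.l.Nodup
  st_nodup : g.st.Nodup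
  st_sub : ∀ x ∈ g.st, x ∈ g.l
  nx_out : ∀ x, x ∉ g.l → g.nx x = 0
  nx_done : ∀ x ∈ g.l, x ∉ g.st → g.nx x = (A.out x).length
  nx_le : ∀ x, g.nx x ≤ (A.out x).length
  edges_in : ∀ v ∈ g.l, ∀ x, G.Adj x v → (A.out x).idxOf v < g.nx x
  count : ∀ v, v ∉ g.l → 0 < (A.inn v).length →
    g.val v + 1 + (followed A g.nx v).card = (A.inn v).length
  linked : Linked A g.nx g.val g.st
  roots : ∀ v, v ∉ g.l → (A.inn v).length = 0 → g.r ≤ v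
  roots_done : ∀ v ∈ g.l, (A.inn v).length = 0 → (v : ℕ) < g.r
  r_le : g.r ≤ n
  topo : ∀ u v, G.Adj u v → v ∈ g.l → g.l.idxOf u < g.l.idxOf v
  val_le : ∀ v : Fin n, g.val v ≤ (A.inn v).length - 1

open Classical in
/-- The part of the potential that belongs to the vertex `v`. -/
noncomputable def weight (c : ℕ → ℕ) (g : Cfg n) (v : Fin n) : ℕ :=
  if v ∈ g.l then if v ∈ g.st then c v + 2 else 0 else psi (g.val v) + 3 * c v + 3

/-- The potential that pays for the rest of the traversal, up to a constant factor: the candidates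
for sources that are left, the vertices that are left to be output or to be returned from, with the
decrements that are left for their counters, and the edges that are left to be followed. -/
noncomputable def pot (c : ℕ → ℕ) (g : Cfg n) : ℕ :=
  (n - g.r) + ∑ v, weight c g v + ∑ x, ((A.out x).length - g.nx x)

theorem sum_change {f f' : Fin n → ℕ} (v : Fin n) (h : ∀ x, x ≠ v → f' x = f x) :
    ∑ x, f' x + f v = ∑ x, f x + f' v := by
  rw [← Finset.add_sum_erase _ _ (Finset.mem_univ v), ← Finset.add_sum_erase _ f
    (Finset.mem_univ v), Finset.sum_congr rfl fun x hx => h x (Finset.ne_of_mem_erase hx)]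
  ring

variable {A} {g : Cfg n} {c : ℕ → ℕ}

/-- Passing over a vertex that is not a source. -/
theorem Inv.skip (h : Inv A g) (hr : g.r < n) (hd : (A.inn ⟨g.r, hr⟩).length ≠ 0) :
    Inv A { g with r := g.r + 1 } ∧ pot A c { g with r := g.r + 1 } + 1 ≤ pot A c g := by
  refine ⟨⟨h.nodup, h.st_nodup, h.st_sub, h.nx_out, h.nx_done, h.nx_le, h.edges_in, h.count,
    h.linked, fun v hv hv0 => ?_,
    fun v hv hv0 => (h.roots_done v hv hv0).trans (Nat.lt_succ_self _), hr, h.topo, h.val_le⟩, ?_⟩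
  · refine Nat.lt_of_le_of_ne (h.roots v hv hv0) ?_
    intro e
    apply hd
    rw [show (⟨g.r, hr⟩ : Fin n) = v from Fin.ext e]
    exact hv0
  · simp only [pot, weight]
    omega

/-- A vertex can be appended to the output once all its inneighbors were output. -/
theorem topo_append {l : List (Fin n)} {v : Fin n} (hv : v ∉ l)
    (ht : ∀ a b, G.Adj a b → b ∈ l → l.idxOf a < l.idxOf b) (hl : ∀ a, G.Adj a v → a ∈ l) :
    ∀ a b, G.Adj a b → b ∈ l ++ [v] → (l ++ [v]).idxOf a < (l ++ [v]).idxOf b := by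
  intro a b hab hb
  by_cases hbl : b ∈ l
  · have h1 := ht a b hab hbl
    have h2 : l.idxOf b < l.length := List.idxOf_lt_length_of_mem hbl
    have hal : a ∈ l := List.idxOf_lt_length_iff.1 (h1.trans h2)
    rwa [List.idxOf_append_of_mem hal, List.idxOf_append_of_mem hbl]
  · obtain rfl : b = v := by simpa [hbl] using hb
    have hal := hl a hab
    rw [List.idxOf_append_of_mem hal, List.idxOf_append_of_notMem hv]
    have := List.idxOf_lt_length_of_mem hal
    omega

/-- Starting at a source. -/
theorem Inv.root (h : Inv A g) (hst : g.st = []) (hr : g.r < n)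
    (hd : (A.inn ⟨g.r, hr⟩).length = 0) {g' : Cfg n}
    (hg' : g' = { g with l := g.l ++ [⟨g.r, hr⟩], st := [⟨g.r, hr⟩], r := g.r + 1 }) :
    Inv A g' ∧ pot A c g' + 2 ≤ pot A c g ∧ g'.nx ⟨g.r, hr⟩ = 0 := by
  set v : Fin n := ⟨g.r, hr⟩ with hv
  have hvl : v ∉ g.l := fun hm => absurd (h.roots_done v hm hd) (lt_irrefl _)
  have hin : ∀ a, ¬ G.Adj a v := by
    intro a ha
    have := (A.mem_inn a v).2 ha
    rw [List.length_eq_zero_iff.1 hd] at this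
    simp at this
  subst hg'
  refine ⟨⟨?_, by simp, by simp, ?_, ?_, h.nx_le, ?_, ?_, hd, ?_, ?_, hr, ?_, h.val_le⟩, ?_,
    h.nx_out v hvl⟩
  · exact List.Nodup.append h.nodup (by simp) (by simpa using hvl)
  · intro x hx
    exact h.nx_out x fun hx' => hx (by simp [hx'])
  · intro x hx hx'
    refine h.nx_done x ?_ (by simp [hst])
    simp only [List.mem_append, List.mem_singleton] at hx hx'
    tauto
  · intro w hw x hx
    simp only [List.mem_append, List.mem_singleton] at hw
    rcases hw with hw | rfl
    · exact h.edges_in w hw x hx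
    · exact absurd hx (hin x)
  · intro w hw
    exact h.count w fun hw' => hw (by simp [hw'])
  · intro w hw hw0
    simp only [List.mem_append, List.mem_singleton, not_or] at hw
    refine Nat.lt_of_le_of_ne (h.roots w hw.1 hw0) ?_
    intro e
    exact hw.2 (Fin.ext e.symm)
  · intro w hw hw0
    simp only [List.mem_append, List.mem_singleton] at hw
    rcases hw with hw | rfl
    · exact (h.roots_done w hw hw0).trans (Nat.lt_succ_self _)
    · exact Nat.lt_succ_self _
  · exact topo_append hvl h.topo fun a ha => absurd ha (hin a)
  · have h1 := sum_change v (f := weight c g)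
      (f' := weight c { g with l := g.l ++ [v], st := [v], r := g.r + 1 }) ?_
    · have e1 : weight c g v = psi (g.val v) + 3 * c v + 3 := by simp [weight, hvl]
      have e2 : weight c { g with l := g.l ++ [v], st := [v], r := g.r + 1 } v = c v + 2 := by
        simp [weight]
      simp only [pot]
      omega
    · intro x hx
      simp [weight, hx, hst]

/-- Leaving a vertex all of whose out-edges were followed. -/
theorem Inv.finish (h : Inv A g) {u : Fin n} {st : List (Fin n)} (hst : g.st = u :: st)
    (hu : g.nx u = (A.out u).length) :
    Inv A { g with st := st } ∧ pot A c { g with st := st } + c u + 2 ≤ pot A c g := by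
  have hul : u ∈ g.l := h.st_sub u (by simp [hst])
  have hnd := h.st_nodup
  rw [hst, List.nodup_cons] at hnd
  refine ⟨⟨h.nodup, hnd.2, fun x hx => h.st_sub x (by simp [hst, hx]), h.nx_out, ?_, h.nx_le,
    h.edges_in, h.count, ?_, h.roots, h.roots_done, h.r_le, h.topo, h.val_le⟩, ?_⟩
  · intro x hx hx'
    by_cases e : x = u
    · rw [e]; exact hu
    · exact h.nx_done x hx (by simpa [hst, e] using hx')
  · have := h.linked
    rw [hst] at this
    cases st with
    | nil => trivial
    | cons u' st => exact this.2
  · have h1 := sum_change u (f := weight c g) (f' := weight c { g with st := st }) ?_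
    · have e1 : weight c g u = c u + 2 := by simp [weight, hul, hst]
      have e2 : weight c { g with st := st } u = 0 := by simp [weight, hul, hnd.1]
      simp only [pot]
      omega
    · intro x hx
      simp [weight, hst, hx]

/-- What is known about the head `v` of the next edge out of `u`. -/
theorem Inv.head (h : Inv A g) {u v : Fin n}
    (hi : g.nx u < (A.out u).length) (hv : (A.out u)[g.nx u] = v) :
    G.Adj u v ∧ v ∉ g.l ∧ (A.out u).idxOf v = g.nx u ∧ u ∉ followed A g.nx v ∧
      0 < (A.inn v).length := by
  have hadj : G.Adj u v := (A.mem_out u v).1 (hv ▸ List.getElem_mem hi)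
  have hidx : (A.out u).idxOf v = g.nx u := by
    rw [← hv, (A.out_nodup u).idxOf_getElem]
  refine ⟨hadj, fun hvl => ?_, hidx, ?_, ?_⟩
  · have := h.edges_in v hvl u hadj
    omega
  · simp [followed, hidx]
  · exact List.length_pos_of_mem ((A.mem_inn u v).2 hadj)

/-- Following an edge lowers the number of edges that are left. -/
theorem sum_nx {u : Fin n} (hi : g.nx u < (A.out u).length) :
    ∑ x, ((A.out x).length - Function.update g.nx u (g.nx u + 1) x) + 1 =
      ∑ x, ((A.out x).length - g.nx x) := by
  have h2 := sum_change u (f := fun x => (A.out x).length - g.nx x)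
    (f' := fun x => (A.out x).length - Function.update g.nx u (g.nx u + 1) x) ?_
  · simp only [Function.update_self] at h2
    omega
  · intro x hx
    simp [Function.update_of_ne hx]

/-- Following an edge that is not the last one into its head. -/
theorem Inv.dec (h : Inv A g) {u v : Fin n} {st : List (Fin n)} (hst : g.st = u :: st)
    (hi : g.nx u < (A.out u).length) (hv : (A.out u)[g.nx u] = v) (h0 : 0 < g.val v) {g' : Cfg n}
    (hg' : g' = { g with nx := Function.update g.nx u (g.nx u + 1)
                         val := Function.update g.val v (g.val v - 1) }) :
    Inv A g' ∧ pot A c g' + padicValNat 2 (g.val v) + 2 ≤ pot A c g := by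
  obtain ⟨hadj, hvl, hidx, huf, hdv⟩ := h.head hi hv
  have hul : u ∈ g.l := h.st_sub u (by simp [hst])
  have hnd := h.st_nodup
  rw [hst, List.nodup_cons] at hnd
  have hmono : ∀ x, g.nx x ≤ Function.update g.nx u (g.nx u + 1) x := by
    intro x
    by_cases e : x = u
    · subst e; simp
    · simp [e]
  subst hg'
  refine ⟨⟨h.nodup, h.st_nodup, h.st_sub, ?_, ?_, ?_, ?_, ?_, ?_, h.roots, h.roots_done, h.r_le,
    h.topo, ?_⟩, ?_⟩
  · intro x hx
    have e : x ≠ u := by rintro rfl; exact hx hul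
    exact (Function.update_of_ne e _ _).trans (h.nx_out x hx)
  · intro x hx hx'
    have e : x ≠ u := by rintro rfl; exact hx' (by simp [hst])
    exact (Function.update_of_ne e _ _).trans (h.nx_done x hx hx')
  · intro x
    by_cases e : x = u
    · subst e; simpa using hi
    · exact (Function.update_of_ne e _ g.nx).trans_le (h.nx_le x)
  · intro w hw x hx
    exact (h.edges_in w hw x hx).trans_le (hmono x)
  · intro w hw hw0
    have := h.count w hw hw0
    rw [followed_update A hi hv]
    by_cases e : w = v
    · subst e
      simp only [Function.update_self, if_true]
      rw [Finset.card_insert_of_notMem huf]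
      omega
    · have e' : (w : ℕ) ≠ v := fun e' => e (Fin.ext e')
      rw [if_neg e]
      simpa only [Function.update_of_ne e'] using this
  · refine h.linked.congr A (fun b hb => ?_) fun a ha => ?_
    · rw [hst] at hb
      exact Function.update_of_ne (fun e => hnd.1 (by simpa [e] using hb)) _ _
    · refine Function.update_of_ne (fun e => hvl ?_) _ _
      rw [← Fin.ext e]
      exact h.st_sub a ha
  · intro w
    have := h.val_le w
    simp only [Function.update_apply]
    split_ifs with e
    · rw [← e]; omega
    · exact this
  · have h1 := sum_change v (f := weight c g)
      (f' := weight c { g with nx := Function.update g.nx u (g.nx u + 1)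
                               val := Function.update g.val v (g.val v - 1) }) ?_
    · have e1 : weight c g v = psi (g.val v) + 3 * c v + 3 := by simp [weight, hvl]
      have e2 : weight c { g with nx := Function.update g.nx u (g.nx u + 1)
                                  val := Function.update g.val v (g.val v - 1) } v =
          psi (g.val v - 1) + 3 * c v + 3 := by simp [weight, hvl]
      have e3 := psi_sub_one h0
      have e4 := sum_nx hi
      simp only [pot]
      omega
    · intro x hx
      have e : (x : ℕ) ≠ v := fun e => hx (Fin.ext e)
      simp [weight, Function.update_of_ne e]

/-- Following an edge that is the last one into its head `v`, as the counter of `v` shows. All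
inneighbors of `v` have been output, and `v` is output and entered. -/
theorem Inv.enter (h : Inv A g) {u v : Fin n} {st : List (Fin n)} (hst : g.st = u :: st)
    (hi : g.nx u < (A.out u).length) (hv : (A.out u)[g.nx u] = v) (h0 : g.val v = 0) {g' : Cfg n}
    (hg' : g' = { g with l := g.l ++ [v]
                         st := v :: g.st
                         nx := Function.update g.nx u (g.nx u + 1)
                         val := Function.update g.val v ((A.inn v).idxOf u) }) :
    Inv A g' ∧ pot A c g' + 2 * c v + 2 ≤ pot A c g ∧ g'.nx v = 0 := by
  obtain ⟨hadj, hvl, hidx, huf, hdv⟩ := h.head hi hv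
  have hul : u ∈ g.l := h.st_sub u (by simp [hst])
  have huv : v ≠ u := fun e => hvl (e ▸ hul)
  have hnd := h.st_nodup
  rw [hst, List.nodup_cons] at hnd
  have hmono : ∀ x, g.nx x ≤ Function.update g.nx u (g.nx u + 1) x := by
    intro x
    by_cases e : x = u
    · subst e; simp
    · simp [e]
  -- all edges into `v` have been followed
  have hall : ∀ x, G.Adj x v → (A.out x).idxOf v < Function.update g.nx u (g.nx u + 1) x := by
    classical
    have h1 := h.count v hvl hdv
    have h2 := followed_update A hi hv v
    rw [if_pos rfl] at h2
    have h3 : (followed A (Function.update g.nx u (g.nx u + 1)) v).card = (A.inn v).length := by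
      rw [h2, Finset.card_insert_of_notMem huf]; omega
    have h4 : followed A (Function.update g.nx u (g.nx u + 1)) v =
        Finset.univ.filter fun x => G.Adj x v := by
      refine Finset.eq_of_subset_of_card_le (fun x hx => ?_) ?_
      · simp only [followed, Finset.mem_filter] at hx ⊢
        exact ⟨hx.1, hx.2.1⟩
      · rw [h3, length_inn]
    intro x hx
    have h5 : x ∈ followed A (Function.update g.nx u (g.nx u + 1)) v := by
      rw [h4]; simpa using hx
    simp only [followed, Finset.mem_filter] at h5
    exact h5.2.2
  have hin : ∀ a, G.Adj a v → a ∈ g.l := by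
    intro a ha
    by_contra hal
    have h1 := hall a ha
    rw [Function.update_of_ne (by rintro rfl; exact hal hul), h.nx_out a hal] at h1
    omega
  have hlt : (A.inn v).idxOf u < (A.inn v).length :=
    List.idxOf_lt_length_of_mem ((A.mem_inn u v).2 hadj)
  subst hg'
  refine ⟨⟨?_, ?_, ?_, ?_, ?_, ?_, ?_, ?_, ?_, ?_, ?_, h.r_le, ?_, ?_⟩, ?_, ?_⟩
  · exact List.Nodup.append h.nodup (by simp) (by simpa using hvl)
  · exact List.nodup_cons.2 ⟨fun hm => hvl (h.st_sub v hm), h.st_nodup⟩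
  · intro x hx
    rcases List.mem_cons.1 hx with rfl | hx
    · simp
    · simp [h.st_sub x hx]
  · intro x hx
    simp only [List.mem_append, List.mem_singleton, not_or] at hx
    have e : x ≠ u := by rintro rfl; exact hx.1 hul
    exact (Function.update_of_ne e _ _).trans (h.nx_out x hx.1)
  · intro x hx hx'
    simp only [List.mem_append, List.mem_cons, not_or] at hx hx'
    have e : x ≠ u := by rintro rfl; exact hx'.2 (by simp [hst])
    exact (Function.update_of_ne e _ _).trans (h.nx_done x (by tauto) hx'.2)
  · intro x
    by_cases e : x = u
    · subst e; simpa using hi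
    · exact (Function.update_of_ne e _ g.nx).trans_le (h.nx_le x)
  · intro w hw x hx
    simp only [List.mem_append, List.mem_singleton] at hw
    rcases hw with hw | rfl
    · exact (h.edges_in w hw x hx).trans_le (hmono x)
    · exact hall x hx
  · intro w hw hw0
    simp only [List.mem_append, List.mem_singleton, not_or] at hw
    have e' : (w : ℕ) ≠ v := fun e' => hw.2 (Fin.ext e')
    rw [followed_update A hi hv, if_neg hw.2]
    simpa only [Function.update_of_ne e'] using h.count w hw.1 hw0
  · have hlink : Linked A (Function.update g.nx u (g.nx u + 1))
        (Function.update g.val v ((A.inn v).idxOf u)) g.st := by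
      refine h.linked.congr A (fun b hb => ?_) fun a ha => ?_
      · rw [hst] at hb
        exact Function.update_of_ne (fun e => hnd.1 (by simpa [e] using hb)) _ _
      · refine Function.update_of_ne (fun e => hvl ?_) _ _
        rw [← Fin.ext e]
        exact h.st_sub a ha
    simp only [hst] at hlink ⊢
    exact ⟨⟨hadj, by simp [hidx], by simp⟩, hlink⟩
  · intro w hw
    exact h.roots w fun hw' => hw (by simp [hw'])
  · intro w hw hw0
    simp only [List.mem_append, List.mem_singleton] at hw
    rcases hw with hw | rfl
    · exact h.roots_done w hw hw0
    · omega
  · exact topo_append hvl h.topo hin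
  · intro w
    have := h.val_le w
    simp only [Function.update_apply]
    split_ifs with e
    · rw [Fin.ext e]; omega
    · exact this
  · have h1 := sum_change v (f := weight c g)
      (f' := weight c { g with l := g.l ++ [v]
                               st := v :: g.st
                               nx := Function.update g.nx u (g.nx u + 1)
                               val := Function.update g.val v ((A.inn v).idxOf u) }) ?_
    · have e1 : weight c g v = psi (g.val v) + 3 * c v + 3 := by simp [weight, hvl]
      have e2 : weight c { g with l := g.l ++ [v]
                                  st := v :: g.st
                                  nx := Function.update g.nx u (g.nx u + 1)
                                  val := Function.update g.val v ((A.inn v).idxOf u) } v =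
          c v + 2 := by simp [weight]
      have e4 := sum_nx hi
      simp only [pot]
      omega
    · intro x hx
      have e : (x : ℕ) ≠ v := fun e => hx (Fin.ext e)
      simp [weight, hx, Function.update_of_ne e]
  · simp only [Function.update_of_ne huv]
    exact h.nx_out v hvl

/-- Where the traversal continues after the vertex `u` is finished. -/
theorem Inv.parent (h : Inv A g) {u : Fin n} {st : List (Fin n)} (hst : g.st = u :: st)
    (hd : (A.inn u).length ≠ 0) : ∃ u' st', st = u' :: st' ∧
      (A.inn u)[g.val u]? = some u' ∧ g.nx u' = (A.out u').idxOf u + 1 := by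
  have hl := h.linked
  rw [hst] at hl
  cases st with
  | nil => exact absurd hl hd
  | cons u' st' =>
    obtain ⟨⟨h1, h2, h3⟩, -⟩ := hl
    refine ⟨u', st', rfl, ?_, h2⟩
    have := List.idxOf_lt_length_of_mem ((A.mem_inn u' u).2 h1)
    rw [h3, List.getElem?_eq_getElem this, List.getElem_idxOf]

/-- Only the bottom of the stack is a source. -/
theorem Inv.source (h : Inv A g) {u : Fin n} {st : List (Fin n)} (hst : g.st = u :: st)
    (hd : (A.inn u).length = 0) : st = [] := by
  have hl := h.linked
  rw [hst] at hl
  cases st with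
  | nil => rfl
  | cons u' st' =>
    have := List.length_pos_of_mem ((A.mem_inn u' u).2 hl.1.1)
    omega

/-- In the end all vertices have been output: otherwise every vertex that is missing would have an
inneighbor that is missing. -/
theorem Inv.sorted (h : Inv A g) (hG : G.Acyclic) (hst : g.st = []) (hr : g.r = n) :
    G.IsTopologicalSorting g.l := by
  have hall : ∀ v, v ∈ g.l := by
    have : IsTrans (Fin n) (Relation.TransGen G.Adj) := ⟨fun _ _ _ => Relation.TransGen.trans⟩
    have : Std.Irrefl (Relation.TransGen G.Adj) := ⟨hG⟩
    have hwf := Finite.wellFounded_of_trans_of_irrefl (Relation.TransGen G.Adj)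
    intro v
    induction v using hwf.induction with
    | _ v ih =>
    classical
    by_contra hv
    have hd : 0 < (A.inn v).length := by
      by_contra h0
      have := h.roots v hv (by omega)
      omega
    have hc := h.count v hv hd
    have : ∀ x, G.Adj x v → x ∈ followed A g.nx v := by
      intro x hx
      have hxl := ih x (.single hx)
      have h1 := h.nx_done x hxl (by simp [hst])
      simp only [followed, Finset.mem_filter, Finset.mem_univ, true_and, h1]
      exact ⟨hx, List.idxOf_lt_length_of_mem ((A.mem_out x v).2 hx)⟩
    have h2 := Finset.card_le_card (s := Finset.univ.filter fun x => G.Adj x v)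
      (t := followed A g.nx v) (fun x hx => this x (by simpa using hx))
    rw [← length_inn A] at h2
    omega
  exact ⟨h.nodup, hall, fun u v huv => h.topo u v huv (hall v)⟩

/-- The initial configuration. -/
def Cfg.init (n : ℕ) (val : ℕ → ℕ) : Cfg n := ⟨[], [], fun _ => 0, val, 0⟩

theorem Inv.init {val : ℕ → ℕ} (hval : ∀ v : Fin n, val v = (A.inn v).length - 1) :
    Inv A (Cfg.init n val) := by
  refine ⟨by simp [Cfg.init], by simp [Cfg.init], by simp [Cfg.init], by simp [Cfg.init],
    by simp [Cfg.init], by simp [Cfg.init], by simp [Cfg.init], ?_, trivial, by simp [Cfg.init],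
    by simp [Cfg.init], by simp [Cfg.init], by simp [Cfg.init], fun v => (hval v).le⟩
  intro v _ hv
  have := hval v
  have h0 : (followed A (fun _ => 0) v).card = 0 := by simp [followed]
  show val v + 1 + (followed A (fun _ => 0) v).card = _
  omega

end

/-! ### The program of the traversal -/

section

variable {n : ℕ} {G : Digraph (Fin n)} (A : G.AdjArrays)

theorem answer_inDeg (v : Fin n) (i : ℕ) : answer A .inDeg v i = (A.inn v).length := by
  simp [answer]

theorem answer_outDeg (v : Fin n) (i : ℕ) : answer A .outDeg v i = (A.out v).length := by
  simp [answer]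

theorem answer_outHead {u v : Fin n} {i : ℕ} (h : (A.out u)[i]? = some v) :
    answer A .outHead u i = v := by
  simp [answer, h]

theorem answer_outMate {u v : Fin n} {i : ℕ} (h : (A.out u)[i]? = some v) :
    answer A .outMate u i = (A.inn v).idxOf u := by
  simp [answer, h]

theorem answer_inHead {u v : Fin n} {i : ℕ} (h : (A.inn v)[i]? = some u) :
    answer A .inHead v i = u := by
  simp [answer, h]

theorem answer_inMate {u v : Fin n} {i : ℕ} (h : (A.inn v)[i]? = some u) :
    answer A .inMate v i = (A.out u).idxOf v := by
  simp [answer, h]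

end

namespace Layout

variable {E : Env} {L : Layout E} {σ : St} {n : ℕ} {G : Digraph (Fin n)} {A : G.AdjArrays}

/-- The state `σ` of the program represents the configuration `g` of the traversal. -/
structure Repr (L : Layout E) (A : G.AdjArrays) (g : Cfg n) (σ : St) : Prop where
  inv : Inv A g
  par : L.Par 14 σ
  dir : L.Dir σ.m
  val : L.Val σ.m g.val
  out : σ.o = g.l.map Fin.val
  r : σ.v 14 = g.r
  act : σ.v 17 = if g.st = [] then 0 else 1
  top : ∀ u st, g.st = u :: st → σ.v 15 = u ∧ σ.v 16 = g.nx u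

/-- Each step of the program is a step of the abstract traversal, whose potential pays for it. -/
theorem stepS_spec (hn : L.n = n) (hA : E.ans = answer A) {g : Cfg n} (h : L.Repr A g σ)
    (hc : σ.v 14 < σ.v 0 + σ.v 17) :
    Tri E stepS σ fun t σ' =>
      ∃ g', L.Repr A g' σ' ∧ t + 1 + 7 * pot A L.c g' ≤ 7 * pot A L.c g := by
  obtain ⟨hI, hP, hD, hV, hO, hr, hact, htop⟩ := h
  have hb := L.four_lt
  have hw0 := L.w_pos
  have h0 : σ.v 0 = n := by rw [hP 0 (by norm_num)]; exact hn
  have hcv : ∀ v : Fin n, g.val v < 2 ^ L.c v := by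
    intro v
    rw [L.c_eq v (by rw [hn]; exact v.2), hA, answer_inDeg]
    exact (hI.val_le v).trans_lt (Nat.lt_size_self _)
  have houtlt : ∀ v : Fin n, (A.out v).length < 2 ^ E.w := fun v => by
    rw [← answer_outDeg A v 0, ← hA]; exact E.ans_lt _ _ _
  cases hst : g.st with
  | nil =>
    rw [hst, if_pos rfl] at hact
    have hrn : g.r < n := by omega
    have hrw : g.r + 1 < 2 ^ E.w := by
      have := L.big'
      have := L.n_le_N
      omega
    refine Tri.cond (by simp) (by simp; omega) (fun _ => ?_) fun hne => absurd hne (by simp [hact])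
    have hdeg : E.ans .inDeg g.r 0 = (A.inn ⟨g.r, hrn⟩).length := by
      rw [hA]; exact answer_inDeg A ⟨g.r, hrn⟩ 0
    refine Tri.seq (Tri.cond (by simp) (by simp; omega) (fun hd => ?_) fun hd => ?_)
    · simp only [Expr.eval_ask, Expr.eval_var, Expr.eval_zero, Expr.eval_one, hr, hdeg] at hd
      obtain ⟨h1, h2, h3⟩ := hI.root (c := L.c) hst hrn (by omega) rfl
      refine Tri.seq (Tri.assign (by simp) (Tri.seq (Tri.assign (by simp) (Tri.seq
        (Tri.assign (by simp; omega) (Tri.emit (by simp) (Tri.assign (by simp [hr]; omega)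
        ⟨_, ⟨h1, ?_, ?_, ?_, ?_, ?_, ?_, ?_⟩, by omega⟩)))))))
      · exact ((((hP.set _ _ (by norm_num)).set _ _ (by norm_num)).set _ _ (by norm_num)).say _).set
          _ _ (by norm_num)
      · exact hD
      · exact hV
      · simp [hO, hr]
      · simp [hr]
      · simp
      · rintro u st hu
        obtain ⟨rfl, rfl⟩ := List.cons.inj hu
        exact ⟨by simp [hr], by simpa using h3.symm⟩
    · simp only [Expr.eval_ask, Expr.eval_var, Expr.eval_zero, Expr.eval_one, hr, hdeg] at hd
      obtain ⟨h1, h2⟩ := hI.skip (c := L.c) hrn (by omega)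
      refine Tri.skip (Tri.assign (by simp [hr]; omega)
        ⟨_, ⟨h1, hP.set _ _ (by norm_num), hD, hV, hO, by simp [hr], by simp [hact, hst], ?_⟩,
          by omega⟩)
      intro u st hu
      rw [show g.st = u :: st from hu] at hst
      cases hst
  | cons u st =>
    rw [hst, if_neg (by simp)] at hact
    obtain ⟨h15, h16⟩ := htop u st hst
    have hun : (u : ℕ) < L.n := by rw [hn]; exact u.2
    refine Tri.cond (by simp) (by simp; omega) (fun hne => absurd hne (by simp [hact])) fun _ => ?_
    have hodeg : E.ans .outDeg u 0 = (A.out u).length := by rw [hA, answer_outDeg]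
    have hideg : E.ans .inDeg u 0 = (A.inn u).length := by rw [hA, answer_inDeg]
    refine Tri.cond (by simp) (by simp) (fun hi => ?_) fun hi => ?_
    · simp only [Expr.eval_ask, Expr.eval_var, Expr.eval_zero, h15, h16, hodeg] at hi
      obtain ⟨v, hv⟩ : ∃ v, (A.out u)[g.nx u] = v := ⟨_, rfl⟩
      have hv' : (A.out u)[g.nx u]? = some v := by rw [List.getElem?_eq_getElem hi, hv]
      have hvn : (v : ℕ) < L.n := by rw [hn]; exact v.2
      refine Tri.seq (Tri.assign (by simp) ?_)
      simp only [Expr.eval_ask, Expr.eval_var, h15, h16, hA, answer_outHead A hv']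
      set σ1 := σ.set 18 v with hσ1
      refine Tri.seq (Tri.mono (decS_spec (σ := σ1) (hP.set _ _ (by norm_num)) hD hV hvn
        (by simp [hσ1]) (hcv v)
        (J := if g.val v = 0 then L.c v else padicValNat 2 (g.val v) + 1) ?_) ?_)
      · intro j hj hd
        split_ifs with hz
        · exact hj
        · exact Nat.lt_succ_of_le ((padicValNat_dvd_iff_le hz).1 hd)
      rintro t σ2 ⟨ht, hF, h24, y, hy, hyv⟩
      have hP1 : L.Par 14 σ1 := hP.set _ _ (by norm_num)
      have hP2 := hF.par hP1
      have hD2 := hF.dir (σ := σ1) hD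
      have f14 : σ2.v 14 = g.r := by rw [hF.v 14 (by norm_num)]; simp [hσ1, hr]
      have f15 : σ2.v 15 = u := by rw [hF.v 15 (by norm_num)]; simp [hσ1, h15]
      have f16 : σ2.v 16 = g.nx u := by rw [hF.v 16 (by norm_num)]; simp [hσ1, h16]
      have f17 : σ2.v 17 = 1 := by rw [hF.v 17 (by norm_num)]; simp [hσ1, hact]
      have f18 : σ2.v 18 = v := by rw [hF.v 18 (by norm_num)]; simp [hσ1]
      have fo : σ2.o = g.l.map Fin.val := by rw [hF.o]; exact hO
      refine Tri.cond (by simp) (by simp) (fun hz => ?_) fun hz => ?_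
      · simp only [Expr.eval_zero, Expr.eval_var, h24] at hz
        have hz : g.val v = 0 := by by_contra hz'; rw [if_neg hz'] at hz; omega
        rw [if_pos hz] at ht
        obtain ⟨h1, h2, h3⟩ := hI.enter (c := L.c) hst hi hv hz rfl
        refine Tri.seq (Tri.assign (by simp) ?_)
        simp only [Expr.eval_ask, Expr.eval_var, f15, f16, hA, answer_outMate A hv']
        refine Tri.seq (Tri.mono (writeS_spec (hP2.set _ _ (by norm_num)) hD2 hy hvn (v := v)
          (by simp [f18]) (by simp; rfl)) ?_)
        rintro t' σ3 ⟨ht', hF', hV'⟩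
        rw [Function.update_idem] at hV'
        have hP3 := hF'.par (hP2.set _ _ (by norm_num))
        refine Tri.seq (Tri.assign (by simp) (Tri.seq (Tri.assign (by simp) (Tri.emit
          (by simp) ⟨_, ⟨h1, ?_, ?_, hV', ?_, ?_, ?_, ?_⟩, by omega⟩))))
        · exact ((hP3.set _ _ (by norm_num)).set _ _ (by norm_num)).say _
        · exact hF'.dir (σ := σ2.set 19 _) hD2
        · simp [hF'.o, fo, hF'.v 18, f18]
        · simp [hF'.v 14, f14]
        · simp [hF'.v 17, f17]
        · intro a b hab
          obtain ⟨rfl, -⟩ := List.cons.inj hab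
          exact ⟨by simp [hF'.v 18, f18], by simpa using h3.symm⟩
      · simp only [Expr.eval_zero, Expr.eval_var, h24] at hz
        have hz : g.val v ≠ 0 := by intro hz'; rw [if_pos hz'] at hz; omega
        rw [if_neg hz] at ht
        obtain ⟨h1, h2⟩ := hI.dec (c := L.c) hst hi hv (by omega) rfl
        have := houtlt u
        rw [hyv (by omega)] at hy
        refine Tri.assign (by simp [f16]; omega) ⟨_, ⟨h1, hP2.set _ _ (by norm_num), hD2, hy, fo,
          by simp [f14], by simp [f17, hst], ?_⟩, by omega⟩
        intro a b hab
        have hab' : g.st = a :: b := hab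
        rw [hst] at hab'
        obtain ⟨rfl, -⟩ := List.cons.inj hab'
        exact ⟨by simp [f15], by simp [f16]⟩
    · simp only [Expr.eval_ask, Expr.eval_var, Expr.eval_zero, h15, h16, hodeg] at hi
      have hnx : g.nx u = (A.out u).length := by have := hI.nx_le u; omega
      obtain ⟨h1, h2⟩ := hI.finish (c := L.c) hst hnx
      refine Tri.cond (by simp) (by simp; omega) (fun hd => ?_) fun hd => ?_
      · simp only [Expr.eval_ask, Expr.eval_var, Expr.eval_zero, h15, hideg, Expr.eval_one] at hd
        have hnil := hI.source hst (by omega)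
        refine Tri.assign (by simp) ⟨_, ⟨h1, hP.set _ _ (by norm_num), hD, hV, hO,
          by simp [hr], by simp [hnil], ?_⟩, by omega⟩
        intro a b hab
        rw [show st = a :: b from hab] at hnil
        cases hnil
      · simp only [Expr.eval_ask, Expr.eval_var, Expr.eval_zero, h15, hideg, Expr.eval_one] at hd
        obtain ⟨u', st', rfl, hu', hnx'⟩ := hI.parent hst (by omega)
        have h3 : (A.out u').idxOf u + 1 < 2 ^ E.w := by
          have := hI.nx_le u'
          have := houtlt u'
          omega
        refine Tri.seq (Tri.mono (readS_spec hP hD hV hun h15 (hcv u)) ?_)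
        rintro t σ2 ⟨ht, hF, hm, h19⟩
        refine Tri.seq (Tri.assign (by simp) (Tri.seq (Tri.assign (by simp) (Tri.assign ?_
          ⟨_, ⟨h1, ?_, ?_, ?_, ?_, ?_, ?_, ?_⟩, by omega⟩))))
        · simp [hF.v 15, h15, h19, hA, answer_inMate A hu', h3]; omega
        · exact (((hF.par hP).set _ _ (by norm_num)).set _ _ (by norm_num)).set _ _ (by norm_num)
        · exact hF.dir hD
        · simpa [hm] using hV
        · simpa [hF.o] using hO
        · simp [hF.v 14, hr]
        · simp [hF.v 17, hact]
        · intro a b hab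
          obtain ⟨rfl, -⟩ := List.cons.inj hab
          exact ⟨by simp [hF.v 15, h15, h19, hA, answer_inHead A hu'],
            by simp [hF.v 15, h15, h19, hA, answer_inMate A hu', hnx']⟩

theorem traverseS_spec (hn : L.n = n) (hA : E.ans = answer A) (hP : L.Par 14 σ) (hD : L.Dir σ.m)
    (hV : L.Val σ.m (ini E)) (hO : σ.o = []) :
    Tri E traverseS σ fun t σ' => t ≤ 7 * pot A L.c (Cfg.init n (ini E)) + 3 ∧
      ∃ g, Inv A g ∧ g.st = [] ∧ g.r = n ∧ σ'.o = g.l.map Fin.val := by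
  have hb := L.four_lt
  have hw0 := L.w_pos
  refine Tri.seq (Tri.assign (by simp) (Tri.seq (Tri.assign (by simp) ?_)))
  refine Tri.mono (Tri.loop (L.Repr A) (fun g => 7 * pot A L.c g) (fun g τ h => ?_)
    (fun g τ h hc => ?_) (Cfg.init n (ini E)) ?_) ?_
  · have h1 := h.act
    have h2 := h.par 0 (by norm_num)
    have h3 := L.big'
    have h4 := L.n_le_N
    have : τ.v 17 ≤ 1 := by rw [h1]; split_ifs <;> omega
    simp only [Layout.val] at h2
    simp
    omega
  · exact stepS_spec hn hA h (by simpa using hc)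
  · refine ⟨Inv.init fun v => ?_, (hP.set _ _ (by norm_num)).set _ _ (by norm_num), hD, hV, hO,
      by simp [Cfg.init], by simp [Cfg.init], by simp [Cfg.init]⟩
    rw [ini, hA, answer_inDeg]
  · rintro t σ' ⟨g, h, hc, ht⟩
    refine ⟨by omega, g, h.inv, ?_, ?_, h.out⟩
    all_goals
      have h1 := h.act
      have h2 := h.par 0 (by norm_num)
      have h3 := h.inv.r_le
      have h4 := h.r
      simp only [Expr.eval_var, Expr.eval_add, h2, Layout.val, hn, h4] at hc
      split_ifs at h1 with h5
    · exact h5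
    · omega
    · omega
    · omega

end Layout

/-! ### Correctness and running time -/

section

variable {n : ℕ} {G : Digraph (Fin n)} (A : G.AdjArrays)

theorem inDeg_eq (v : Fin n) : G.inDeg v = (A.inn v).length := by
  classical
  rw [length_inn, Digraph.inDeg, Set.ncard_eq_toFinset_card']
  congr 1
  ext x
  simp

open Classical in
theorem edgeCount_eq : G.edgeCount = ∑ u, ∑ v, if G.Adj u v then 1 else 0 := by
  rw [Digraph.edgeCount, Set.ncard_eq_toFinset_card', ← Finset.sum_product',
    Finset.univ_product_univ, Finset.sum_boole, Nat.cast_id]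
  congr 1
  ext x
  simp

theorem sum_length_out : ∑ u, (A.out u).length = G.edgeCount := by
  classical
  rw [edgeCount_eq]
  refine Finset.sum_congr rfl fun u _ => ?_
  rw [Finset.sum_boole, Nat.cast_id, ← List.toFinset_card_of_nodup (A.out_nodup u)]
  congr 1
  ext x
  simp [A.mem_out]

theorem sum_length_inn : ∑ v, (A.inn v).length = G.edgeCount := by
  classical
  rw [edgeCount_eq, Finset.sum_comm]
  refine Finset.sum_congr rfl fun u _ => ?_
  rw [Finset.sum_boole, Nat.cast_id, length_inn]

end

namespace Layout

variable {E : Env} {L : Layout E} {σ : St} {n : ℕ} {G : Digraph (Fin n)} {A : G.AdjArrays}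

theorem N_eq (L : Layout E) : L.N = L.n + ∑ v ∈ Finset.range L.n, L.c v :=
  sum_start _ fun v hv => Nat.lt_succ_of_le (L.c_le v hv)

theorem sum_c (hn : L.n = n) : ∑ v ∈ Finset.range L.n, L.c v = ∑ v : Fin n, L.c v := by
  rw [hn, Fin.sum_univ_eq_sum_range]

theorem c_fin (hn : L.n = n) (hA : E.ans = answer A) (v : Fin n) :
    L.c v = ((A.inn v).length - 1).size := by
  rw [L.c_eq v (by rw [hn]; exact v.2), hA, answer_inDeg]

theorem sum_c_le (hn : L.n = n) (hA : E.ans = answer A) :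
    ∑ v : Fin n, L.c v ≤ G.edgeCount := by
  rw [← sum_length_inn A]
  refine Finset.sum_le_sum fun v _ => ?_
  rw [c_fin hn hA]
  exact (size_le_self _).trans (Nat.sub_le _ _)

theorem pot_init_le (hn : L.n = n) (hA : E.ans = answer A) :
    pot A L.c (Cfg.init n (ini E)) ≤ 4 * n + 6 * G.edgeCount := by
  have h1 : ∑ v : Fin n, weight L.c (Cfg.init n (ini E)) v ≤
      ∑ v : Fin n, (2 * (A.inn v).length + 3 * L.c v + 3) := by
    refine Finset.sum_le_sum fun v _ => ?_
    have h2 := psi_le (ini E v)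
    have h3 : ini E v ≤ (A.inn v).length := by
      rw [ini, hA, answer_inDeg]; exact Nat.sub_le _ _
    simp only [weight, Cfg.init, List.not_mem_nil, if_false]
    omega
  have h2 := sum_c_le hn hA
  simp only [Finset.sum_add_distrib, ← Finset.mul_sum, sum_length_inn, Finset.sum_const,
    Finset.card_univ, Fintype.card_fin, smul_eq_mul] at h1
  have h3 := sum_length_out A
  simp only [pot, Cfg.init, Nat.sub_zero] at h1 ⊢
  omega

/-- The program computes a topological sorting. -/
theorem mainS_spec (hn : L.n = n) (hA : E.ans = answer A) (hG : G.Acyclic) (h0 : σ.v 0 = n)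
    (h1 : σ.v 1 = E.w) (hm : σ.m = fun _ => 0) (ho : σ.o = []) :
    Tri E mainS σ fun t σ' => t ≤ 120 * (n + G.edgeCount) + 5 * 2 ^ L.h ∧
      ∃ l, G.IsTopologicalSorting l ∧ σ'.o = l.map Fin.val := by
  have hn0 := L.n_pos
  refine Tri.seq (Tri.mono (setupS_spec L (by rw [h0, hn]) h1) ?_)
  rintro t1 σ1 ⟨ht1, hP1, hm1, ho1⟩
  refine Tri.seq (Tri.mono (countS_spec L hP1 (by rw [hm1, hm])) ?_)
  rintro t2 σ2 ⟨ht2, hP2, hm2, ho2⟩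
  refine Tri.seq (Tri.mono (prefixS_spec L hP2 hm2) ?_)
  rintro t3 σ3 ⟨ht3, hP3, hN3, hm3, hz3, ho3⟩
  refine Tri.seq (Tri.mono (layoutS_spec L hP3 hN3) ?_)
  rintro t4 σ4 ⟨ht4, hP4, hm4, ho4⟩
  refine Tri.seq (Tri.mono (fillS_spec L hP4 (by rw [hm4]; exact hm3) (by rw [hm4]; exact hz3)) ?_)
  rintro t5 σ5 ⟨ht5, hP5, hF, ho5⟩
  obtain ⟨b1, b2, b3, b4, b5, b6, b7, b8, b9, b10⟩ := L.bases
  have hMS : ∀ a, L.bS ≤ L.bM + a := fun a => by omega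
  have hDM : ∀ a, L.bM ≤ L.bD + a := fun a => by omega
  have hDS : ∀ a, L.bS ≤ L.bD + a := fun a => by omega
  refine Tri.seq (Tri.mono (tableS_spec L hP5 hF.zero) ?_)
  rintro t6 σ6 ⟨ht6, hP6, htab, hm6, ho6⟩
  have hM : ∀ p < L.NC * L.h, bit σ6.m L.bM L.U p = 1 ↔ Mk L.c L.n p := by
    intro p hp
    rw [bit_congr (m := σ5.m) (hm6 _ (Or.inr (hMS _))), hF.mark p hp]
    constructor
    · rintro ⟨u, i, hu, hi, -, e⟩
      exact ⟨u, hu, i, hi, e⟩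
    · rintro ⟨u, hu, i, hi, e⟩
      exact ⟨u, i, hu, hi, Or.inl hu, e⟩
  refine Tri.seq (Tri.mono (dirS_spec L hP6 htab (fun a h1 h2 => ?_) hM) ?_)
  · rw [hm6 a (Or.inr h1)]
    exact hF.zero a (by omega) h2
  rintro t7 σ7 ⟨ht7, hP7, hD7, hm7, ho7⟩
  refine Tri.mono (traverseS_spec hn hA hP7 hD7 ?_ ?_) ?_
  · intro u hu i hi
    rw [bit_congr (m := σ5.m), hF.data u hu i hi, if_pos (Or.inl hu)]
    rw [hm7 _ (hDM _), hm6 _ (Or.inr (hDS _))]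
  · rw [ho7, ho6, ho5, ho4, ho3, ho2, ho1, ho]
  · rintro t8 σ8 ⟨ht8, g, hI, hst, hr, ho8⟩
    refine ⟨?_, g.l, hI.sorted hG hst hr, ho8⟩
    have h1 := pot_init_le hn hA
    have h2 := sum_c_le hn hA
    have h3 := L.N_eq
    rw [sum_c hn] at h3 ht2 ht5
    have h4 : L.NC ≤ L.N + 1 := by
      rw [L.NC_eq]; exact Nat.succ_le_succ (Nat.div_le_self _ _)
    omega

end Layout

/-! ### The layout for a given graph -/

section

variable {n : ℕ} {G : Digraph (Fin n)} (A : G.AdjArrays) {w : ℕ}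

theorem length_le_of_nodup {l : List (Fin n)} (h : l.Nodup) : l.length ≤ n := by
  simpa using h.length_le_card

theorem answer_le (q : Query) (u i : ℕ) : answer A q u i ≤ n := by
  rw [answer]
  split_ifs with h
  · cases q with
    | outDeg => exact length_le_of_nodup (A.out_nodup _)
    | inDeg => exact length_le_of_nodup (A.inn_nodup _)
    | outHead =>
      cases e : (A.out ⟨u, h⟩)[i]? with
      | none => simp
      | some v => simp
    | inHead =>
      cases e : (A.inn ⟨u, h⟩)[i]? with
      | none => simp
      | some v => simp
    | outMate =>
      cases e : (A.out ⟨u, h⟩)[i]? with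
      | none => simp
      | some v =>
        simpa using List.idxOf_le_length.trans (length_le_of_nodup (A.inn_nodup v))
    | inMate =>
      cases e : (A.inn ⟨u, h⟩)[i]? with
      | none => simp
      | some v =>
        simpa using List.idxOf_le_length.trans (length_le_of_nodup (A.out_nodup v))
  · exact Nat.zero_le _

end

/-- If as many chunks are put into a word of `w` bits as would fit if they had `q` bits each, then
each chunk can be given the same number of bits, between `q` and `2 * q`. -/
theorem chunk_lt {w q : ℕ} (hq : 0 < q) (hw : q ≤ w) :
    q ≤ w / (w / q) ∧ w / (w / q) < 2 * q := by
  have hk : 0 < w / q := Nat.div_pos hw hq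
  have h1 := Nat.div_add_mod w q
  have h2 := Nat.mod_lt w hq
  refine ⟨?_, ?_⟩
  · rw [Nat.le_div_iff_mul_le hk]
    exact Nat.mul_div_le w q
  · rw [Nat.div_lt_iff_lt_mul hk]
    nlinarith

theorem size_mul_le (a b : ℕ) : (a * b).size ≤ a.size + b.size := by
  rw [Nat.size_le, pow_add]
  exact Nat.mul_lt_mul'' (Nat.lt_size_self a) (Nat.lt_size_self b)

/-- The parameters of the data structure as functions of `n`, of the word length, and of the
numbers `c v` of bits of the counters. -/
structure Sizes where
  (n w : ℕ)
  c : ℕ → ℕ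
  n_pos : 0 < n
  le_w : 64 * n.size ≤ w
  c_le : ∀ i < n, c i ≤ n.size

namespace Sizes

variable (z : Sizes)

/-- The bit length of `n`. -/
def lg : ℕ := z.n.size
/-- The number of chunks in a word of the bit arrays. -/
def k : ℕ := z.w / (z.lg / 4 + 1)
/-- The number of bits of a chunk, for which there is a table of the numbers of ones. It is at least
`lg / 4`, to keep the directory small, and about at most `lg / 2`, to keep the table small. -/
def h : ℕ := z.w / z.k
/-- The number of bits of an entry of the second level of the rank directory. -/
def s : ℕ := (z.h * z.lg).size
/-- The number of these entries in a word. -/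
def kR : ℕ := z.w / z.s
/-- The number of nodes. -/
def N : ℕ := start z.c z.n (z.lg + 1)
/-- The number of chunks of marker bits. -/
def NC : ℕ := z.N / z.h + 1
/-- The address of the first level of the rank directory, which follows the pointers to the levels
and the table. -/
def bS : ℕ := z.lg + 1 + 2 ^ z.h
/-- The address of the second level of the rank directory. -/
def bR : ℕ := z.bS + (z.NC / z.lg + 1)
/-- The address of the marker bits. -/
def bM : ℕ := z.bR + (z.NC / z.kR + 1)
/-- The address of the bits of the counters. -/
def bD : ℕ := z.bM + (z.NC / z.k + 1)
/-- The end of the memory area. -/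
def sp : ℕ := z.bD + ((z.N - z.n) / (z.h * z.k) + 1)

theorem lg_pos : 0 < z.lg := Nat.size_pos.2 z.n_pos

theorem w_ge : 64 * z.lg ≤ z.w := z.le_w

theorem k_pos : 0 < z.k := Nat.div_pos (by have := z.w_ge; have := z.lg_pos; omega) (by omega)

theorem h_bounds : z.lg / 4 + 1 ≤ z.h ∧ z.h < 2 * (z.lg / 4 + 1) :=
  chunk_lt (by omega) (by have := z.w_ge; have := z.lg_pos; omega)

theorem h_pos : 0 < z.h := by have := z.h_bounds; omega

theorem h_le : z.h ≤ z.lg := by have := z.h_bounds; have := z.lg_pos; omega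

theorem s_pos : 0 < z.s := Nat.size_pos.2 (Nat.mul_pos z.h_pos z.lg_pos)

theorem s_le : z.s ≤ 2 * z.lg.size := by
  have := size_mul_le z.h z.lg
  have := Nat.size_le_size z.h_le
  rw [s]; omega

theorem s_le' : z.s ≤ 2 * z.lg := z.s_le.trans (Nat.mul_le_mul_left _ (size_le_self _))

theorem N_eq : z.N = z.n + ∑ v ∈ Finset.range z.n, z.c v :=
  sum_start _ fun v hv => Nat.lt_succ_of_le (z.c_le v hv)

theorem two_pow_lg_le : 2 ^ z.lg ≤ 2 * z.n := by
  have h : ¬ z.n.size ≤ z.lg - 1 := by have := z.lg_pos; rw [← lg]; omega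
  rw [Nat.size_le, not_lt] at h
  have := z.lg_pos
  obtain ⟨x, hx⟩ : ∃ x, z.lg = x + 1 := ⟨z.lg - 1, by omega⟩
  rw [hx, Nat.add_sub_cancel] at h
  rw [hx, pow_succ]; omega

theorem two_pow_h_le : 2 ^ z.h ≤ 2 * 2 ^ (z.lg / 2) := by
  rw [← pow_succ']
  exact Nat.pow_le_pow_right (by norm_num) (by have := z.h_bounds; omega)

theorem two_pow_h_le' : 2 ^ z.h ≤ 2 * z.n :=
  (Nat.pow_le_pow_right (by norm_num) z.h_le).trans z.two_pow_lg_le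

/-- No address or number of nodes comes near to `2 ^ w`. -/
theorem big : 16 * (z.sp + z.N + z.w) ≤ 2 ^ z.w := by
  have h1 := z.two_pow_h_le'
  have h2 : z.n < 2 ^ z.lg := Nat.lt_size_self _
  have h3 : z.lg < 2 ^ z.lg := Nat.lt_two_pow_self
  have h4 : z.N ≤ z.n + z.n * z.lg := by
    rw [N_eq]
    refine Nat.add_le_add_left ?_ _
    simpa using Finset.sum_le_card_nsmul (Finset.range z.n) z.c z.lg
      fun v hv => z.c_le v (Finset.mem_range.1 hv)
  have h5 : z.NC ≤ z.N + 1 := Nat.succ_le_succ (Nat.div_le_self _ _)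
  have h6 := Nat.div_le_self z.NC z.lg
  have h7 := Nat.div_le_self z.NC z.kR
  have h8 := Nat.div_le_self z.NC z.k
  have h9 := Nat.div_le_self (z.N - z.n) (z.h * z.k)
  have h10 : z.n * z.lg ≤ 2 ^ z.lg * 2 ^ z.lg := Nat.mul_le_mul h2.le h3.le
  have h11 : 2 ^ z.lg ≤ 2 ^ z.lg * 2 ^ z.lg := Nat.le_mul_of_pos_right _ (by positivity)
  have h12 : 512 * (2 ^ z.lg * 2 ^ z.lg) ≤ 2 ^ (z.w - 1) := by
    rw [show 512 = 2 ^ 9 by norm_num, ← pow_add, ← pow_add]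
    exact Nat.pow_le_pow_right (by norm_num) (by have := z.w_ge; have := z.lg_pos; omega)
  have h13 : 16 * z.w ≤ 2 ^ (z.w - 1) := by
    have h14 : ∀ x, 8 ≤ x → 16 * x ≤ 2 ^ (x - 1) := by
      intro x hx
      induction x, hx using Nat.le_induction with
      | base => norm_num
      | succ x hx ih =>
        obtain ⟨y, rfl⟩ : ∃ y, x = y + 1 := ⟨x - 1, by omega⟩
        simp only [Nat.add_sub_cancel, pow_succ] at ih ⊢
        omega
    exact h14 _ (by have := z.w_ge; have := z.lg_pos; omega)
  have h14 : 2 ^ z.w = 2 * 2 ^ (z.w - 1) := by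
    rw [← pow_succ']
    congr 1
    have := z.w_ge; have := z.lg_pos; omega
  have h15 : 1 ≤ 2 ^ z.lg := Nat.one_le_two_pow
  simp only [sp, bD, bM, bR, bS]
  omega

end Sizes

section

variable {n : ℕ} {G : Digraph (Fin n)} (A : G.AdjArrays) {w : ℕ}

/-- The parameters for the graph `G`. -/
def sizes (hn : 0 < n) (hw : 64 * n.size ≤ w) : Sizes where
  n := n
  w := w
  c v := (answer A .inDeg v 0 - 1).size
  n_pos := hn
  le_w := hw
  c_le _ _ := Nat.size_le_size ((Nat.sub_le _ _).trans (answer_le A _ _ _))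

/-- The environment for the graph `G`. -/
def env (hn : 0 < n) (hw : 64 * n.size ≤ w) : Env where
  w := w
  ans := answer A
  sp := (sizes A hn hw).sp
  ans_lt q u i := (answer_le A q u i).trans_lt ((Nat.lt_size_self n).trans_le
    (Nat.pow_le_pow_right (by norm_num) (by omega)))

/-- The layout for the graph `G`. -/
def layout (hn : 0 < n) (hw : 64 * n.size ≤ w) : Layout (env A hn hw) :=
  let z := sizes A hn hw
  { n := n, lg := z.lg, k := z.k, h := z.h, s := z.s, kR := z.kR
    bT := z.lg + 1, bS := z.bS, bR := z.bR, bM := z.bM, bD := z.bD, NC := z.NC, c := z.c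
    n_pos := hn
    lg_eq := rfl
    k_eq := rfl
    h_eq := rfl
    s_eq := rfl
    kR_eq := rfl
    c_eq := fun _ _ => rfl
    c_le := z.c_le
    lg_pos := z.lg_pos
    k_pos := z.k_pos
    h_pos := z.h_pos
    hk_le := Nat.div_mul_le_self _ _
    h_lt := z.h_le.trans_lt (by have := z.w_ge; have := z.lg_pos; change _ < z.w; omega)
    s_lt := z.s_le'.trans_lt (by have := z.w_ge; have := z.lg_pos; change _ < z.w; omega)
    kR_pos := Nat.div_pos (z.s_le'.trans (by have := z.w_ge; omega)) z.s_pos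
    kRs_le := Nat.div_mul_le_self _ _
    rel_lt := by rw [mul_comm]; exact Nat.lt_size_self _
    NC_eq := rfl
    bT_eq := rfl
    bS_eq := rfl
    bR_eq := rfl
    bM_eq := rfl
    bD_eq := rfl
    sp_eq := rfl
    big := z.big }

/-- The program runs in linear time, and uses no memory beyond the address `sp`. -/
theorem run_mainS (hn : 0 < n) (hw : 64 * n.size ≤ w) (hG : G.Acyclic) :
    ∃ (t : ℕ) (s : State w), Runs (answer A) mainS.compile (State.start w n) t s ∧
      (∃ l : List (Fin n), G.IsTopologicalSorting l ∧
        s.out = l.map (fun v : Fin n => BitVec.ofNat w (v : ℕ))) ∧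
      t ≤ 130 * mainS.wt * (n + G.edgeCount) ∧ s.space ≤ (sizes A hn hw).sp := by
  have hlt : n < 2 ^ w := (Nat.lt_size_self n).trans_le
    (Nat.pow_le_pow_right (by norm_num) (by omega))
  have hab : Abs (env A hn hw)
      ⟨fun x => if x = 0 then n else if x = 1 then w else 0, fun _ => 0, []⟩ (State.start w n) := by
    refine ⟨fun x _ => ?_, fun a => rfl, rfl, Nat.zero_le _⟩
    simp only [State.start]
    split_ifs
    · exact (BitVec.toNat_ofNat _ _).trans (Nat.mod_eq_of_lt hlt)
    · exact (BitVec.toNat_ofNat _ _).trans (Nat.mod_eq_of_lt Nat.lt_two_pow_self)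
    · rfl
  obtain ⟨t, t', σ', s', h1, h2, h3, h4, l, hl, ho⟩ :=
    Layout.mainS_spec (L := layout A hn hw) (n := n) (G := G) rfl rfl hG rfl rfl rfl rfl _ hab
  refine ⟨t', s', h1, ⟨l, hl, ?_⟩, ?_, h3.space⟩
  · rw [h3.out, ho, List.map_map]
    rfl
  · have h5 : 2 ^ (layout A hn hw).h ≤ 2 * n := (sizes A hn hw).two_pow_h_le'
    have h6 : t ≤ 130 * (n + G.edgeCount) := by omega
    calc t' ≤ t * mainS.wt := h2
      _ ≤ 130 * (n + G.edgeCount) * mainS.wt := Nat.mul_le_mul_right _ h6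
      _ = _ := by ring

end

/-! ### The space bound -/

theorem cube_le (x : ℕ) : x ^ 3 ≤ 4 * 2 ^ x := by
  have h : ∀ y, 4 ≤ y → y ^ 3 ≤ 4 * 2 ^ y := by
    intro y hy
    induction y, hy using Nat.le_induction with
    | base => norm_num
    | succ y hy ih => rw [pow_succ 2]; nlinarith [Nat.mul_le_mul hy hy]
  rcases Nat.lt_or_ge x 4 with h4 | h4
  · interval_cases x <;> norm_num
  · exact h x h4

theorem square_le (y : ℕ) : (2 * y + 1) ^ 2 ≤ 7 * 2 ^ y := by
  have h : ∀ y, 3 ≤ y → (2 * y + 1) ^ 2 ≤ 7 * 2 ^ y := by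
    intro y hy
    induction y, hy using Nat.le_induction with
    | base => norm_num
    | succ y hy ih => rw [pow_succ 2]; nlinarith
  rcases Nat.lt_or_ge y 3 with h3 | h3
  · interval_cases y <;> norm_num
  · exact h y h3

namespace Sizes

variable (z : Sizes)

/-- The number of bits of all counters. -/
def L : ℕ := ∑ v ∈ Finset.range z.n, z.c v

theorem lg_le_four_mul_h : z.lg ≤ 4 * z.h := by have := z.h_bounds; omega

theorem w_le_h : z.w ≤ (z.h + 1) * z.k := by
  have := Nat.lt_mul_div_succ z.w z.k_pos
  rw [mul_comm]; exact this.le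

theorem kR_pos : 0 < z.kR :=
  Nat.div_pos (z.s_le'.trans (by have := z.w_ge; omega)) z.s_pos

theorem w_le_s : z.w ≤ 2 * z.s * z.kR := by
  have h1 := Nat.lt_mul_div_succ z.w z.s_pos
  have h2 := z.kR_pos
  rw [← kR] at h1
  nlinarith [Nat.mul_le_mul_left z.s h2]

/-- A word holds `h * k ≥ w - k` marker bits, so that the fraction of `1 / (h + 1)` of the bits is
wasted at most. -/
theorem mark_words_le : z.NC / z.k * z.w ≤ z.N + z.N / z.h + z.h + 1 := by
  have h1 : z.NC / z.k * z.k ≤ z.N / z.h + 1 := Nat.div_mul_le_self _ _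
  have h2 : z.N / z.h * z.h ≤ z.N := Nat.div_mul_le_self _ _
  calc z.NC / z.k * z.w ≤ z.NC / z.k * ((z.h + 1) * z.k) := Nat.mul_le_mul_left _ z.w_le_h
    _ = z.NC / z.k * z.k * (z.h + 1) := by ring
    _ ≤ (z.N / z.h + 1) * (z.h + 1) := Nat.mul_le_mul_right _ h1
    _ = z.N / z.h * z.h + z.N / z.h + z.h + 1 := by ring
    _ ≤ _ := by omega

theorem data_words_le : (z.N - z.n) / (z.h * z.k) * z.w * z.lg ≤ z.L * z.lg + 4 * z.L := by
  set b := (z.N - z.n) / (z.h * z.k)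
  have h1 : b * (z.h * z.k) ≤ z.L := by
    have h2 : z.N - z.n = z.L := by rw [N_eq, Nat.add_sub_cancel_left, L]
    exact (Nat.div_mul_le_self _ _).trans h2.le
  calc b * z.w * z.lg ≤ b * ((z.h + 1) * z.k) * z.lg :=
        Nat.mul_le_mul_right _ (Nat.mul_le_mul_left _ z.w_le_h)
    _ = b * (z.h * z.k) * z.lg + b * z.k * z.lg := by ring
    _ ≤ z.L * z.lg + b * z.k * (4 * z.h) :=
        Nat.add_le_add (Nat.mul_le_mul_right _ h1) (Nat.mul_le_mul_left _ z.lg_le_four_mul_h)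
    _ = z.L * z.lg + 4 * (b * (z.h * z.k)) := by ring
    _ ≤ _ := by omega

/-- The second level of the directory takes `O(log log n)` bits for each chunk of `Ω(log n)`
nodes. -/
theorem rel_words_le : z.NC / z.kR * z.w ≤ 2 * z.s * (z.N / z.h + 1) := by
  calc z.NC / z.kR * z.w ≤ z.NC / z.kR * (2 * z.s * z.kR) := Nat.mul_le_mul_left _ z.w_le_s
    _ = 2 * z.s * (z.NC / z.kR * z.kR) := by ring
    _ ≤ _ := Nat.mul_le_mul_left _ (Nat.div_mul_le_self _ _)

variable {z} {κ : ℕ}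

theorem sup_words_le (hκ : z.w ≤ κ * z.lg) : z.NC / z.lg * z.w ≤ κ * (z.N / z.h + 1) := by
  calc z.NC / z.lg * z.w ≤ z.NC / z.lg * (κ * z.lg) := Nat.mul_le_mul_left _ hκ
    _ = κ * (z.NC / z.lg * z.lg) := by ring
    _ ≤ _ := Nat.mul_le_mul_left _ (Nat.div_mul_le_self _ _)

/-- The table takes about `√n` words. -/
theorem table_words_le (hκ : z.w ≤ κ * z.lg) : 2 ^ z.h * z.w * z.lg ≤ 14 * κ * 2 ^ z.lg := by
  have h1 : z.lg ≤ 2 * (z.lg / 2) + 1 := by omega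
  have h2 : 2 ^ (z.lg / 2) * 2 ^ (z.lg / 2) ≤ 2 ^ z.lg := by
    rw [← pow_add]; exact Nat.pow_le_pow_right (by norm_num) (by omega)
  have h3 : z.lg ^ 2 ≤ 7 * 2 ^ (z.lg / 2) := (Nat.pow_le_pow_left h1 2).trans (square_le _)
  calc 2 ^ z.h * z.w * z.lg ≤ 2 * 2 ^ (z.lg / 2) * (κ * z.lg) * z.lg :=
        Nat.mul_le_mul_right _ (Nat.mul_le_mul z.two_pow_h_le hκ)
    _ = 2 * κ * 2 ^ (z.lg / 2) * z.lg ^ 2 := by ring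
    _ ≤ 2 * κ * 2 ^ (z.lg / 2) * (7 * 2 ^ (z.lg / 2)) := Nat.mul_le_mul_left _ h3
    _ = 14 * κ * (2 ^ (z.lg / 2) * 2 ^ (z.lg / 2)) := by ring
    _ ≤ _ := Nat.mul_le_mul_left _ h2

/-- The marker bits, of which there is one for each node, and the bits of the counters take about
`n + L` and `L` bits. Everything else is of lower order. -/
theorem bits_le (hκ : z.w ≤ κ * z.lg) (r : ℕ) : (r + z.sp) * z.w * z.lg ≤
    (2 * z.n + 2 * z.L) * (z.lg + (4 * r * κ + 46 * κ + 28) + 16 * z.lg.size) := by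
  set Q := z.N / z.h with hQ
  have hN : z.N = z.n + z.L := z.N_eq
  have hlg := z.lg_pos
  have h2n := z.two_pow_lg_le
  have hcube : z.lg ^ 3 ≤ 8 * z.n := (cube_le _).trans (by omega)
  have hQlg : Q * z.lg ≤ 4 * z.N :=
    calc Q * z.lg ≤ Q * (4 * z.h) := Nat.mul_le_mul_left _ z.lg_le_four_mul_h
      _ = 4 * (Q * z.h) := by ring
      _ ≤ _ := Nat.mul_le_mul_left _ (Nat.div_mul_le_self _ _)
  have hsq : z.lg * z.lg ≤ z.lg ^ 3 := by
    rw [pow_succ, pow_two]; exact Nat.le_mul_of_pos_right _ hlg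
  have hlg3 : z.lg ≤ z.lg ^ 3 := (Nat.le_mul_of_pos_right _ hlg).trans hsq
  -- the registers, the pointers to the levels, and one word for each array
  have e0 : (r + z.lg + 5) * z.w * z.lg ≤ (r + 6) * κ * (8 * z.n) :=
    calc (r + z.lg + 5) * z.w * z.lg ≤ ((r + 6) * z.lg) * (κ * z.lg) * z.lg :=
          Nat.mul_le_mul_right _ (Nat.mul_le_mul (by nlinarith) hκ)
      _ = (r + 6) * κ * z.lg ^ 3 := by ring
      _ ≤ _ := Nat.mul_le_mul_left _ hcube
  have e1 := (table_words_le hκ).trans (Nat.mul_le_mul_left _ h2n)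
  have e2 : z.NC / z.lg * z.w * z.lg ≤ 4 * κ * z.N + κ * (8 * z.n) :=
    calc z.NC / z.lg * z.w * z.lg ≤ κ * (Q + 1) * z.lg :=
          Nat.mul_le_mul_right _ (sup_words_le hκ)
      _ = κ * (Q * z.lg) + κ * z.lg := by ring
      _ ≤ κ * (4 * z.N) + κ * (8 * z.n) :=
          Nat.add_le_add (Nat.mul_le_mul_left _ hQlg) (Nat.mul_le_mul_left _ (hlg3.trans hcube))
      _ = _ := by ring
  have e3 : z.NC / z.kR * z.w * z.lg ≤ 16 * z.lg.size * z.N + 4 * (8 * z.n) :=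
    calc z.NC / z.kR * z.w * z.lg ≤ 2 * z.s * (Q + 1) * z.lg :=
          Nat.mul_le_mul_right _ z.rel_words_le
      _ = 2 * z.s * (Q * z.lg) + 2 * (z.s * z.lg) := by ring
      _ ≤ 2 * (2 * z.lg.size) * (4 * z.N) + 2 * (2 * z.lg * z.lg) :=
          Nat.add_le_add (Nat.mul_le_mul (Nat.mul_le_mul_left _ z.s_le) hQlg)
            (Nat.mul_le_mul_left _ (Nat.mul_le_mul_right _ z.s_le'))
      _ = 16 * z.lg.size * z.N + 4 * (z.lg * z.lg) := by ring
      _ ≤ _ := by omega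
  have e4 : z.NC / z.k * z.w * z.lg ≤ z.N * z.lg + 4 * z.N + 2 * (8 * z.n) :=
    calc z.NC / z.k * z.w * z.lg ≤ (z.N + Q + z.h + 1) * z.lg :=
          Nat.mul_le_mul_right _ z.mark_words_le
      _ = z.N * z.lg + Q * z.lg + (z.h * z.lg + z.lg) := by ring
      _ ≤ z.N * z.lg + 4 * z.N + (z.lg * z.lg + z.lg) :=
          Nat.add_le_add (Nat.add_le_add_left hQlg _)
            (Nat.add_le_add_right (Nat.mul_le_mul_right _ z.h_le) _)
      _ ≤ _ := by omega
  have e5 := z.data_words_le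
  -- the nonlinear terms are now treated as unknowns
  have e6 : (r + z.sp) * z.w * z.lg = (r + z.lg + 5) * z.w * z.lg + 2 ^ z.h * z.w * z.lg +
      z.NC / z.lg * z.w * z.lg + z.NC / z.kR * z.w * z.lg + z.NC / z.k * z.w * z.lg +
      (z.N - z.n) / (z.h * z.k) * z.w * z.lg := by
    simp only [sp, bD, bM, bR, bS]; ring
  rw [e6, hN] at *
  have p1 := Nat.zero_le (κ * z.L)
  have p2 := Nat.zero_le (z.lg.size * z.n)
  have p3 := Nat.zero_le (z.lg.size * z.L)
  have p4 := Nat.zero_le (z.n * z.lg)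
  have p5 := Nat.zero_le (r * κ * z.L)
  have p6 := Nat.zero_le (κ * z.n)
  nlinarith

end Sizes

/-- The passage from the bound `Sizes.bits_le` to logarithms. As `log log n` is bounded from below
for `n ≥ 3`, terms of order `1 / log n` are absorbed. -/
theorem real_bound {n W b a : ℕ} (hn : 3 ≤ n)
    (h : b * n.size ≤ W * (n.size + a + 16 * n.size.size)) :
    (b : ℝ) ≤ W * (1 + (2 * a + 80 : ℕ) * (Real.logb 2 (Real.logb 2 n) / Real.logb 2 n)) := by
  have hn' : (3 : ℝ) ≤ n := by exact_mod_cast hn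
  set l := Real.logb 2 n with hl
  set ll := Real.logb 2 l with hll
  set x := n.size with hx
  have hx1 : 2 ^ (x - 1) ≤ n := by
    have : ¬ n.size ≤ x - 1 := by
      have := Nat.size_pos.2 (show 0 < n by omega)
      omega
    rw [Nat.size_le, not_lt] at this
    exact this
  have hlx : l ≤ x := by
    rw [hl, Real.logb_le_iff_le_rpow (by norm_num) (by linarith), Real.rpow_natCast]
    exact_mod_cast (Nat.lt_size_self n).le
  have hxl : (x : ℝ) ≤ l + 1 := by
    have h1 : ((x - 1 : ℕ) : ℝ) ≤ l := by
      rw [hl, Real.le_logb_iff_rpow_le (by norm_num) (by linarith), Real.rpow_natCast]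
      exact_mod_cast hx1
    have h2 : (x : ℝ) ≤ ((x - 1 : ℕ) : ℝ) + 1 := by
      exact_mod_cast (show x ≤ x - 1 + 1 by omega)
    linarith
  have hl32 : (3 / 2 : ℝ) ≤ l := by
    rw [hl, Real.le_logb_iff_rpow_le (by norm_num) (by linarith)]
    refine le_trans ?_ hn'
    have h1 : ((2 : ℝ) ^ (3 / 2 : ℝ)) ^ 2 = 8 := by
      rw [← Real.rpow_natCast, ← Real.rpow_mul (by norm_num)]; norm_num
    nlinarith [Real.rpow_nonneg (show (0 : ℝ) ≤ 2 by norm_num) (3 / 2)]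
  have hll12 : (1 / 2 : ℝ) ≤ ll := by
    rw [hll, Real.le_logb_iff_rpow_le (by norm_num) (by linarith)]
    refine le_trans ?_ hl32
    have h1 : ((2 : ℝ) ^ (1 / 2 : ℝ)) ^ 2 = 2 := by
      rw [← Real.rpow_natCast, ← Real.rpow_mul (by norm_num)]; norm_num
    nlinarith [Real.rpow_nonneg (show (0 : ℝ) ≤ 2 by norm_num) (1 / 2)]
  have hy : (x.size : ℝ) ≤ ll + 2 := by
    set y := x.size with hy
    have hy0 : 0 < y := Nat.size_pos.2 (Nat.size_pos.2 (by omega))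
    have h0 : 2 ^ (y - 1) ≤ x := by
      have : ¬ x.size ≤ y - 1 := by omega
      rwa [Nat.size_le, not_lt] at this
    have h1 : ((y - 1 : ℕ) : ℝ) ≤ Real.logb 2 x := by
      rw [Real.le_logb_iff_rpow_le (by norm_num) (by linarith), Real.rpow_natCast]
      exact_mod_cast h0
    have h2 : Real.logb 2 x ≤ 1 + ll := by
      have : (1 : ℝ) + ll = Real.logb 2 (2 * l) := by
        rw [Real.logb_mul (by norm_num) (by linarith), Real.logb_self_eq_one (by norm_num)]
      rw [this]
      exact Real.logb_le_logb_of_le (by norm_num) (by linarith) (by linarith)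
    have h3 : (y : ℝ) ≤ ((y - 1 : ℕ) : ℝ) + 1 := by
      exact_mod_cast (show y ≤ y - 1 + 1 by omega)
    linarith
  have hl0 : 0 < l := by linarith
  have hx0 : (0 : ℝ) < x := by linarith
  have h' : (b : ℝ) * x ≤ W * (x + a + 16 * x.size) := by exact_mod_cast h
  have h1 : (b : ℝ) ≤ W * (1 + (a + 16 * x.size) / x) := by
    rw [← mul_le_mul_iff_of_pos_right hx0]
    refine h'.trans (le_of_eq ?_)
    field_simp
    ring
  refine h1.trans ?_
  have hW : (0 : ℝ) ≤ W := Nat.cast_nonneg _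
  have ha : (0 : ℝ) ≤ a := Nat.cast_nonneg _
  refine mul_le_mul_of_nonneg_left (add_le_add_right ?_ 1) hW
  have h2 : ((a : ℝ) + 16 * x.size) ≤ (2 * a + 80 : ℕ) * ll := by
    push_cast
    nlinarith
  calc ((a : ℝ) + 16 * x.size) / x ≤ ((2 * a + 80 : ℕ) * ll) / l :=
        div_le_div₀ (by positivity) h2 hl0 hlx
    _ = _ := by rw [mul_div_assoc]

/-! ### The three forms of the bound -/

theorem ceil_logb_eq_size {d : ℕ} (hd : 2 ≤ d) : ⌈Real.logb 2 d⌉ = (((d - 1).size : ℕ) : ℤ) := by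
  apply le_antisymm
  · rw [Int.ceil_le, Real.logb_le_iff_le_rpow (by norm_num) (by positivity), Int.cast_natCast,
      Real.rpow_natCast]
    have := Nat.lt_size_self (d - 1)
    exact_mod_cast (show d ≤ 2 ^ (d - 1).size by omega)
  · have h : ¬ (d - 1).size ≤ (d - 1).size - 1 := by
      have := Nat.size_pos.2 (show 0 < d - 1 by omega)
      omega
    rw [Nat.size_le, not_lt] at h
    have h1 : (((d - 1).size - 1 : ℕ) : ℤ) < ⌈Real.logb 2 d⌉ := by
      rw [Int.lt_ceil, Int.cast_natCast, Real.lt_logb_iff_rpow_lt (by norm_num) (by positivity),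
        Real.rpow_natCast]
      exact_mod_cast (show 2 ^ ((d - 1).size - 1) < d by omega)
    omega

theorem inL_zero_eq {n : ℕ} (G : Digraph (Fin n)) :
    G.inL 0 = ((∑ v, (G.inDeg v - 1).size : ℕ) : ℤ) := by
  rw [Digraph.inL, Finset.sum_filter, Nat.cast_sum]
  refine Finset.sum_congr rfl fun v _ => ?_
  simp only [add_zero, Int.cast_natCast]
  split_ifs with h
  · exact ceil_logb_eq_size (by exact_mod_cast h)
  · have h1 : G.inDeg v - 1 = 0 := by omega
    simp [h1]

/-- The factor `2 / 3` is best possible: equality holds for `d = 3`. -/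
theorem three_mul_size_le (d : ℕ) : 3 * (d - 1).size ≤ 2 * d := by
  have h : ∀ d, d ≤ 2 ^ (2 * d / 3) := by
    intro d
    induction d using Nat.strong_induction_on with
    | _ d ih =>
      rcases Nat.lt_or_ge d 3 with h3 | h3
      · interval_cases d <;> norm_num
      · have h1 := ih (d - 3) (by omega)
        have h2 : 2 * d / 3 = 2 * (d - 3) / 3 + 2 := by omega
        have h3 : 1 ≤ 2 ^ (2 * (d - 3) / 3) := Nat.one_le_two_pow
        rw [h2, pow_add]
        omega
  rcases Nat.eq_zero_or_pos d with rfl | hd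
  · simp
  · have : (d - 1).size ≤ 2 * d / 3 := Nat.size_le.2 (by have := h d; omega)
    omega

/-- The number of nodes of the chain of a vertex of indegree `d`. -/
theorem one_add_size_le (d : ℕ) : (1 : ℝ) + (d - 1).size ≤ Real.logb 2 (2 + 4 * d) := by
  rw [Real.le_logb_iff_rpow_le (by norm_num) (by positivity),
    show (1 : ℝ) + (d - 1).size = ((1 + (d - 1).size : ℕ) : ℝ) by push_cast; ring,
    Real.rpow_natCast]
  have : 2 ^ (1 + (d - 1).size) ≤ 2 + 4 * d := by
    rcases Nat.eq_zero_or_pos (d - 1) with h | h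
    · simp [h]
    · have h0 := Nat.size_pos.2 h
      have h1 : ¬ (d - 1).size ≤ (d - 1).size - 1 := by omega
      rw [Nat.size_le, not_lt] at h1
      obtain ⟨x, hx⟩ : ∃ x, (d - 1).size = x + 1 := ⟨(d - 1).size - 1, by omega⟩
      rw [hx] at h1 ⊢
      rw [Nat.add_sub_cancel] at h1
      rw [show 1 + (x + 1) = x + 2 by ring, pow_add]
      omega
  exact_mod_cast this

/-- Jensen's inequality for the logarithm, by comparison with the tangent at the mean. -/
theorem sum_logb_le {n : ℕ} (hn : 0 < n) (f : Fin n → ℝ) (hf : ∀ v, 0 < f v) :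
    ∑ v, Real.logb 2 (f v) ≤ n * Real.logb 2 ((∑ v, f v) / n) := by
  have hn' : (0 : ℝ) < n := by exact_mod_cast hn
  have : Nonempty (Fin n) := ⟨⟨0, hn⟩⟩
  have hs : 0 < ∑ v, f v := Finset.sum_pos (fun v _ => hf v) Finset.univ_nonempty
  set a := (∑ v, f v) / n with ha
  have ha0 : 0 < a := div_pos hs hn'
  have h1 : ∑ v, Real.log (f v) ≤ n * Real.log a := by
    have h2 : ∑ v, (Real.log (f v) - Real.log a) ≤ ∑ v, (f v / a - 1) := by
      refine Finset.sum_le_sum fun v _ => ?_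
      rw [← Real.log_div (hf v).ne' ha0.ne']
      exact Real.log_le_sub_one_of_pos (div_pos (hf v) ha0)
    rw [Finset.sum_sub_distrib, Finset.sum_sub_distrib, ← Finset.sum_div] at h2
    simp only [Finset.sum_const, Finset.card_univ, Fintype.card_fin, nsmul_eq_mul, mul_one] at h2
    have h3 : (∑ v, f v) / a = n := by rw [ha]; field_simp
    linarith
  simp only [Real.logb]
  rw [← Finset.sum_div, ← mul_div_assoc]
  exact div_le_div_of_nonneg_right h1 (Real.log_nonneg (by norm_num))

section

variable {n : ℕ} {G : Digraph (Fin n)}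

theorem sum_inDeg (A : G.AdjArrays) : ∑ v, G.inDeg v = G.edgeCount := by
  rw [← sum_length_inn A]
  exact Finset.sum_congr rfl fun v _ => inDeg_eq A v

theorem sum_size_le_edgeCount (A : G.AdjArrays) :
    2 * (∑ v, (G.inDeg v - 1).size : ℕ) ≤ (4 / 3 : ℝ) * G.edgeCount := by
  have h : 3 * ∑ v, (G.inDeg v - 1).size ≤ 2 * G.edgeCount := by
    rw [← sum_inDeg A, Finset.mul_sum, Finset.mul_sum]
    exact Finset.sum_le_sum fun v _ => three_mul_size_le _
  have h' : (3 : ℝ) * (∑ v, (G.inDeg v - 1).size : ℕ) ≤ 2 * G.edgeCount := by exact_mod_cast h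
  linarith

theorem sum_size_le_logb (A : G.AdjArrays) (hn : 0 < n) :
    (n : ℝ) + (∑ v, (G.inDeg v - 1).size : ℕ) ≤ n * Real.logb 2 (2 + 4 * G.edgeCount / n) := by
  have hn' : (n : ℝ) ≠ 0 := by positivity
  have h1 := sum_logb_le hn (fun v => (2 : ℝ) + 4 * G.inDeg v) fun v => by positivity
  have h2 : (∑ v, ((2 : ℝ) + 4 * G.inDeg v)) / n = 2 + 4 * G.edgeCount / n := by
    rw [Finset.sum_add_distrib, ← Finset.mul_sum, ← Nat.cast_sum, sum_inDeg A]
    simp only [Finset.sum_const, Finset.card_univ, Fintype.card_fin, nsmul_eq_mul]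
    field_simp
  rw [h2] at h1
  refine le_trans ?_ h1
  have h3 : ∑ v : Fin n, ((1 : ℝ) + (G.inDeg v - 1).size) ≤
      ∑ v, Real.logb 2 (2 + 4 * G.inDeg v) := Finset.sum_le_sum fun v _ => one_add_size_le _
  refine le_trans (le_of_eq ?_) h3
  rw [Finset.sum_add_distrib]
  simp

theorem sizes_L (A : G.AdjArrays) {w : ℕ} (hn : 0 < n) (hw : 64 * n.size ≤ w) :
    (sizes A hn hw).L = ∑ v, (G.inDeg v - 1).size := by
  change ∑ v ∈ Finset.range n, (answer A .inDeg v 0 - 1).size = _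
  rw [← Fin.sum_univ_eq_sum_range (fun v => (answer A .inDeg v 0 - 1).size)]
  exact Finset.sum_congr rfl fun v _ => by rw [answer_inDeg, inDeg_eq A]

end

end TopoSort

theorem mainTheorem10 :
    ∃ (P : WordRAM.Program) (c C : ℕ) (K : ℕ → ℝ),
      ∀ (n : ℕ) (G : Digraph (Fin n)) (A : G.AdjArrays) (w : ℕ),
        1 ≤ n → G.Acyclic → c * Nat.size n ≤ w →
        ∃ (t : ℕ) (s : WordRAM.State w),
          WordRAM.Runs (WordRAM.answer A) P (WordRAM.State.start w n) t s ∧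
          (∃ l : List (Fin n), G.IsTopologicalSorting l ∧
            s.out = l.map (fun v : Fin n => BitVec.ofNat w (v : ℕ))) ∧
          t ≤ C * (n + G.edgeCount) ∧
          (3 ≤ n → ∀ κ : ℕ, w ≤ κ * Nat.size n →
            (WordRAM.bitsUsed P s : ℝ) ≤
                (2 * n + 2 * G.inL 0) *
                  (1 + K κ * (Real.logb 2 (Real.logb 2 n) / Real.logb 2 n)) ∧
            (WordRAM.bitsUsed P s : ℝ) ≤
                (2 * n + 4 / 3 * G.edgeCount) *
                  (1 + K κ * (Real.logb 2 (Real.logb 2 n) / Real.logb 2 n)) ∧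
            (WordRAM.bitsUsed P s : ℝ) ≤
                2 * n * Real.logb 2 (2 + 4 * G.edgeCount / n) *
                  (1 + K κ * (Real.logb 2 (Real.logb 2 n) / Real.logb 2 n))) := by
  refine ⟨TopoSort.mainS.compile, 64, 130 * TopoSort.mainS.wt, fun κ =>
    ((2 * (4 * TopoSort.mainS.compile.numRegs * κ + 46 * κ + 28) + 80 : ℕ) : ℝ), ?_⟩
  intro n G A w hn hG hw
  obtain ⟨t, s, h1, h2, h3, h4⟩ := TopoSort.run_mainS A hn hw hG
  refine ⟨t, s, h1, h2, h3, fun hn3 κ hκ => ?_⟩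
  have h5 := TopoSort.Sizes.bits_le (z := TopoSort.sizes A hn hw) hκ TopoSort.mainS.compile.numRegs
  rw [TopoSort.sizes_L] at h5
  have h6 := TopoSort.real_bound hn3 h5
  set Z := ∑ v, (G.inDeg v - 1).size with hZ
  set F := 1 + ((2 * (4 * TopoSort.mainS.compile.numRegs * κ + 46 * κ + 28) + 80 : ℕ) : ℝ) *
    (Real.logb 2 (Real.logb 2 n) / Real.logb 2 n) with hF
  have hF0 : 0 ≤ F := by
    have h7 : (1 : ℝ) ≤ Real.logb 2 n := by
      rw [Real.le_logb_iff_rpow_le (by norm_num) (by positivity), Real.rpow_one]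
      exact_mod_cast (show 2 ≤ n by omega)
    have h8 := Real.logb_nonneg (show (1 : ℝ) < 2 by norm_num) h7
    exact add_nonneg zero_le_one (mul_nonneg (Nat.cast_nonneg _) (div_nonneg h8 (by linarith)))
  -- the bound (a) implies the other two
  have h7 : (WordRAM.bitsUsed TopoSort.mainS.compile s : ℝ) ≤ (2 * n + 2 * Z) * F := by
    have h8 : WordRAM.bitsUsed TopoSort.mainS.compile s ≤
        (TopoSort.mainS.compile.numRegs + (TopoSort.sizes A hn hw).sp) * w :=
      Nat.mul_le_mul_right _ (Nat.add_le_add_left h4 _)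
    refine (Nat.cast_le.2 h8).trans (h6.trans (le_of_eq ?_))
    push_cast
    rfl
  refine ⟨?_, h7.trans ?_, h7.trans ?_⟩
  · rw [TopoSort.inL_zero_eq, Int.cast_natCast]
    exact h7
  · refine mul_le_mul_of_nonneg_right ?_ hF0
    linarith [TopoSort.sum_size_le_edgeCount A]
  · refine mul_le_mul_of_nonneg_right ?_ hF0
    linarith [TopoSort.sum_size_le_logb A (show 0 < n from hn)]
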